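/- **Setting.** Let $G$ be a second countable locally compact Hausdorff group with closed, regularly related subgroups $H,K$ (there are measurable unions $E_0,E_1,\dots$ of $H:K$ double cosets with $E_0$ Haar-null such that every double coset not in $E_0$ is the intersection of the $E_j$ containing it). Let $\pi$ be a strongly continuous isometric representation of $H$ on a separable complex Banach space $\mathcal H(\pi)$ and $\gamma$ one of $K$ on $\mathcal H(\gamma)$, where $\mathcal H(\gamma)$ and $\mathcal H(\gamma^*):=\mathcal H(\gamma)^*$ are separable; $\gamma^*(k)=\gamma(k^{-1})^*$. $G/S$ denotes the space of right cosets $Sx$, $S^x=x^{-1}Sx$, and $N_{x,y}:=H^x\cap K^y$. Fix right Haar measures on $G$ and on all closed subgroups. A continuous $\rho>0$ on a group $A$ and a measure $\mu$ on $A/S$ *correspond* if $\int_A f\rho\,d\nu_A=\int_{A/S}\int_S f(sa)\,d\nu_S(s)\,d\mu(Sa)$ for all measurable $f\ge 0$; then $\mu$ is quasi-invariant. Fix quasi-invariant measures $\mu_H,\mu_K$ on $G/H,G/K$ with corresponding continuous $\rho_H,\rho_K$, and put $\lambda_H(x,t)=\rho_H(xt)/\rho_H(x)$, $\lambda_K(y,t)=\rho_K(yt)/\rho_K(y)$.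 Let $\Upsilon$ be the set of double cosets $D(x,y)=(H\times K)(x,y)\Delta$ in $G\times G$, $\Delta$ the diagonal, with the quotient $\sigma$-algebra, and let $\mu_{H,K}$ be an admissible measure on $\Upsilon$ ($\sigma$-finite, and $F$ is null iff its preimage in $G\times G$ is Haar-null). Let $\mu_{x,y}$ be quasi-invariant measures on $G/N_{x,y}$ with corresponding continuous $\rho_{x,y}$, $\lambda_{x,y}(e,t)=\rho_{x,y}(t)/\rho_{x,y}(e)$, such that $\mu_{x,y}$ depends only on $Hx,Ky$, $t\mapsto s^{-1}t$ carries $\mu_{x,y}$ to $\mu_{xs,ys}$, and $$\int_{G/H}\int_{G/K}F\,d\mu_K\,d\mu_H=\int_\Upsilon\int_{G/N_{x,y}}F(xt,yt)\,d\mu_{x,y}(t)\,d\mu_{H,K}(D(x,y))\qquad(F\ge0\text{ measurable}).$$ Let $\rho_{H^x}$ correspond to $\mu_{H^x}(E)=\mu_H(xE)$ on $G/H^x$, let $\mu_{H_{x,y}}$ on $H^x/N_{x,y}$ correspond to $\rho_{x,y}/\rho_{H^x}$, and put $$M_{x,y}^{q'/(q'-1)}=\int_{H^x/N_{x,y}}\frac{\rho_{H^x}(\alpha)/\rho_{H^x}(e)}{\lambda_{x,y}(e,\alpha)}\,d\mu_{H_{x,y}}(\alpha);$$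 define $N_{x,y}^{(p)}$ by $(N^{(p)}_{x,y})^{p/(p-1)}=\int_{K^y/N_{x,y}}\frac{\rho_{K^y}(\xi)/\rho_{K^y}(e)}{\lambda_{x,y}(e,\xi)}\,d\mu_{K_{x,y}}(\xi)$ analogously. $L_p(\pi)$ is the space of weakly Borel $f:G\to\mathcal H(\pi)$ with $f(hx)=\pi(h)f(x)$ and $\|f\|_p^p=\int_{G/H}\|f\|^p\,d\mu_H<\infty$; similarly $L_{q'}(\gamma^*)$. Let $\mathcal H_{x,y}\subseteq\mathcal H(\pi)\otimes^\sigma\mathcal H(\gamma^*)$ (projective tensor product) be the closed span of all $\pi(h)\xi\otimes\eta-\xi\otimes\gamma(k)^*\eta$ with $h\in H$, $k\in K$, $x^{-1}hx=y^{-1}ky$, and $\mathcal A_{x,y}=(\mathcal H(\pi)\otimes^\sigma\mathcal H(\gamma^*))/\mathcal H_{x,y}$, which depends only on $(x,y)\Delta$; $u\otimes_{x,y}v$ is the class of $u\otimes v$. $\underline{\mathcal B}_2$ and $\underline{\mathcal B}_2^\Delta$ are the semi-bundles over $G\times G$ and $(G\times G)/\Delta$ with fibres $\mathcal A_{x,y}$;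 a cross-section is measurable if a.e. it is the image of a strongly measurable $\mathcal H(\pi)\otimes^\sigma\mathcal H(\gamma^*)$-valued function. $L_r(\underline{\mathcal B}_2^\Delta;\mu_{H,K})$ consists of the measurable cross-sections of $\underline{\mathcal B}_2^\Delta$ whose norm is a.e. a measurable function $n$ on $\Upsilon$ with $\int n^r\,d\mu_{H,K}<\infty$, and $L_\infty(\underline{\mathcal B}_2)$ of the measurable cross-sections of $\underline{\mathcal B}_2$ with finite $\|\alpha\|_\infty=\operatorname{ess\,sup}_{G\times G}\|\alpha(x,y)\|$. For $1\le p,q'<\infty$ and $\sum_i\|f_i\|_p\|g_i\|_{q'}<\infty$ ($f_i\in L_p(\pi)$, $g_i\in L_{q'}(\gamma^*)$) let $$\Psi\Big(\sum_i f_i\otimes g_i\Big)(x,y)=\int_{G/N_{x,y}}\sum_i\frac{\lambda_H(x,t)^{1/p}\lambda_K(y,t)^{1/q'}}{\lambda_{x,y}(e,t)}\,f_i(xt)\otimes_{x,y}g_i(yt)\,d\mu_{x,y}(t),$$ and let $A_p^q$ be the range of $\Psi$. Consider the conditions * (a) $p=1$ and $\mu_K$ is finite and invariant, or $q'=1$ and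 $\mu_H$ is finite and invariant; * (b) $\mu_H$ and $\mu_K$ are finite and invariant; * (c) $p=q'=1$; * (d) $p,q'>1$, $1/p+1/q'\ge1$, for almost all $x,y$ the spaces $H^x/N_{x,y}$ and $K^y/N_{x,y}$ are compact and possess invariant measures, and $(x,y)\mapsto M_{x,y}N^{(p)}_{x,y}$ is essentially bounded. **Proposition.** In each of the cases (1), (2), (3) below, the integral defining $\Psi$ is well defined (the terms of the integrand are constant on cosets of $N_{x,y}$) and absolutely convergent for almost every $D(x,y)$. Moreover: 1. Under (a), (b) or (c), $A_p^q\subseteq L_1(\underline{\mathcal B}_2^\Delta;\mu_{H,K})$. If (b) holds, $\mu_{H,K}$ is the image of $\mu_H\times\mu_K$ in $\Upsilon$, and $1/p+1/q'>1$, then $A_p^q\subseteq L_r(\underline{\mathcal B}_2^\Delta;\mu_{H,K})$ with $1/r=1/p+1/q'-1$. 2. Under (d) with $1/p+1/q'>1$ and $1/r=1/p+1/q'-1$, every $\alpha\in A_p^q$ is a measurable cross-section of $\underline{\mathcal B}_2$, and there is a measurable $n$ on $\Upsilon$ with $\int n^r\,d\mu_{H,K}<\infty$ and $\|\alpha(x,y)\|\le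 n(D)$ for almost all $D\in\Upsilon$ and all $(x,y)\in D$. If moreover $M_{x,y}N^{(p)}_{x,y}$ depends (for almost all $D$) only on $D=D(x,y)$, then $A_p^q\subseteq L_r(\underline{\mathcal B}_2^\Delta;\mu_{H,K})$. 3. Under (d) with $1/p+1/q'=1$, $A_p^q\subseteq L_\infty(\underline{\mathcal B}_2)$ and $$\Big\|\Psi\Big(\sum_i f_i\otimes g_i\Big)\Big\|_\infty\le S\sum_i\|f_i\|_p\|g_i\|_{q'},\qquad S=\operatorname{ess\,sup}_{(x,y)}M_{x,y}N^{(p)}_{x,y}.$$ (Membership of $\alpha\in A_p^q$ in a space of cross-sections of $\underline{\mathcal B}_2^\Delta$ means that $\alpha(x,y)=\sigma((x,y)\Delta)$ on almost every double coset for a $\sigma$ in that space.) -/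

import Mathlib

open MeasureTheory
open scoped ENNReal NNReal TensorProduct Topology

noncomputable section

namespace ApqSpace

/-! ### The projective tensor product of two Banach spaces -/

section Projective

variable (V W : Type*) [NormedAddCommGroup V] [NormedSpace ℂ V]
  [NormedAddCommGroup W] [NormedSpace ℂ W]

/-- The algebraic tensor product, as a carrier for the projective norm. -/
def AlgTensor : Type _ := V ⊗[ℂ] W

instance : AddCommGroup (AlgTensor V W) := inferInstanceAs (AddCommGroup (V ⊗[ℂ] W))
instance : Module ℂ (AlgTensor V W) := inferInstanceAs (Module ℂ (V ⊗[ℂ] W))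

variable {V W}

/-- The elementary tensor in the algebraic tensor product. -/
def algTmul (v : V) (w : W) : AlgTensor V W := (v ⊗ₜ[ℂ] w : V ⊗[ℂ] W)

/-- The possible values `∑ ‖vᵢ‖ ‖wᵢ‖` for finite representations `u = ∑ vᵢ ⊗ wᵢ`. -/
def projCosts (u : AlgTensor V W) : Set ℝ :=
  {c | ∃ l : List (V × W), (l.map fun a => algTmul a.1 a.2).sum = u ∧
    c = (l.map fun a => ‖a.1‖ * ‖a.2‖).sum}

lemma projCosts_nonneg {u : AlgTensor V W} {c : ℝ} (hc : c ∈ projCosts u) : 0 ≤ c := by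
  obtain ⟨l, -, rfl⟩ := hc
  apply List.sum_nonneg
  intro a ha
  obtain ⟨b, -, rfl⟩ := List.mem_map.1 ha
  positivity

lemma projCosts_bddBelow (u : AlgTensor V W) : BddBelow (projCosts u) :=
  ⟨0, fun _ hc => projCosts_nonneg hc⟩

lemma projCosts_add {u v : AlgTensor V W} {c d : ℝ} (hc : c ∈ projCosts u)
    (hd : d ∈ projCosts v) : c + d ∈ projCosts (u + v) := by
  obtain ⟨l, rfl, rfl⟩ := hc
  obtain ⟨m, rfl, rfl⟩ := hd
  exact ⟨l ++ m, by simp, by simp⟩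

lemma projCosts_smul (r : ℂ) {u : AlgTensor V W} {c : ℝ} (hc : c ∈ projCosts u) :
    ‖r‖ * c ∈ projCosts (r • u) := by
  obtain ⟨l, rfl, rfl⟩ := hc
  refine ⟨l.map fun a => (r • a.1, a.2), ?_, ?_⟩
  · induction l with
    | nil => simp
    | cons a l ih =>
      simp only [List.map_cons, List.sum_cons, smul_add] at ih ⊢
      rw [ih]
      rfl
  · induction l with
    | nil => simp
    | cons a l ih =>
      simp only [List.map_cons, List.sum_cons, mul_add, norm_smul] at ih ⊢
      rw [ih, mul_assoc]

lemma projCosts_nonempty (u : AlgTensor V W) : (projCosts u).Nonempty := by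
  have : ∃ l : List (V × W), (l.map fun a => algTmul a.1 a.2).sum = u := by
    refine TensorProduct.induction_on (motive := fun u : V ⊗[ℂ] W =>
      ∃ l : List (V × W), (l.map fun a => algTmul a.1 a.2).sum = (u : AlgTensor V W)) u ?_ ?_ ?_
    · exact ⟨[], rfl⟩
    · intro x y
      exact ⟨[(x, y)], List.sum_singleton⟩
    · rintro x y ⟨l, hl⟩ ⟨m, hm⟩
      refine ⟨l ++ m, ?_⟩
      rw [List.map_append, List.sum_append, hl, hm]
      rfl
  obtain ⟨l, hl⟩ := this
  exact ⟨_, l, hl, rfl⟩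

/-- The greatest cross-norm `‖u‖ = inf {∑ ‖vᵢ‖ ‖wᵢ‖ : u = ∑ vᵢ ⊗ wᵢ}`. -/
def projSeminorm : Seminorm ℂ (AlgTensor V W) :=
  Seminorm.ofSMulLE (fun u => sInf (projCosts u))
    (le_antisymm (csInf_le (projCosts_bddBelow _) ⟨[], rfl, by simp⟩)
      (le_csInf (projCosts_nonempty _) fun _ hc => projCosts_nonneg hc))
    (fun u v => by
      apply le_of_forall_pos_lt_add
      intro ε hε
      obtain ⟨c, hc, hc'⟩ := Real.lt_sInf_add_pos (projCosts_nonempty u) (half_pos hε)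
      obtain ⟨d, hd, hd'⟩ := Real.lt_sInf_add_pos (projCosts_nonempty v) (half_pos hε)
      have := csInf_le (projCosts_bddBelow _) (projCosts_add hc hd)
      linarith)
    (fun r u => by
      apply le_of_forall_pos_lt_add
      intro ε hε
      have hr : (0 : ℝ) < ‖r‖ + 1 := by positivity
      obtain ⟨c, hc, hc'⟩ := Real.lt_sInf_add_pos (projCosts_nonempty u) (div_pos hε hr)
      have h1 := csInf_le (projCosts_bddBelow _) (projCosts_smul r hc)
      have h2 : ‖r‖ * c ≤ ‖r‖ * (sInf (projCosts u) + ε / (‖r‖ + 1)) :=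
        mul_le_mul_of_nonneg_left hc'.le (norm_nonneg r)
      have h3 : ‖r‖ * (ε / (‖r‖ + 1)) < ε := by
        rw [mul_div_assoc', div_lt_iff₀ hr]
        nlinarith
      rw [mul_add] at h2
      linarith)

instance : SeminormedAddCommGroup (AlgTensor V W) :=
  (projSeminorm (V := V) (W := W)).toAddGroupSeminorm.toSeminormedAddCommGroup

instance : NormedSpace ℂ (AlgTensor V W) where
  norm_smul_le r u := le_of_eq (map_smul_eq_mul (projSeminorm (V := V) (W := W)) r u)

variable (V W)

/-- The projective tensor product of two Banach spaces: the completion of the algebraic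
tensor product for the greatest cross-norm. -/
abbrev ProjTensor : Type _ := UniformSpace.Completion (AlgTensor V W)

variable {V W}

/-- The elementary tensor `v ⊗ w` in the projective tensor product. -/
def tmul (v : V) (w : W) : ProjTensor V W := (algTmul v w : AlgTensor V W)

end Projective

/-! ### Right coset spaces, Haar measures and quasi-invariant measures -/

section Cosets

variable {A : Type*} [Group A]

/-- The space of right cosets `S a`, with the quotient topology and the quotient
`σ`-algebra. -/
abbrev RCoset (S : Subgroup A) : Type _ := Quotient (QuotientGroup.rightRel S)

/-- The coset `S a`. -/
abbrev RCoset.mk (S : Subgroup A) (a : A) : RCoset S := Quotient.mk (QuotientGroup.rightRel S) a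

/-- The right translation `S a ↦ S a s`. -/
def RCoset.translate (S : Subgroup A) (s : A) : RCoset S → RCoset S :=
  Quotient.map (fun a => a * s) (by
    intro a b hab
    have h : b * a⁻¹ ∈ S := QuotientGroup.rightRel_apply.1 hab
    refine QuotientGroup.rightRel_apply.2 ?_
    simpa [mul_assoc] using h)

/-- The conjugate subgroup `S^x = x⁻¹ S x`. -/
def conj (S : Subgroup A) (x : A) : Subgroup A := S.comap (MulAut.conj x).toMonoidHom

/-- The subgroup `H^x ∩ K^y`. -/
def stab (H K : Subgroup A) (x y : A) : Subgroup A := conj H x ⊓ conj K y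

/-- A measure on a right coset space that is invariant under right translations. -/
def IsInvariant [MeasurableSpace A] {S : Subgroup A} (m : Measure (RCoset S)) : Prop :=
  ∀ s : A, m.map (RCoset.translate S s) = m

/-- The right coset space possesses a (nonzero, locally finite) invariant measure. -/
def HasInvariantMeasure [TopologicalSpace A] [MeasurableSpace A] (S : Subgroup A) : Prop :=
  ∃ m : Measure (RCoset S), m ≠ 0 ∧ IsFiniteMeasureOnCompacts m ∧ IsInvariant m

variable [TopologicalSpace A] [IsTopologicalGroup A]

instance instClosedConj (S : Subgroup A) [hS : IsClosed (S : Set A)] (x : A) :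
    IsClosed (conj S x : Set A) :=
  hS.preimage (f := fun t => x * t * x⁻¹) (by fun_prop)

instance instClosedStab (H K : Subgroup A) [hH : IsClosed (H : Set A)]
    [hK : IsClosed (K : Set A)] (x y : A) : IsClosed (stab H K x y : Set A) :=
  (instClosedConj H x).inter (instClosedConj K y)

instance instLocallyCompactSubgroup [LocallyCompactSpace A] (S : Subgroup A)
    [hS : IsClosed (S : Set A)] : LocallyCompactSpace S :=
  hS.locallyCompactSpace

/-- A fixed right Haar measure on a locally compact group. -/
def rightHaar (A : Type*) [Group A] [TopologicalSpace A] [IsTopologicalGroup A]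
    [LocallyCompactSpace A] [MeasurableSpace A] [BorelSpace A] : Measure A :=
  (Measure.haar : Measure A).inv

/-- `ρ` is a continuous strictly positive `ρ`-function for the subgroup `S` of `A`, and `μ` is
the quasi-invariant measure on the right coset space `A / S` corresponding to it:
`∫_A f ρ dν_A = ∫_{A/S} ∫_S f (s a) dν_S(s) dμ(S a)`.
The subgroup is presented by an injection `j : L → A` with image `S`, and `νA`, `νL` are right
Haar measures on `A` and on `L ≅ S`. The formula implies `ρ (s a) = (Δ_S(s) / Δ_A(s)) ρ a` and
that `a ↦ ρ (a t) / ρ a` is the density of `E ↦ μ (E t)` with respect to `μ`. -/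
structure Corresponds {L : Type*} [MeasurableSpace A] [MeasurableSpace L]
    (S : Subgroup A) (j : L → A) (νA : Measure A) (νL : Measure L)
    (ρ : A → ℝ) (μ : Measure (RCoset S)) : Prop where
  continuous : Continuous ρ
  pos : ∀ a, 0 < ρ a
  formula : ∀ f : A → ℝ≥0∞, Measurable f →
    ∫⁻ a, f a * ENNReal.ofReal (ρ a) ∂νA = ∫⁻ z : RCoset S, ∫⁻ l, f (j l * z.out) ∂νL ∂μ

end Cosets

/-! ### Double cosets and the disintegration of the product measure -/

section Group

variable {G : Type*} [Group G]

/-- The diagonal subgroup `Δ` of `G × G`. -/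
def diag (G : Type*) [Group G] : Subgroup (G × G) :=
  ((MonoidHom.id G).prod (MonoidHom.id G)).range

/-- The space `Υ` of double cosets `(H × K) (x, y) Δ` in `G × G`, with the quotient
`σ`-algebra. -/
abbrev DCoset (H K : Subgroup G) : Type _ :=
  Quotient (DoubleCoset.setoid ((H.prod K : Subgroup (G × G)) : Set (G × G))
    ((diag G : Subgroup (G × G)) : Set (G × G)))

/-- The double coset of `w = (x, y)`. -/
abbrev DCoset.mk (H K : Subgroup G) (w : G × G) : DCoset H K :=
  Quotient.mk (DoubleCoset.setoid ((H.prod K : Subgroup (G × G)) : Set (G × G))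
    ((diag G : Subgroup (G × G)) : Set (G × G))) w

/-- The orbit map `G / (H^x ∩ K^y) → G / H × G / K`, `t ↦ (x t, y t)`. -/
def orbitMap (H K : Subgroup G) (x y : G) (t : RCoset (stab H K x y)) : RCoset H × RCoset K :=
  (RCoset.mk H (x * t.out), RCoset.mk K (y * t.out))

/-! ### The fibres of the bundles -/

section Fibres

variable {V W : Type*} [NormedAddCommGroup V] [NormedSpace ℂ V]
  [NormedAddCommGroup W] [NormedSpace ℂ W] {H K : Subgroup G}

/-- The dual representation `γ*(k) = (γ(k⁻¹))*`. -/
def dualAct (γ : K →* (W ≃ₗᵢ[ℂ] W)) (k : K) (η : StrongDual ℂ W) : StrongDual ℂ W :=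
  η.comp ((γ k⁻¹).toContinuousLinearEquiv : W →L[ℂ] W)

variable (π : H →* (V ≃ₗᵢ[ℂ] V)) (γ : K →* (W ≃ₗᵢ[ℂ] W))

/-- The elements `π^x(b) ξ ⊗ η - ξ ⊗ (γ^y(b))* η`, `b ∈ H^x ∩ K^y`; here
`b = x⁻¹ h x = y⁻¹ k y`, `π^x(b) = π(h)` and `γ^y(b) = γ(k)`. -/
def balancingSet (x y : G) : Set (ProjTensor V (StrongDual ℂ W)) :=
  {u | ∃ (h : H) (k : K) (ξ : V) (η : StrongDual ℂ W), x⁻¹ * h * x = y⁻¹ * k * y ∧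
    u = tmul (π h ξ) η - tmul ξ (η.comp ((γ k).toContinuousLinearEquiv : W →L[ℂ] W))}

/-- The subspace `H_{x,y}`. -/
def balancing (x y : G) : Submodule ℂ (ProjTensor V (StrongDual ℂ W)) :=
  (Submodule.span ℂ (balancingSet π γ x y)).topologicalClosure

lemma balancing_mul (x y s : G) : balancing π γ (x * s) (y * s) = balancing π γ x y := by
  have : balancingSet π γ (x * s) (y * s) = balancingSet π γ x y := by
    have key : ∀ (h : H) (k : K), (x * s)⁻¹ * h * (x * s) = (y * s)⁻¹ * k * (y * s) ↔
        x⁻¹ * h * x = y⁻¹ * k * y := by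
      intro h k
      have e : ∀ a g : G, (a * s)⁻¹ * g * (a * s) = s⁻¹ * (a⁻¹ * g * a) * s := by
        intro a g
        group
      rw [e, e, mul_left_inj, mul_right_inj]
    ext u
    simp only [balancingSet, Set.mem_ofPred_eq, key]
  simp [balancing, this]

instance instClosedBalancing (x y : G) :
    IsClosed (balancing π γ x y : Set (ProjTensor V (StrongDual ℂ W))) :=
  Submodule.isClosed_topologicalClosure _

/-- The Banach space `A_{x,y}`, the fibre over `(x, y)` of the semi-bundle over `G × G`. -/
abbrev Fibre (x y : G) : Type _ := ProjTensor V (StrongDual ℂ W) ⧸ balancing π γ x y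

/-- The base space `(G × G) / Δ`, consisting of the cosets `(x, y) Δ`. -/
abbrev DeltaBase (G : Type*) [Group G] : Type _ := (G × G) ⧸ diag G

/-- The subspace `H_{x,y}` depends only on the coset `(x, y) Δ`. -/
def balancingΔ : DeltaBase G → Submodule ℂ (ProjTensor V (StrongDual ℂ W)) :=
  Quotient.lift (fun w : G × G => balancing π γ w.1 w.2) (by
    rintro ⟨x, y⟩ ⟨x', y'⟩ hab
    obtain ⟨s, hs⟩ := QuotientGroup.leftRel_apply.1 hab
    obtain ⟨h1, h2⟩ : s = x⁻¹ * x' ∧ s = y⁻¹ * y' := by simpa using hs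
    have h1' : x' = x * s := by rw [h1]; group
    have h2' : y' = y * s := by rw [h2]; group
    simp only [h1', h2', balancing_mul])

instance instClosedBalancingΔ (z : DeltaBase G) :
    IsClosed (balancingΔ π γ z : Set (ProjTensor V (StrongDual ℂ W))) := by
  induction z using Quotient.inductionOn with
  | h w => exact instClosedBalancing π γ w.1 w.2

/-- The fibre over `z` of the semi-bundle over `(G × G) / Δ`; over the coset of `(x, y)` it is
`A_{x,y}`. -/
abbrev FibreΔ (z : DeltaBase G) : Type _ := ProjTensor V (StrongDual ℂ W) ⧸ balancingΔ π γ z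

end Fibres

variable [TopologicalSpace G] [IsTopologicalGroup G] [LocallyCompactSpace G]
  [MeasurableSpace G] [BorelSpace G]

/-- `H` and `K` are regularly related: there are measurable unions `E 0, E 1, …` of `H : K`
double cosets, with `E 0` a null set, such that every double coset outside `E 0` is the
intersection of the `E j` containing it. -/
def RegularlyRelated (H K : Subgroup G) : Prop :=
  ∃ E : ℕ → Set G,
    (∀ j, NullMeasurableSet (E j) (rightHaar G)) ∧
    (∀ j, ∀ h ∈ H, ∀ k ∈ K, ∀ x, h * x * k ∈ E j ↔ x ∈ E j) ∧
    rightHaar G (E 0) = 0 ∧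
    ∀ x, x ∉ E 0 → DoubleCoset.doubleCoset x H K = ⋂ j ∈ {j | x ∈ E j}, E j

/-- The measure `μ_{S^x}(E) = μ_S (x E)` on `G / S^x`. -/
def conjMeasure (S : Subgroup G) (μ : Measure (RCoset S)) (x : G) :
    Measure (RCoset (conj S x)) :=
  μ.map fun z => RCoset.mk (conj S x) (x⁻¹ * z.out)

/-- The choice of measures that enters the construction of the convolution. -/
structure CosetMeasures (H K : Subgroup G) [IsClosed (H : Set G)] [IsClosed (K : Set G)] where
  /-- quasi-invariant measures on `G / H` and `G / K`, with their continuous `ρ`-functions -/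
  ρH : G → ℝ
  ρK : G → ℝ
  μH : Measure (RCoset H)
  μK : Measure (RCoset K)
  sigmaFiniteH : SigmaFinite μH
  sigmaFiniteK : SigmaFinite μK
  corrH : Corresponds H ((↑) : H → G) (rightHaar G) (rightHaar H) ρH μH
  corrK : Corresponds K ((↑) : K → G) (rightHaar G) (rightHaar K) ρK μK
  /-- the `ρ`-functions of the measures `μ_{H^x}` and `μ_{K^y}` -/
  ρHx : G → G → ℝ
  ρKy : G → G → ℝ
  corrHx : ∀ x, Corresponds (conj H x) ((↑) : conj H x → G) (rightHaar G)
    (rightHaar (conj H x)) (ρHx x) (conjMeasure H μH x)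
  corrKy : ∀ y, Corresponds (conj K y) ((↑) : conj K y → G) (rightHaar G)
    (rightHaar (conj K y)) (ρKy y) (conjMeasure K μK y)
  /-- quasi-invariant measures `μ_{x,y}` on `G / (H^x ∩ K^y)` with their `ρ`-functions -/
  ρ : G → G → G → ℝ
  μ : ∀ x y : G, Measure (RCoset (stab H K x y))
  corr : ∀ x y, Corresponds (stab H K x y) ((↑) : stab H K x y → G) (rightHaar G)
    (rightHaar (stab H K x y)) (ρ x y) (μ x y)
  /-- `μ_{x,y}` depends only on the cosets of `x` and `y`, and the substitution
  `t ↦ s⁻¹ t` carries `μ_{x,y}` to `μ_{xs,ys}` -/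
  equivariant : ∀ h ∈ H, ∀ k ∈ K, ∀ x y s : G,
    μ (h * x * s) (k * y * s) =
      (μ x y).map fun z => RCoset.mk (stab H K (h * x * s) (k * y * s)) (s⁻¹ * z.out)
  /-- an admissible measure `μ_{H,K}` on the space of double cosets -/
  μHK : Measure (DCoset H K)
  sigmaFiniteHK : SigmaFinite μHK
  admissible : ∀ F : Set (DCoset H K), MeasurableSet F →
    (μHK F = 0 ↔ ((rightHaar G).prod (rightHaar G)) (DCoset.mk H K ⁻¹' F) = 0)
  /-- the disintegration of `μ_H × μ_K` over the orbits of `Δ` -/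
  aemeasurable_orbit : ∀ F : RCoset H × RCoset K → ℝ≥0∞, Measurable F →
    AEMeasurable (fun D : DCoset H K =>
      ∫⁻ t, F (orbitMap H K D.out.1 D.out.2 t) ∂(μ D.out.1 D.out.2)) μHK
  disintegration : ∀ F : RCoset H × RCoset K → ℝ≥0∞, Measurable F →
    ∫⁻ u, ∫⁻ v, F (u, v) ∂μK ∂μH =
      ∫⁻ D : DCoset H K, ∫⁻ t, F (orbitMap H K D.out.1 D.out.2 t) ∂(μ D.out.1 D.out.2) ∂μHK
  /-- the quasi-invariant measures on `H^x / (H^x ∩ K^y)` and `K^y / (H^x ∩ K^y)` that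
  correspond to the `ρ`-functions `ρ_{H^x ∩ K^y} / ρ_{H^x}` and `ρ_{H^x ∩ K^y} / ρ_{K^y}` -/
  μHxy : ∀ x y : G, Measure (RCoset ((stab H K x y).subgroupOf (conj H x)))
  μKxy : ∀ x y : G, Measure (RCoset ((stab H K x y).subgroupOf (conj K y)))
  corrHxy : ∀ x y, Corresponds ((stab H K x y).subgroupOf (conj H x))
    (Subgroup.inclusion (inf_le_left : stab H K x y ≤ conj H x))
    (rightHaar (conj H x)) (rightHaar (stab H K x y))
    (fun u => ρ x y u / ρHx x u) (μHxy x y)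
  corrKxy : ∀ x y, Corresponds ((stab H K x y).subgroupOf (conj K y))
    (Subgroup.inclusion (inf_le_right : stab H K x y ≤ conj K y))
    (rightHaar (conj K y)) (rightHaar (stab H K x y))
    (fun u => ρ x y u / ρKy y u) (μKxy x y)

namespace CosetMeasures

variable {H K : Subgroup G} [IsClosed (H : Set G)] [IsClosed (K : Set G)]
  (D : CosetMeasures H K)

/-- `λ_H (x, t) = ρ_H (x t) / ρ_H (x)`. -/
def lamH (x t : G) : ℝ := D.ρH (x * t) / D.ρH x

/-- `λ_K (y, t) = ρ_K (y t) / ρ_K (y)`. -/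
def lamK (y t : G) : ℝ := D.ρK (y * t) / D.ρK y

/-- `λ_{H^x ∩ K^y} (e, t)`. -/
def lam (x y t : G) : ℝ := D.ρ x y t / D.ρ x y 1

/-- `M_{x,y}`, where `M_{x,y}^{q'/(q'-1)}` is the integral over `H^x / (H^x ∩ K^y)` of
`α ↦ λ_{H^x} (e, α) / λ_{H^x ∩ K^y} (e, α)`. -/
def M (qd : ℝ) (x y : G) : ℝ≥0∞ :=
  (∫⁻ α, ENNReal.ofReal ((D.ρHx x (α.out : conj H x) / D.ρHx x 1) / D.lam x y (α.out : conj H x))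
    ∂(D.μHxy x y)) ^ ((qd - 1) / qd)

/-- `N_{x,y}`, where `N_{x,y}^{p/(p-1)}` is the integral over `K^y / (H^x ∩ K^y)` of
`ξ ↦ λ_{K^y} (e, ξ) / λ_{H^x ∩ K^y} (e, ξ)`. -/
def N (p : ℝ) (x y : G) : ℝ≥0∞ :=
  (∫⁻ ξ, ENNReal.ofReal ((D.ρKy y (ξ.out : conj K y) / D.ρKy y 1) / D.lam x y (ξ.out : conj K y))
    ∂(D.μKxy x y)) ^ ((p - 1) / p)

/-- `G / H` has finite invariant measure (namely the chosen measure on it). -/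
def FiniteInvH : Prop := IsFiniteMeasure D.μH ∧ IsInvariant D.μH

/-- `G / K` has finite invariant measure (namely the chosen measure on it). -/
def FiniteInvK : Prop := IsFiniteMeasure D.μK ∧ IsInvariant D.μK

/-- `p = 1` and `G / K` has finite invariant measure, or `q' = 1` and `G / H` has one. -/
def CondA (p qd : ℝ) : Prop := (p = 1 ∧ D.FiniteInvK) ∨ (qd = 1 ∧ D.FiniteInvH)

/-- `G / H` and `G / K` both have finite invariant measures. -/
def CondB : Prop := D.FiniteInvK ∧ D.FiniteInvH

/-- `1 < p, q' < ∞` with `1/p + 1/q' ≥ 1`, the spaces `H^x / (H^x ∩ K^y)` and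
`K^y / (H^x ∩ K^y)` are almost always compact with invariant measure, and `M_{x,y} N_{x,y}` is
(essentially) bounded. -/
def CondD (p qd : ℝ) : Prop :=
  1 < p ∧ 1 < qd ∧ 1 ≤ 1 / p + 1 / qd ∧
  (∀ᵐ w ∂((rightHaar G).prod (rightHaar G)),
    CompactSpace (RCoset ((stab H K w.1 w.2).subgroupOf (conj H w.1))) ∧
    HasInvariantMeasure ((stab H K w.1 w.2).subgroupOf (conj H w.1)) ∧
    CompactSpace (RCoset ((stab H K w.1 w.2).subgroupOf (conj K w.2))) ∧
    HasInvariantMeasure ((stab H K w.1 w.2).subgroupOf (conj K w.2))) ∧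
  ∃ C : ℝ≥0, ∀ᵐ w ∂((rightHaar G).prod (rightHaar G)), D.M qd w.1 w.2 * D.N p w.1 w.2 ≤ C

/-- `(x, y) ↦ M_{x,y} N_{x,y}` is (almost everywhere) a function on the space of double cosets. -/
def MNDescends (p qd : ℝ) : Prop :=
  ∀ᵐ d ∂D.μHK, ∀ w w' : G × G, DCoset.mk H K w = d → DCoset.mk H K w' = d →
    D.M qd w.1 w.2 * D.N p w.1 w.2 = D.M qd w'.1 w'.2 * D.N p w'.1 w'.2

/-- `S`, the essential supremum of `M_{x,y} N_{x,y}`. -/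
def S (p qd : ℝ) : ℝ≥0∞ :=
  essSup (fun w : G × G => D.M qd w.1 w.2 * D.N p w.1 w.2) ((rightHaar G).prod (rightHaar G))

/-- `μ_{H,K}` is the image of `μ_H × μ_K` under `G / H × G / K → Υ`. -/
def IsImageMeasure : Prop :=
  ∀ F : Set (DCoset H K), MeasurableSet F →
    D.μHK F = (D.μH.prod D.μK) {w | DCoset.mk H K (w.1.out, w.2.out) ∈ F}

end CosetMeasures

/-! ### The spaces of vector valued functions -/

section Lp

variable {U : Type*} [NormedAddCommGroup U] [NormedSpace ℂ U]

/-- `‖f‖_p = (∫_{G/S} ‖f(x)‖^p dμ)^{1/p}` for a function `f` whose norm is constant on right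
cosets. -/
def lpNorm {S : Subgroup G} (μ : Measure (RCoset S)) (p : ℝ) (f : G → U) : ℝ≥0∞ :=
  (∫⁻ z : RCoset S, ‖f z.out‖ₑ ^ p ∂μ) ^ (1 / p)

/-- (Representatives of) the elements of the space of the `p`-induced representation, for the
action `act` of the subgroup `S` on `U`. -/
def InducedLp {S : Subgroup G} (act : S → U → U) (μ : Measure (RCoset S)) (p : ℝ) :
    Set (G → U) :=
  {f | (∀ φ : StrongDual ℂ U, Measurable fun x => φ (f x)) ∧
    (∀ (s : S) (x : G), f (s * x) = act s (f x)) ∧ lpNorm μ p f ≠ ∞}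

end Lp

/-! ### The bundles -/

section Bundle

variable {V W : Type*} [NormedAddCommGroup V] [NormedSpace ℂ V]
  [NormedAddCommGroup W] [NormedSpace ℂ W] {H K : Subgroup G}

variable (π : H →* (V ≃ₗᵢ[ℂ] V)) (γ : K →* (W ≃ₗᵢ[ℂ] W))

/-- Cross-sections of the semi-bundle with base `G × G`. -/
abbrev Section₂ : Type _ := ∀ w : G × G, Fibre π γ w.1 w.2

/-- Cross-sections of the semi-bundle with base `(G × G) / Δ`. -/
abbrev SectionΔ : Type _ := ∀ z : DeltaBase G, FibreΔ π γ z

/-- A cross-section over `G × G` is measurable if almost everywhere it is the image of a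
strongly measurable cross-section of the trivial bundle under the bundle quotient map. -/
def MeasurableSection₂ (α : Section₂ π γ) : Prop :=
  ∃ h : G × G → ProjTensor V (StrongDual ℂ W), StronglyMeasurable h ∧
    ∀ᵐ w ∂((rightHaar G).prod (rightHaar G)), α w = Submodule.Quotient.mk (h w)

/-- A cross-section over `(G × G) / Δ` is measurable if almost everywhere (with respect to the
image of the Haar measure class) it is the image of a strongly measurable cross-section of the
trivial bundle under the bundle quotient map. -/
def MeasurableSectionΔ (σ : SectionΔ π γ) : Prop :=
  ∃ h : DeltaBase G → ProjTensor V (StrongDual ℂ W), StronglyMeasurable h ∧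
    ∀ᵐ w ∂((rightHaar G).prod (rightHaar G)),
      σ (QuotientGroup.mk w) = Submodule.Quotient.mk (h (QuotientGroup.mk w))

variable [IsClosed (H : Set G)] [IsClosed (K : Set G)] (D : CosetMeasures H K)

/-- The `r`-th power summable cross-sections of the semi-bundle over `(G × G) / Δ`, with respect
to the measure `μ_{H,K}` on double cosets: measurable cross-sections whose norm is (almost
everywhere) a measurable function `n` of the double coset, with `∫ n^r dμ_{H,K} < ∞`. -/
def LrΔ (r : ℝ) : Set (SectionΔ π γ) :=
  {σ | MeasurableSectionΔ π γ σ ∧ ∃ n : DCoset H K → ℝ≥0∞, Measurable n ∧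
    (∀ᵐ d ∂D.μHK, ∀ w : G × G, DCoset.mk H K w = d → ‖σ (QuotientGroup.mk w)‖ₑ = n d) ∧
    ∫⁻ d, n d ^ r ∂D.μHK < ∞}

/-- The cross-sections over `G × G` that are, almost everywhere, given by an `r`-th power
summable cross-section over `(G × G) / Δ`. -/
def LrΔ₂ (r : ℝ) : Set (Section₂ π γ) :=
  {α | ∃ σ ∈ LrΔ π γ D r,
    ∀ᵐ d ∂D.μHK, ∀ w : G × G, DCoset.mk H K w = d → α w = σ (QuotientGroup.mk w)}

/-- The measurable cross-sections over `G × G` whose norm, on almost every double coset, is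
bounded by a function `n` of the double coset with `∫ n^r dμ_{H,K} < ∞`. -/
def LrDom (r : ℝ) : Set (Section₂ π γ) :=
  {α | MeasurableSection₂ π γ α ∧ ∃ n : DCoset H K → ℝ≥0∞, Measurable n ∧
    (∀ᵐ d ∂D.μHK, ∀ w : G × G, DCoset.mk H K w = d → ‖α w‖ₑ ≤ n d) ∧
    ∫⁻ d, n d ^ r ∂D.μHK < ∞}

variable {π γ} in
/-- The essential supremum over `G × G` of the norm of a cross-section. -/
def supNorm (α : Section₂ π γ) : ℝ≥0∞ :=
  essSup (fun w : G × G => ‖α w‖ₑ) ((rightHaar G).prod (rightHaar G))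

/-- The essentially bounded cross-sections of the semi-bundle over `G × G`. -/
def LInf : Set (Section₂ π γ) :=
  {α | MeasurableSection₂ π γ α ∧ supNorm α < ∞}

/-! ### The convolution and the space of its values -/

/-- Series `∑ fᵢ ⊗ gᵢ` with `∑ ‖fᵢ‖_p ‖gᵢ‖_{q'} < ∞`; they represent the elements of the
projective tensor product of the two induced spaces. -/
structure TensorSeries (p qd : ℝ) where
  f : ℕ → G → V
  g : ℕ → G → StrongDual ℂ W
  memf : ∀ i, f i ∈ InducedLp (fun h v => π h v) D.μH p
  memg : ∀ i, g i ∈ InducedLp (dualAct γ) D.μK qd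
  summable : ∑' i, lpNorm D.μH p (f i) * lpNorm D.μK qd (g i) ≠ ∞

namespace TensorSeries

variable {π γ D} {p qd : ℝ} (F : TensorSeries π γ D p qd)

/-- `∑ ‖fᵢ‖_p ‖gᵢ‖_{q'}`. -/
def cost : ℝ≥0∞ := ∑' i, lpNorm D.μH p (F.f i) * lpNorm D.μK qd (F.g i)

/-- The `i`-th term
`λ_{H^x ∩ K^y}(e,t)⁻¹ λ_H(x,t)^{1/p} λ_K(y,t)^{1/q'} fᵢ(xt) ⊗_{x,y} gᵢ(yt)`
of the integrand. -/
def term (x y : G) (i : ℕ) (t : G) : Fibre π γ x y :=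
  (((D.lam x y t)⁻¹ * D.lamH x t ^ (1 / p) * D.lamK y t ^ (1 / qd) : ℝ) : ℂ) •
    Submodule.Quotient.mk (tmul (F.f i (x * t)) (F.g i (y * t)))

/-- The convolution `Ψ (∑ fᵢ ⊗ gᵢ)`, as a cross-section over `G × G`. -/
def Psi : Section₂ π γ := fun w =>
  ∫ t : RCoset (stab H K w.1 w.2), ∑' i, F.term w.1 w.2 i t.out ∂(D.μ w.1 w.2)

/-- The defining integral makes sense and converges over almost every double coset: the terms of
the integrand are functions on `G / (H^x ∩ K^y)`, their sum converges absolutely almost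
everywhere, and it is integrable. -/
def Converges : Prop :=
  ∀ᵐ d ∂D.μHK, ∀ x y : G, DCoset.mk H K (x, y) = d →
    (∀ i, ∀ s ∈ stab H K x y, ∀ t : G, F.term x y i (s * t) = F.term x y i t) ∧
    (∀ᵐ t : RCoset (stab H K x y) ∂(D.μ x y), Summable fun i => ‖F.term x y i t.out‖) ∧
    Integrable (fun t : RCoset (stab H K x y) => ∑' i, F.term x y i t.out) (D.μ x y)

end TensorSeries

/-- The space `A_p^q`: the range of `Ψ`. -/
def Apq (p qd : ℝ) : Set (Section₂ π γ) :=
  Set.range fun F : TensorSeries π γ D p qd => F.Psi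

end Bundle

end Group

end ApqSpace

end

open ApqSpace

noncomputable section

open scoped Pointwise

set_option linter.unusedSectionVars false

namespace ApqSpace

/-! ### Locally compact second countable spaces are Polish -/

/-! The whole proof rests on one identity: on almost every double coset `λ_{x,y}(e,t) = λ_H(x,t)
λ_K(y,t)` for every `t` (`generic_lam`). Right translation by `s` preserves double cosets and
multiplies `μ_H × μ_K` by a density built from `λ_H` and `λ_K`. Disintegrations are unique, so
almost every orbit measure has the same density under translation by `s`. A dense sequence of `s`
and continuity then give all `t`. The scalar in the integrand of `Ψ` therefore collapses to the
weight `wt = λ_H^{1/p-1} λ_K^{1/q'-1}`. The integrand lives on `G/N_{x,y}` once this weight is one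
on `N_{x,y}`.

The estimate is a convolution inequality of Young type on a single orbit. The exponents `1/p + 1/q'
- 1`, `1 - 1/q'` and `1 - 1/p` add up to one. `majorant_eq` splits `wt ‖f‖ ‖g‖` into the
corresponding powers of `‖f‖^p ‖g‖^{q'}`, `‖f‖^p / λ_K` and `‖g‖^{q'} / λ_H`, and Hölder's
inequality applies (`Balanced.termBound_le`). Integration in stages through `H^x` and `K^y`
(`Corresponds.lintegral_tower`, `balanced_of_stab`) evaluates the last two integrals as multiples of
`‖f‖_p^p` and `‖g‖_{q'}^{q'}`; the multiples produce exactly `M N`. The first integral occurs to the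
power `1/r`. Its `r`-th power integrates over `Υ` by the disintegration, and Minkowski's inequality
sums the series (`exists_bound`). If `1/p + 1/q' = 1` the first factor is absent and the bound is
pointwise. Under (a), (b) or (c) the weight is identically one, and for `r = 1` Tonelli's theorem
together with finite total mass suffices (`exists_bound_one`).

Along a double coset, `Ψ` at `(hxs, kys)` is `wt(x,y,s)⁻¹` times the image of `Ψ` at `(x,y)` under a
contraction of fibres that has a contractive inverse (`Good.Psi_shift`). So if the weight is
identically one, `Ψ` descends to `(G × G)/Δ` and its norm to `Υ`. The product `M N` transforms by
the same factor (`MN_shift`). Since it is finite and nonzero, it can be constant on a double coset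
only if the weight is one there (`generic_wt_eq_one`). The same rule, with continuity in `s`, turns
an essential bound on `G × G` into a bound at every point of almost every double coset
(`generic_of_ae`, `exists_generic_MN_le`).

Two measurability questions remain. Strong measurability of `Ψ` follows by writing the orbit
measures as images of measures on `G` with jointly measurable densities (`exists_lift`,
`exists_stronglyMeasurable_Psi`). Measurability of the fibre norm follows because its sublevel sets
are countable unions of projections of closed subsets of a `σ`-compact space
(`measurable_norm_toFibre`). This needs norm continuity of `γ*`, which separability of the dual
supplies (`continuous_dualAct`). -/

theorem polishSpace_of_locallyCompact (X : Type*) [TopologicalSpace X] [LocallyCompactSpace X]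
    [SecondCountableTopology X] [T2Space X] : PolishSpace X := by
  let _ := TopologicalSpace.metrizableSpaceMetric X
  have hi : Topology.IsEmbedding ((↑) : X → UniformSpace.Completion X) :=
    UniformSpace.Completion.isUniformEmbedding_coe X |>.isEmbedding
  have hd : DenseRange ((↑) : X → UniformSpace.Completion X) :=
    UniformSpace.Completion.denseRange_coe
  have : PolishSpace (UniformSpace.Completion X) := by
    have : TopologicalSpace.SeparableSpace (UniformSpace.Completion X) :=
      hd.separableSpace hi.continuous
    have : SecondCountableTopology (UniformSpace.Completion X) :=
      UniformSpace.secondCountable_of_separable _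
    infer_instance
  -- A dense locally compact subspace of a Hausdorff space is open: a compact neighbourhood in `X`
  -- is closed in the completion, so it contains the closure of the trace of an open set, hence that
  -- open set.
  have ho : IsOpen (Set.range ((↑) : X → UniformSpace.Completion X)) := by
    rw [isOpen_iff_mem_nhds]
    rintro _ ⟨x, rfl⟩
    obtain ⟨C, hC, hx⟩ := exists_compact_mem_nhds x
    rw [hi.nhds_eq_comap, Filter.mem_comap] at hx
    obtain ⟨U, hU, hUC⟩ := hx
    obtain ⟨O, hOU, hO, hxO⟩ := mem_nhds_iff.1 hU
    refine Filter.mem_of_superset (hO.mem_nhds hxO) ?_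
    have h1 : O ⊆ closure (O ∩ Set.range ((↑) : X → UniformSpace.Completion X)) :=
      hd.open_subset_closure_inter hO
    have h2 : O ∩ Set.range ((↑) : X → UniformSpace.Completion X) ⊆ (↑) '' C := by
      rintro _ ⟨h, y, rfl⟩
      exact ⟨y, hUC (hOU h), rfl⟩
    have h3 : IsClosed (((↑) : X → UniformSpace.Completion X) '' C) :=
      (hC.image hi.continuous).isClosed
    exact (h1.trans (closure_minimal h2 h3)).trans (Set.image_subset_range _ _)
  have := ho.polishSpace
  exact hi.toHomeomorph.isClosedEmbedding.polishSpace

/-! ### Right coset spaces -/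

section Cosets

variable {A : Type*} [Group A]

theorem RCoset.mk_eq_iff {S : Subgroup A} {a b : A} :
    RCoset.mk S a = RCoset.mk S b ↔ ∃ s ∈ S, b = s * a := by
  rw [Quotient.eq, QuotientGroup.rightRel_apply]
  constructor
  · intro h
    exact ⟨_, h, by simp⟩
  · rintro ⟨s, hs, rfl⟩
    simpa using hs

theorem RCoset.mk_mul {S : Subgroup A} {s : A} (hs : s ∈ S) (a : A) :
    RCoset.mk S (s * a) = RCoset.mk S a :=
  (RCoset.mk_eq_iff.2 ⟨s, hs, rfl⟩).symm

theorem RCoset.mk_out {S : Subgroup A} (z : RCoset S) : RCoset.mk S z.out = z :=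
  Quotient.out_eq z

theorem RCoset.exists_out (S : Subgroup A) (a : A) :
    ∃ s ∈ S, (RCoset.mk S a).out = s * a :=
  RCoset.mk_eq_iff.1 (RCoset.mk_out _).symm

/-- A function on `A` that is constant on the right cosets of `S`. -/
def CosetInv {β : Type*} (S : Subgroup A) (f : A → β) : Prop :=
  ∀ s ∈ S, ∀ a, f (s * a) = f a

/-- The chosen representative differs from `a` by a left factor in `S`, so the arbitrary choice made
by `Quotient.out` disappears. This is how integrals over coset spaces become statements about
functions on the group. -/
theorem CosetInv.out {β : Type*} {S : Subgroup A} {f : A → β} (hf : CosetInv S f) (a : A) :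
    f (RCoset.mk S a).out = f a := by
  obtain ⟨s, hs, h⟩ := RCoset.exists_out S a
  rw [h, hf s hs]

theorem CosetInv.comp {β γ : Type*} {S : Subgroup A} {f : A → β} (hf : CosetInv S f)
    (g : β → γ) : CosetInv S (fun a => g (f a)) :=
  fun s hs a => congrArg g (hf s hs a)

theorem CosetInv.comp_mk {β : Type*} {S : Subgroup A} (g : RCoset S → β) :
    CosetInv S (fun a => g (RCoset.mk S a)) :=
  fun s hs a => by simp only [RCoset.mk_mul hs a]

theorem CosetInv.mul_right {β : Type*} {S : Subgroup A} {f : A → β} (hf : CosetInv S f) (t : A) :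
    CosetInv S (fun a => f (a * t)) :=
  fun s hs a => by simp only [mul_assoc, hf s hs]

theorem CosetInv.translate {β : Type*} {S : Subgroup A} {f : A → β} (hf : CosetInv S f)
    (z : RCoset S) (t : A) : f (RCoset.translate S t z).out = f (z.out * t) := by
  conv_lhs => rw [← RCoset.mk_out z]
  exact hf.out _

theorem RCoset.translate_mk (S : Subgroup A) (t a : A) :
    RCoset.translate S t (RCoset.mk S a) = RCoset.mk S (a * t) := rfl

variable [MeasurableSpace A]

theorem RCoset.measurable_mk (S : Subgroup A) : Measurable (RCoset.mk S) :=
  measurable_quotient_mk''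

theorem RCoset.measurable_iff {β : Type*} [MeasurableSpace β] {S : Subgroup A}
    {f : RCoset S → β} : Measurable f ↔ Measurable fun a => f (RCoset.mk S a) :=
  measurable_from_quotient

theorem CosetInv.measurable {β : Type*} [MeasurableSpace β] {S : Subgroup A} {f : A → β}
    (hf : CosetInv S f) (hm : Measurable f) : Measurable fun z : RCoset S => f z.out := by
  rw [RCoset.measurable_iff]
  simpa only [hf.out] using hm

theorem RCoset.measurable_translate [MeasurableMul A] (S : Subgroup A) (t : A) :
    Measurable (RCoset.translate S t) := by
  rw [RCoset.measurable_iff]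
  exact (RCoset.measurable_mk S).comp (measurable_mul_const t)

variable [TopologicalSpace A] [IsTopologicalGroup A]

theorem RCoset.isOpenQuotientMap_mk (S : Subgroup A) : IsOpenQuotientMap (RCoset.mk S) :=
  MulAction.isOpenQuotientMap_quotientMk (Γ := S) (T := A)

instance RCoset.instT2Space (S : Subgroup A) [IsClosed (S : Set A)] : T2Space (RCoset S) :=
  inferInstanceAs (T2Space (Quotient (MulAction.orbitRel S A)))

instance RCoset.instSecondCountable [SecondCountableTopology A] (S : Subgroup A) :
    SecondCountableTopology (RCoset S) :=
  ContinuousConstSMul.secondCountableTopology (Γ := S) (T := A)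

instance RCoset.instLocallyCompact [LocallyCompactSpace A] (S : Subgroup A) :
    LocallyCompactSpace (RCoset S) :=
  (RCoset.isOpenQuotientMap_mk S).locallyCompactSpace

variable [LocallyCompactSpace A] [SecondCountableTopology A] [T2Space A] [BorelSpace A]

instance RCoset.instPolishSpace (S : Subgroup A) [IsClosed (S : Set A)] :
    PolishSpace (RCoset S) :=
  polishSpace_of_locallyCompact _

/-- The quotient `σ`-algebra might a priori be larger than the Borel one. They agree because `A` is
Polish and the quotient is Hausdorff and second countable. -/
instance RCoset.instBorelSpace (S : Subgroup A) [IsClosed (S : Set A)] :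
    BorelSpace (RCoset S) :=
  have := polishSpace_of_locallyCompact A
  Quotient.borelSpace

end Cosets

/-! ### Right Haar measure -/

section Haar

variable {A : Type*} [Group A] [TopologicalSpace A] [IsTopologicalGroup A]
  [LocallyCompactSpace A] [MeasurableSpace A] [BorelSpace A]

instance rightHaar.instInvariant : (rightHaar A).IsMulRightInvariant := by
  unfold rightHaar; infer_instance

instance rightHaar.instFiniteOnCompacts : IsFiniteMeasureOnCompacts (rightHaar A) := by
  unfold rightHaar; infer_instance

instance rightHaar.instOpenPos : (rightHaar A).IsOpenPosMeasure := by
  unfold rightHaar; infer_instance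

theorem lintegral_rightHaar_mul_right (f : A → ℝ≥0∞) (t : A) :
    ∫⁻ a, f (a * t) ∂(rightHaar A) = ∫⁻ a, f a ∂(rightHaar A) :=
  lintegral_mul_right_eq_self f t

variable [SecondCountableTopology A]

instance rightHaar.instSigmaFinite : SigmaFinite (rightHaar A) := by
  unfold rightHaar; infer_instance

/-- Uniqueness of the right Haar measure. -/
theorem exists_smul_rightHaar (m : Measure A) [IsFiniteMeasureOnCompacts m]
    [m.IsMulRightInvariant] : ∃ c : ℝ≥0, m = c • rightHaar A := by
  have : m.inv.IsMulLeftInvariant := inferInstance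
  have h := Measure.isMulLeftInvariant_eq_smul m.inv (Measure.haar : Measure A)
  refine ⟨m.inv.haarScalarFactor Measure.haar,
    (Measure.inv_inv m).symm.trans ((congrArg Measure.inv h).trans ?_)⟩
  simp [rightHaar, Measure.inv, Measure.map_smul]

/-- Left translation multiplies the right Haar measure by a constant. -/
theorem exists_lintegral_mul_left_rightHaar (s : A) : ∃ c : ℝ≥0, c ≠ 0 ∧
    ∀ f : A → ℝ≥0∞, Measurable f →
      ∫⁻ a, f (s * a) ∂(rightHaar A) = c * ∫⁻ a, f a ∂(rightHaar A) := by
  have hmeas : Measurable fun a : A => s * a := measurable_const_mul s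
  -- Left and right translations commute, so the left translate is again right invariant and
  -- uniqueness applies.
  have h1 : ((rightHaar A).map fun a => s * a).IsMulRightInvariant := by
    constructor
    intro g
    rw [Measure.map_map (measurable_mul_const g) hmeas]
    have : (fun x => x * g) ∘ (fun a => s * a) = (fun a => s * a) ∘ (fun x : A => x * g) := by
      ext a; simp [mul_assoc]
    rw [this, ← Measure.map_map hmeas (measurable_mul_const g), map_mul_right_eq_self]
  have : IsFiniteMeasureOnCompacts ((rightHaar A).map fun a => s * a) :=
    Measure.IsFiniteMeasureOnCompacts.map (rightHaar A) (Homeomorph.mulLeft s)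
  obtain ⟨c, hc⟩ := exists_smul_rightHaar ((rightHaar A).map fun a => s * a)
  refine ⟨c, ?_, fun f hf => ?_⟩
  · rintro rfl
    have : (rightHaar A).map (fun a => s * a) Set.univ = 0 := by rw [hc]; simp
    rw [Measure.map_apply hmeas MeasurableSet.univ] at this
    simp at this
    exact (NeZero.ne (rightHaar A)) this
  · rw [← lintegral_map hf hmeas, hc, lintegral_smul_measure]
    rfl

end Haar

end ApqSpace

namespace ApqSpace

/-! ### Quasi-invariant measures on a coset space and their `ρ`-functions -/

section General

variable {A L : Type*} [Group A] [TopologicalSpace A] [IsTopologicalGroup A]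
  [LocallyCompactSpace A] [SecondCountableTopology A] [T2Space A] [MeasurableSpace A]
  [BorelSpace A]
  [Group L] [TopologicalSpace L] [IsTopologicalGroup L]
  [LocallyCompactSpace L] [SecondCountableTopology L] [T2Space L] [MeasurableSpace L]
  [BorelSpace L] {j : L →* A} {S : Subgroup A}

theorem cosetInv_lintegral (hS : j.range = S) (f : A → ℝ≥0∞) :
    CosetInv S fun a => ∫⁻ l, f (j l * a) ∂(rightHaar L) := by
  rintro s hs a
  rw [← hS] at hs
  obtain ⟨l0, rfl⟩ := hs
  simpa [mul_assoc] using lintegral_rightHaar_mul_right (fun l => f (j l * a)) l0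

theorem measurable_lintegral_coset (hj : Continuous j) {f : A → ℝ≥0∞} (hf : Measurable f) :
    Measurable fun a => ∫⁻ l, f (j l * a) ∂(rightHaar L) := by
  have hjm := hj.measurable
  have h : Measurable fun q : A × L => f (j q.2 * q.1) := by fun_prop
  exact h.lintegral_prod_right'

theorem measurable_lintegral_out (hj : Continuous j) (hS : j.range = S) {f : A → ℝ≥0∞}
    (hf : Measurable f) :
    Measurable fun z : RCoset S => ∫⁻ l, f (j l * z.out) ∂(rightHaar L) :=
  (cosetInv_lintegral hS f).measurable (measurable_lintegral_coset hj hf)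

/-- The mass of a translate of a compact set in a fibre is bounded. -/
theorem rightHaar_preimage_le (hj : Topology.IsClosedEmbedding j) {C : Set A} (hC : IsCompact C) :
    ∃ M : ℝ≥0, ∀ a, rightHaar L {l | j l * a ∈ C} ≤ M := by
  have hCC : IsCompact (j ⁻¹' (C * C⁻¹)) := hj.isCompact_preimage (hC.mul hC.inv)
  refine ⟨(rightHaar L (j ⁻¹' (C * C⁻¹))).toNNReal, fun a => ?_⟩
  rw [ENNReal.coe_toNNReal hCC.measure_lt_top.ne]
  by_cases h : ∃ l0, j l0 * a ∈ C
  · obtain ⟨l0, h0⟩ := h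
    -- Once the fibre over `a` meets `C` at `l0`, right translation by `l0⁻¹` moves all of its trace
    -- on `C` into the fixed compact set `C C⁻¹`. The bound therefore does not depend on `a`.
    have hsub : {l | j l * a ∈ C} ⊆ (fun l => l * l0⁻¹) ⁻¹' (j ⁻¹' (C * C⁻¹)) := by
      intro l hl
      refine ⟨j l * a, hl, (j l0 * a)⁻¹, Set.inv_mem_inv.2 h0, ?_⟩
      simp
    calc _ ≤ _ := measure_mono hsub
      _ = _ := measure_preimage_mul_right _ _ _
  · push Not at h
    simp [h]

/-- A Bruhat function: a weight on the group whose integral over every coset is one. -/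
theorem exists_bruhat (hj : Topology.IsClosedEmbedding j) (hS : j.range = S) :
    ∃ β : A → ℝ≥0∞, Measurable β ∧ ∀ a, ∫⁻ l, β (j l * a) ∂(rightHaar L) = 1 := by
  set C := compactCovering A
  have hC : ∀ n, IsCompact (C n) := isCompact_compactCovering A
  choose M hM using fun n => rightHaar_preimage_le (L := L) hj (hC n)
  obtain ⟨ε, hε0, hε⟩ := ENNReal.exists_pos_sum_of_countable' (ε := 1) one_ne_zero ℕ
  -- The weights compensate the uniform fibre bounds `M n`, so that the weighted sum of indicators
  -- has fibre integral at most `∑ ε n < 1`. The integral is positive because the sets `C n` cover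
  -- the group.
  set w : ℕ → ℝ≥0∞ := fun n => ε n / (M n + 1)
  have hw0 : ∀ n, w n ≠ 0 := fun n => by
    simp only [w]
    exact (ENNReal.div_pos (hε0 n).ne' (by simp)).ne'
  set β0 : A → ℝ≥0∞ := fun a => ∑' n, w n * (C n).indicator 1 a
  have hCm : ∀ n, MeasurableSet (C n) := fun n => (hC n).measurableSet
  have hβ0 : Measurable β0 := by
    refine Measurable.tsum fun n => ?_
    exact (measurable_one.indicator (hCm n)).const_mul _
  have hjm : Measurable j := hj.continuous.measurable
  have hset : ∀ n a, MeasurableSet {l | j l * a ∈ C n} := fun n a =>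
    (hjm.mul_const a) (hCm n)
  have hint : ∀ a, ∫⁻ l, β0 (j l * a) ∂(rightHaar L)
      = ∑' n, w n * rightHaar L {l | j l * a ∈ C n} := by
    intro a
    have hm : ∀ n, Measurable fun l => (C n).indicator (1 : A → ℝ≥0∞) (j l * a) := fun n =>
      (measurable_one.indicator (hCm n)).comp (hjm.mul_const a)
    rw [lintegral_tsum fun n => ((hm n).const_mul _).aemeasurable]
    congr 1
    ext n
    rw [lintegral_const_mul _ (hm n)]
    congr 1
    rw [← lintegral_indicator_one (hset n a)]
    rfl
  set I : A → ℝ≥0∞ := fun a => ∫⁻ l, β0 (j l * a) ∂(rightHaar L)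
  have hItop : ∀ a, I a ≠ ∞ := by
    intro a
    simp only [I]
    rw [hint]
    refine ne_of_lt (lt_of_le_of_lt (ENNReal.tsum_le_tsum fun n => ?_) (hε.trans ENNReal.one_lt_top))
    calc w n * _ ≤ w n * (M n + 1) := by
          gcongr
          exact (hM n a).trans le_self_add
      _ ≤ ε n := by rw [mul_comm]; exact ENNReal.mul_div_le
  have hI0 : ∀ a, I a ≠ 0 := by
    intro a h
    have hj0 : ∀ᵐ l ∂(rightHaar L), β0 (j l * a) = 0 :=
      (lintegral_eq_zero_iff (hβ0.comp (hjm.mul_const a))).1 h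
    obtain ⟨l, hl⟩ := hj0.exists
    simp only [β0, ENNReal.tsum_eq_zero] at hl
    obtain ⟨n, hn⟩ : ∃ n, j l * a ∈ C n := by
      have : j l * a ∈ ⋃ n, C n := by rw [iUnion_compactCovering]; trivial
      simpa using this
    have := hl n
    simp [hn, hw0 n] at this
  have hIinv : CosetInv S I := cosetInv_lintegral hS β0
  have hIm : Measurable I := measurable_lintegral_coset hj.continuous hβ0
  -- The fibre integral `I` is constant on cosets, finite and nonzero, so dividing by it normalizes
  -- every coset at once.
  refine ⟨fun a => β0 a / I a, hβ0.div hIm, fun a => ?_⟩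
  have : ∀ l, I (j l * a) = I a := fun l => hIinv _ (hS ▸ ⟨l, rfl⟩) a
  simp only [this, div_eq_mul_inv]
  rw [lintegral_mul_const _ (show Measurable fun l => β0 (j l * a) from
    hβ0.comp (hjm.mul_const a))]
  exact ENNReal.mul_inv_cancel (hI0 a) (hItop a)

/-- Continuous functions on the group that agree almost everywhere agree. -/
theorem eq_of_ae_eq_rightHaar {β : Type*} [TopologicalSpace β] [T2Space β] {f g : A → β}
    (hf : Continuous f) (hg : Continuous g) (h : ∀ᵐ a ∂(rightHaar A), f a = g a) : f = g :=
  Continuous.ae_eq_iff_eq _ hf hg |>.1 h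

variable {ρ : A → ℝ} {μ : Measure (RCoset S)}

/-- Two densities with the same integrals against all functions agree almost everywhere. -/
theorem ae_eq_of_forall_lintegral_mul {Ω : Type*} [MeasurableSpace Ω] {m : Measure Ω}
    [SigmaFinite m] {u v : Ω → ℝ≥0∞} (hu : Measurable u) (hv : Measurable v)
    (h : ∀ f : Ω → ℝ≥0∞, Measurable f → ∫⁻ a, f a * u a ∂m = ∫⁻ a, f a * v a ∂m) :
    u =ᵐ[m] v := by
  refine ae_eq_of_forall_setLIntegral_eq_of_sigmaFinite hu hv fun s hs _ => ?_
  have := h (s.indicator 1) (measurable_one.indicator hs)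
  have e : ∀ u : Ω → ℝ≥0∞, (fun a => s.indicator 1 a * u a) = s.indicator u := by
    intro u; ext a; by_cases ha : a ∈ s <;> simp [ha]
  simpa [e, lintegral_indicator hs] using this

/-- For the indicator of the preimage, the inner integral is the total mass of `L` over points of
`B` and zero elsewhere. That mass may be infinite but is nonzero, and `ρ` is positive. This moves
almost-everywhere statements between the coset space and the group. -/
theorem Corresponds.null_iff (hS : j.range = S)
    (h : Corresponds S j (rightHaar A) (rightHaar L) ρ μ)
    {B : Set (RCoset S)} (hB : MeasurableSet B) :
    μ B = 0 ↔ rightHaar A (RCoset.mk S ⁻¹' B) = 0 := by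
  have hB' : MeasurableSet (RCoset.mk S ⁻¹' B) := RCoset.measurable_mk S hB
  have hρ : Measurable fun a => ENNReal.ofReal (ρ a) := h.continuous.measurable.ennreal_ofReal
  have key := h.formula ((RCoset.mk S ⁻¹' B).indicator 1) (measurable_one.indicator hB')
  have e1 : ∀ z : RCoset S, ∫⁻ l, (RCoset.mk S ⁻¹' B).indicator (1 : A → ℝ≥0∞) (j l * z.out)
      ∂(rightHaar L) = B.indicator (fun _ => rightHaar L Set.univ) z := by
    intro z
    have : ∀ l, (RCoset.mk S ⁻¹' B).indicator (1 : A → ℝ≥0∞) (j l * z.out)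
        = B.indicator 1 z := by
      intro l
      have hz : RCoset.mk S (j l * z.out) = z := by
        rw [RCoset.mk_mul (hS ▸ ⟨l, rfl⟩), RCoset.mk_out]
      by_cases hzB : z ∈ B <;> simp [hz, hzB, Set.indicator]
    simp only [this]
    by_cases hzB : z ∈ B <;> simp [hzB]
  simp only [e1] at key
  rw [lintegral_indicator_const hB] at key
  have e2 : (fun a => (RCoset.mk S ⁻¹' B).indicator 1 a * ENNReal.ofReal (ρ a))
      = (RCoset.mk S ⁻¹' B).indicator fun a => ENNReal.ofReal (ρ a) := by
    ext a; by_cases ha : a ∈ RCoset.mk S ⁻¹' B <;> simp [Set.indicator, ha]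
  rw [e2, lintegral_indicator hB'] at key
  have hL : rightHaar L Set.univ ≠ 0 := by
    rw [Ne, Measure.measure_univ_eq_zero]; exact NeZero.ne _
  have h3 : ∫⁻ a in RCoset.mk S ⁻¹' B, ENNReal.ofReal (ρ a) ∂(rightHaar A) = 0 ↔
      rightHaar A (RCoset.mk S ⁻¹' B) = 0 := by
    rw [setLIntegral_eq_zero_iff hB' hρ, measure_eq_zero_iff_ae_notMem]
    refine Filter.eventually_congr (Filter.Eventually.of_forall fun a => ?_)
    have := not_le.2 (h.pos a)
    simp [this]
  rw [← h3, key]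
  simp [hL]

theorem Corresponds.ae_iff (hS : j.range = S)
    (h : Corresponds S j (rightHaar A) (rightHaar L) ρ μ)
    {p : RCoset S → Prop} (hp : MeasurableSet {z | p z}) :
    (∀ᵐ z ∂μ, p z) ↔ ∀ᵐ a ∂(rightHaar A), p (RCoset.mk S a) :=
  h.null_iff hS hp.compl

/-- The `ρ`-functions of a subgroup all have the same multiplier. -/
theorem exists_multiplier (S : Subgroup A) (hj : Topology.IsClosedEmbedding j) :
    ∃ χ : L → ℝ, ∀ (ρ : A → ℝ) (μ : Measure (RCoset S)),
      Corresponds S j (rightHaar A) (rightHaar L) ρ μ → ∀ l a, ρ (j l * a) = χ l * ρ a := by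
  have hl : ∀ l : L, ∃ χ : ℝ, ∀ (ρ : A → ℝ) (μ : Measure (RCoset S)),
      Corresponds S j (rightHaar A) (rightHaar L) ρ μ → ∀ a, ρ (j l * a) = χ * ρ a := by
    intro l
    -- Both constants depend only on `l`, not on `ρ` or `μ`. Substituting `a ↦ (j l)⁻¹ a` scales the
    -- two sides of the formula by them, so the multiplier is the same for all `ρ`-functions. Later,
    -- one invariant measure determines the multiplier of every other one.
    obtain ⟨cA, hcA0, hcA⟩ := exists_lintegral_mul_left_rightHaar (j l)⁻¹
    obtain ⟨cL, hcL0, hcL⟩ := exists_lintegral_mul_left_rightHaar l⁻¹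
    refine ⟨cL / cA, fun ρ μ h a => ?_⟩
    have hjm : Measurable j := hj.continuous.measurable
    have hρ : Measurable fun a => ENNReal.ofReal (ρ a) := h.continuous.measurable.ennreal_ofReal
    have key : ∀ f : A → ℝ≥0∞, Measurable f →
        ∫⁻ a, f a * (cA * ENNReal.ofReal (ρ (j l * a))) ∂(rightHaar A)
          = ∫⁻ a, f a * (cL * ENNReal.ofReal (ρ a)) ∂(rightHaar A) := by
      intro f hf
      have h1 := h.formula (fun a => f ((j l)⁻¹ * a)) (hf.comp (measurable_const_mul _))
      have h2 := hcA (fun a => f a * ENNReal.ofReal (ρ (j l * a)))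
        (hf.mul (hρ.comp (measurable_const_mul _)))
      simp only [mul_inv_cancel_left] at h2
      have h3 : ∀ z : RCoset S, ∫⁻ l', f ((j l)⁻¹ * (j l' * z.out)) ∂(rightHaar L)
          = cL * ∫⁻ l', f (j l' * z.out) ∂(rightHaar L) := by
        intro z
        rw [← hcL (fun l' => f (j l' * z.out)) (hf.comp (hjm.mul_const _))]
        simp [mul_assoc]
      simp only [h3] at h1
      rw [lintegral_const_mul' _ _ ENNReal.coe_ne_top, ← h.formula f hf] at h1
      simp only [mul_left_comm (f _)]
      rw [lintegral_const_mul' _ _ ENNReal.coe_ne_top,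
        lintegral_const_mul' _ _ ENNReal.coe_ne_top, ← h2, h1]
    have hae := ae_eq_of_forall_lintegral_mul (m := rightHaar A)
      ((hρ.comp (measurable_const_mul (j l))).const_mul _) (hρ.const_mul _) key
    have heq : (fun a => (cA : ℝ) * ρ (j l * a)) = fun a => (cL : ℝ) * ρ a := by
      have hc := h.continuous
      refine eq_of_ae_eq_rightHaar (by fun_prop) (by fun_prop) ?_
      filter_upwards [hae] with a ha
      have := congrArg ENNReal.toReal ha
      simpa [ENNReal.toReal_mul, ENNReal.toReal_ofReal (h.pos _).le] using this
    have := congrFun heq a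
    have hcA0' : (cA : ℝ) ≠ 0 := by exact_mod_cast hcA0
    field_simp
    linarith
  choose χ hχ using hl
  exact ⟨χ, fun ρ μ h l => hχ l ρ μ h⟩

/-- Integration over the coset space by integration of a Bruhat function over the group. -/
theorem Corresponds.lintegral_eq_bruhat (hj : Continuous j) (hS : j.range = S)
    (h : Corresponds S j (rightHaar A) (rightHaar L) ρ μ) {β : A → ℝ≥0∞} (hβ : Measurable β)
    (hβ1 : ∀ a, ∫⁻ l, β (j l * a) ∂(rightHaar L) = 1) {Φ : A → ℝ≥0∞} (hΦ : Measurable Φ)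
    (hinv : CosetInv S Φ) :
    ∫⁻ z : RCoset S, Φ z.out ∂μ
      = ∫⁻ a, β a * Φ a * ENNReal.ofReal (ρ a) ∂(rightHaar A) := by
  rw [h.formula (fun a => β a * Φ a) (hβ.mul hΦ)]
  congr 1
  ext z
  have : ∀ l, Φ (j l * z.out) = Φ z.out := fun l => hinv _ (hS ▸ ⟨l, rfl⟩) _
  simp only [this]
  rw [lintegral_mul_const _ (show Measurable fun l => β (j l * z.out) from
    hβ.comp (hj.measurable.mul_const _)), hβ1, one_mul]

/-- Numerator and denominator pick up the same multiplier under left translation by `S`, and it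
cancels. -/
theorem Corresponds.ratio_cosetInv (hj : Topology.IsClosedEmbedding j) (hS : j.range = S)
    (h : Corresponds S j (rightHaar A) (rightHaar L) ρ μ) (t : A) :
    CosetInv S fun a => ρ (a * t) / ρ a := by
  obtain ⟨χ, hχ⟩ := exists_multiplier S hj
  rintro s hs a
  rw [← hS] at hs
  obtain ⟨l, rfl⟩ := hs
  have h1 : χ l ≠ 0 := by
    intro h0
    have := hχ ρ μ h l 1
    rw [h0, zero_mul] at this
    exact (h.pos _).ne' this
  simp only [mul_assoc, hχ ρ μ h]
  rw [mul_div_mul_left _ _ h1]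

/-- The density of a translate of a quasi-invariant measure. -/
theorem Corresponds.lintegral_translate (hj : Topology.IsClosedEmbedding j) (hS : j.range = S)
    (h : Corresponds S j (rightHaar A) (rightHaar L) ρ μ) {Φ : A → ℝ≥0∞} (hΦ : Measurable Φ)
    (hinv : CosetInv S Φ) (t : A) :
    ∫⁻ z : RCoset S, Φ (z.out * t) ∂μ
      = ∫⁻ z : RCoset S, Φ z.out * ENNReal.ofReal (ρ (z.out * t⁻¹) / ρ z.out) ∂μ := by
  obtain ⟨β, hβ, hβ1⟩ := exists_bruhat (L := L) hj hS
  have hc := h.continuous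
  have hρm := hc.measurable
  rw [h.lintegral_eq_bruhat hj.continuous hS hβ hβ1 (Φ := fun a => Φ (a * t))
    (hΦ.comp (measurable_mul_const t)) (hinv.mul_right t)]
  rw [← lintegral_rightHaar_mul_right _ t⁻¹]
  simp only [inv_mul_cancel_right]
  have hr := h.ratio_cosetInv hj hS t⁻¹
  -- The translate `β (a * t⁻¹)` still integrates to one over every coset, so it serves as the
  -- Bruhat function for the other side.
  have h1 := h.formula (fun a => β (a * t⁻¹) * (Φ a * ENNReal.ofReal (ρ (a * t⁻¹) / ρ a)))
    (by fun_prop)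
  have e1 : ∀ a, β (a * t⁻¹) * (Φ a * ENNReal.ofReal (ρ (a * t⁻¹) / ρ a)) * ENNReal.ofReal (ρ a)
      = β (a * t⁻¹) * Φ a * ENNReal.ofReal (ρ (a * t⁻¹)) := by
    intro a
    rw [← mul_assoc, mul_assoc, ← ENNReal.ofReal_mul (div_pos (h.pos _) (h.pos _)).le,
      div_mul_cancel₀ _ (h.pos _).ne']
  simp only [e1] at h1
  rw [h1]
  congr 1
  ext z
  have e3 : ∀ l, ρ (j l * z.out * t⁻¹) / ρ (j l * z.out) = ρ (z.out * t⁻¹) / ρ z.out :=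
    fun l => hr _ (hS ▸ ⟨l, rfl⟩) z.out
  have e2 : ∀ l, Φ (j l * z.out) * ENNReal.ofReal (ρ (j l * z.out * t⁻¹) / ρ (j l * z.out))
      = Φ z.out * ENNReal.ofReal (ρ (z.out * t⁻¹) / ρ z.out) := fun l => by
    rw [hinv _ (hS ▸ ⟨l, rfl⟩), e3]
  simp only [e2]
  have hm : Measurable fun l => β (j l * z.out * t⁻¹) := by
    have := hj.continuous.measurable
    fun_prop
  rw [lintegral_mul_const _ hm]
  simp only [mul_assoc, hβ1, one_mul]

theorem IsInvariant.lintegral {m : Measure (RCoset S)} (hm : IsInvariant m) {Φ : A → ℝ≥0∞}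
    (hΦ : Measurable Φ) (hinv : CosetInv S Φ) (t : A) :
    ∫⁻ z : RCoset S, Φ (z.out * t) ∂m = ∫⁻ z : RCoset S, Φ z.out ∂m := by
  conv_rhs => rw [← hm t]
  rw [lintegral_map (hinv.measurable hΦ) (RCoset.measurable_translate S t)]
  simp only [hinv.translate]

/-- The `ρ`-function of an invariant measure is constant. -/
theorem Corresponds.const_of_isInvariant [SigmaFinite μ] (hj : Topology.IsClosedEmbedding j)
    (hS : j.range = S) (h : Corresponds S j (rightHaar A) (rightHaar L) ρ μ)
    (hm : IsInvariant μ) (a : A) : ρ a = ρ 1 := by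
  have hc := h.continuous
  have hr := h.ratio_cosetInv hj hS a
  have hmeas : Measurable fun b => ρ (b * a) / ρ b := by
    have := hc.measurable
    fun_prop
  have hmz := hr.measurable hmeas
  have key : ∀ᵐ z : RCoset S ∂μ, ENNReal.ofReal (ρ (z.out * a) / ρ z.out) = 1 := by
    refine ae_eq_of_forall_lintegral_mul hmz.ennreal_ofReal measurable_const fun f hf => ?_
    have h1 := h.lintegral_translate hj hS (Φ := fun a => f (RCoset.mk S a))
      (hf.comp (RCoset.measurable_mk S)) (CosetInv.comp_mk f) a⁻¹
    have h2 := hm.lintegral (Φ := fun a => f (RCoset.mk S a))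
      (hf.comp (RCoset.measurable_mk S)) (CosetInv.comp_mk f) a⁻¹
    rw [h1] at h2
    simpa [RCoset.mk_out] using h2
  rw [h.ae_iff hS (measurableSet_eq_fun hmz.ennreal_ofReal measurable_const)] at key
  -- The density of translation by `a⁻¹` is one almost everywhere. Continuity of `ρ` and full
  -- support of Haar measure remove the exceptional set.
  have heq : (fun b => ρ (b * a)) = ρ := by
    refine eq_of_ae_eq_rightHaar (by fun_prop) hc ?_
    filter_upwards [key] with b hb
    have e := hr.out b
    rw [e, ENNReal.ofReal_eq_one, div_eq_one_iff_eq (h.pos _).ne'] at hb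
    exact hb
  have := congrFun heq 1
  simpa using this

/-- An invariant measure on the coset space corresponds to a constant `ρ`-function. -/
theorem IsInvariant.exists_corresponds (hj : Topology.IsClosedEmbedding j) (hS : j.range = S)
    {m : Measure (RCoset S)} [IsFiniteMeasureOnCompacts m] (hm : IsInvariant m) (hm0 : m ≠ 0) :
    ∃ c : ℝ, 0 < c ∧ Corresponds S j (rightHaar A) (rightHaar L) (fun _ => c) m := by
  have hSc : IsClosed (S : Set A) := by
    rw [← hS]; exact hj.isClosed_range
  have hjm := hj.continuous.measurable
  -- Averaging the Haar measures of the fibres against `m` gives a measure `ν` on `A`. It is right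
  -- invariant because `m` is, and finite on compacts by the uniform fibre bound. Hence it is a
  -- multiple of Haar measure, and the multiple is the constant `ρ`-function.
  set κ : RCoset S → Measure A := fun z => (rightHaar L).map fun l => j l * z.out
  have hκl : ∀ (f : A → ℝ≥0∞), Measurable f → ∀ z,
      ∫⁻ a, f a ∂(κ z) = ∫⁻ l, f (j l * z.out) ∂(rightHaar L) := fun f hf z =>
    lintegral_map hf (hjm.mul_const _)
  have hκ : Measurable κ := by
    refine Measure.measurable_of_measurable_coe _ fun B hB => ?_
    have : ∀ z, κ z B = ∫⁻ l, B.indicator (1 : A → ℝ≥0∞) (j l * z.out) ∂(rightHaar L) := by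
      intro z
      rw [← hκl _ (measurable_one.indicator hB), lintegral_indicator_one hB]
    simp only [this]
    exact measurable_lintegral_out hj.continuous hS (measurable_one.indicator hB)
  set ν : Measure A := m.bind κ
  have hν : ∀ f : A → ℝ≥0∞, Measurable f →
      ∫⁻ a, f a ∂ν = ∫⁻ z : RCoset S, ∫⁻ l, f (j l * z.out) ∂(rightHaar L) ∂m := by
    intro f hf
    rw [Measure.lintegral_bind hκ.aemeasurable hf.aemeasurable]
    simp only [hκl f hf]
  have hνr : ν.IsMulRightInvariant := by
    refine ⟨fun t => Measure.ext fun B hB => ?_⟩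
    have h1 : Measurable (B.indicator (1 : A → ℝ≥0∞)) := measurable_one.indicator hB
    rw [← lintegral_indicator_one hB, ← lintegral_indicator_one hB,
      lintegral_map h1 (measurable_mul_const t), hν _ h1,
      hν (fun a => B.indicator 1 (a * t)) (h1.comp (measurable_mul_const t)),
      ← hm.lintegral (measurable_lintegral_coset hj.continuous h1) (cosetInv_lintegral hS _) t]
    simp only [mul_assoc]
  have hνc : IsFiniteMeasureOnCompacts ν := by
    refine ⟨fun C hC => ?_⟩
    obtain ⟨M, hM⟩ := rightHaar_preimage_le (L := L) hj hC
    have hmkC : IsCompact (RCoset.mk S '' C) := hC.image (RCoset.isOpenQuotientMap_mk S).continuous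
    have h1 : Measurable (C.indicator (1 : A → ℝ≥0∞)) := measurable_one.indicator hC.measurableSet
    rw [← lintegral_indicator_one hC.measurableSet, hν _ h1]
    calc ∫⁻ z : RCoset S, ∫⁻ l, C.indicator 1 (j l * z.out) ∂(rightHaar L) ∂m
        ≤ ∫⁻ z : RCoset S, (RCoset.mk S '' C).indicator (fun _ => (M : ℝ≥0∞)) z ∂m := by
          refine lintegral_mono fun z => ?_
          by_cases hz : z ∈ RCoset.mk S '' C
          · simp only [hz, Set.indicator_of_mem]
            refine le_trans (le_of_eq ?_) (hM z.out)
            exact lintegral_indicator_one (s := {l | j l * z.out ∈ C})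
              ((hjm.mul_const _) hC.measurableSet)
          · have : ∀ l, j l * z.out ∉ C := fun l hl =>
              hz ⟨_, hl, by rw [RCoset.mk_mul (hS ▸ ⟨l, rfl⟩), RCoset.mk_out]⟩
            simp [this]
      _ = M * m (RCoset.mk S '' C) := lintegral_indicator_const hmkC.measurableSet _
      _ < ∞ := ENNReal.mul_lt_top ENNReal.coe_lt_top hmkC.measure_lt_top
  obtain ⟨c, hc⟩ := exists_smul_rightHaar ν
  have hform : ∀ f : A → ℝ≥0∞, Measurable f → ∫⁻ a, f a * ENNReal.ofReal (c : ℝ) ∂(rightHaar A)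
      = ∫⁻ z : RCoset S, ∫⁻ l, f (j l * z.out) ∂(rightHaar L) ∂m := by
    intro f hf
    rw [← hν f hf, hc, lintegral_mul_const _ hf, lintegral_smul_measure, mul_comm]
    simp
    rfl
  have hc0 : 0 < (c : ℝ) := by
    rcases eq_or_ne c 0 with h0 | h0
    · exfalso
      have := hform (fun _ => 1) measurable_const
      simp only [h0, NNReal.coe_zero, ENNReal.ofReal_zero, mul_zero, lintegral_zero,
        lintegral_const, one_mul] at this
      have h2 := mul_eq_zero.1 this.symm
      simp only [Measure.measure_univ_eq_zero, hm0, or_false] at h2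
      exact NeZero.ne (rightHaar L) h2
    · exact_mod_cast pos_iff_ne_zero.2 h0
  exact ⟨c, hc0, continuous_const, fun _ => hc0, hform⟩

/-- If the coset space has an invariant measure, then all `ρ`-functions are constant on cosets. -/
theorem HasInvariantMeasure.cosetInv (hj : Topology.IsClosedEmbedding j) (hS : j.range = S)
    (hm : HasInvariantMeasure S) (h : Corresponds S j (rightHaar A) (rightHaar L) ρ μ) :
    CosetInv S ρ := by
  obtain ⟨m, hm0, hmc, hmi⟩ := hm
  obtain ⟨c, hc, hcorr⟩ := hmi.exists_corresponds (L := L) hj hS hm0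
  obtain ⟨χ, hχ⟩ := exists_multiplier S hj
  rintro s hs a
  rw [← hS] at hs
  obtain ⟨l, rfl⟩ := hs
  -- A constant `ρ`-function has multiplier one, and the multiplier is common to all `ρ`-functions
  -- of `S`.
  have h1 := hχ _ m hcorr l 1
  have : χ l = 1 := by
    rw [eq_comm, mul_eq_right₀ hc.ne'] at h1
    exact h1
  rw [hχ ρ μ h, this, one_mul]

/-- Two measures with proportional `ρ`-functions are proportional. -/
theorem Corresponds.lintegral_const {c : ℝ} {m : Measure (RCoset S)}
    (hj : Topology.IsClosedEmbedding j) (hS : j.range = S)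
    (h : Corresponds S j (rightHaar A) (rightHaar L) (fun _ => c) m)
    {Φ : A → ℝ≥0∞} (hΦ : Measurable Φ) (hinv : CosetInv S Φ) {c' : ℝ} {m' : Measure (RCoset S)}
    (h' : Corresponds S j (rightHaar A) (rightHaar L) (fun _ => c') m') :
    ENNReal.ofReal c' * ∫⁻ z : RCoset S, Φ z.out ∂m
      = ENNReal.ofReal c * ∫⁻ z : RCoset S, Φ z.out ∂m' := by
  obtain ⟨β, hβ, hβ1⟩ := exists_bruhat (L := L) hj hS
  have hm : Measurable fun a => β a * Φ a := hβ.mul hΦ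
  rw [h.lintegral_eq_bruhat hj.continuous hS hβ hβ1 hΦ hinv,
    h'.lintegral_eq_bruhat hj.continuous hS hβ hβ1 hΦ hinv,
    lintegral_mul_const _ hm, lintegral_mul_const _ hm]
  ring

end General

/-! ### Integration in stages through an intermediate subgroup -/

section Tower

variable {G : Type*} [Group G] [TopologicalSpace G] [IsTopologicalGroup G]
  [LocallyCompactSpace G] [SecondCountableTopology G] [T2Space G] [MeasurableSpace G]
  [BorelSpace G]

instance instSecondCountableSubgroup (S : Subgroup G) : SecondCountableTopology S :=
  TopologicalSpace.Subtype.secondCountableTopology (S : Set G)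

theorem isClosedEmbedding_subtype (S : Subgroup G) [hS : IsClosed (S : Set G)] :
    Topology.IsClosedEmbedding S.subtype :=
  hS.isClosedEmbedding_subtypeVal

theorem isClosedEmbedding_inclusion {N P : Subgroup G} [hN : IsClosed (N : Set G)] (h : N ≤ P) :
    Topology.IsClosedEmbedding (Subgroup.inclusion h) := by
  have hc : Continuous (Subgroup.inclusion h) :=
    continuous_subtype_val.subtype_mk _
  refine ⟨.of_comp hc continuous_subtype_val (isClosedEmbedding_subtype N).isEmbedding, ?_⟩
  have : Set.range (Subgroup.inclusion h) = Subtype.val ⁻¹' (N : Set G) :=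
    Set.range_inclusion h
  rw [this]
  exact hN.preimage continuous_subtype_val

/-- Integration in stages over `G / N → G / P`, for functions on `G / P`. -/
theorem Corresponds.lintegral_tower {N P : Subgroup G} [IsClosed (N : Set G)]
    [IsClosed (P : Set G)] (hNP : N ≤ P) {ρN ρP : G → ℝ} {μN : Measure (RCoset N)}
    {μP : Measure (RCoset P)} {μNP : Measure (RCoset (N.subgroupOf P))}
    (hN : Corresponds N ((↑) : N → G) (rightHaar G) (rightHaar N) ρN μN)
    (hP : Corresponds P ((↑) : P → G) (rightHaar G) (rightHaar P) ρP μP)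
    (hQ : Corresponds (N.subgroupOf P) (Subgroup.inclusion hNP) (rightHaar P) (rightHaar N)
      (fun u => ρN u / ρP u) μNP)
    (hinv : CosetInv N fun a => ρN a / ρP a) {F : G → ℝ≥0∞} (hF : Measurable F)
    (hFinv : CosetInv P F) :
    ∫⁻ z : RCoset N, F z.out *
        ENNReal.ofReal ((ρP z.out / ρP 1) / (ρN z.out / ρN 1)) ∂μN
      = (∫⁻ α : RCoset (N.subgroupOf P),
          ENNReal.ofReal ((ρP (α.out : P) / ρP 1) / (ρN (α.out : P) / ρN 1)) ∂μNP) *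
        ∫⁻ z : RCoset P, F z.out ∂μP := by
  obtain ⟨β, hβ, hβ1⟩ := exists_bruhat (isClosedEmbedding_subtype N) N.range_subtype
  set r : G → ℝ := fun a => (ρP a / ρP 1) / (ρN a / ρN 1)
  have hP0 : ∀ a, ρP a ≠ 0 := fun a => (hP.pos a).ne'
  have hN0 : ∀ a, ρN a ≠ 0 := fun a => (hN.pos a).ne'
  have hr0 : ∀ a, 0 < r a := fun a =>
    div_pos (div_pos (hP.pos _) (hP.pos _)) (div_pos (hN.pos _) (hN.pos _))
  have hrm : Measurable r := by
    have := hN.continuous.measurable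
    have := hP.continuous.measurable
    fun_prop
  have hrinv : CosetInv N r := by
    have e : r = fun a => (ρN a / ρP a)⁻¹ * (ρN 1 / ρP 1) := by
      ext a
      simp only [r]
      have := hP0 a
      have := hN0 a
      have := hP0 1
      have := hN0 1
      field_simp
    rw [e]
    exact hinv.comp fun q => q⁻¹ * (ρN 1 / ρP 1)
  set c : ℝ≥0∞ := ENNReal.ofReal (ρN 1 / ρP 1)
  have hrc : ∀ a, ENNReal.ofReal (r a) * ENNReal.ofReal (ρN a) = c * ENNReal.ofReal (ρP a) := by
    intro a
    rw [← ENNReal.ofReal_mul (hr0 a).le,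
      ← ENNReal.ofReal_mul (div_pos (hN.pos _) (hP.pos _)).le]
    congr 1
    simp only [r]
    have := hP0 a
    have := hN0 a
    have := hP0 1
    have := hN0 1
    field_simp
  have hrc' : ∀ a, ENNReal.ofReal (r a) * ENNReal.ofReal (ρN a / ρP a) = c := by
    intro a
    rw [← ENNReal.ofReal_mul (hr0 a).le]
    congr 1
    simp only [r]
    have := hP0 a
    have := hN0 a
    have := hP0 1
    have := hN0 1
    field_simp
  have hβP : ∀ t, Measurable fun u : P => β (u * t) := fun t => by fun_prop
  -- For each `t` the function `u ↦ β (u * t)` is a Bruhat function for `N` inside `P`. Hence every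
  -- fibre of `G/N → G/P` has the same weighted mass, which is why it comes out of the integral as a
  -- factor.
  have hfibre : ∀ t : G, ∫⁻ α : RCoset (N.subgroupOf P), ENNReal.ofReal (r (α.out : P)) ∂μNP
      = c * ∫⁻ u : P, β (u * t) ∂(rightHaar P) := by
    intro t
    have hone : ∀ u : P, ∫⁻ l : N, β ((Subgroup.inclusion hNP l * u : P) * t) ∂(rightHaar N)
        = 1 := by
      intro u
      simpa [mul_assoc] using hβ1 (u * t)
    rw [hQ.lintegral_eq_bruhat (isClosedEmbedding_inclusion hNP).continuous
      (Subgroup.inclusion_range hNP) (hβP t) hone (Φ := fun u : P => ENNReal.ofReal (r u))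
      (by fun_prop) (fun s hs a => by
        have := hrinv s (Subgroup.mem_subgroupOf.1 hs) a
        simpa using congrArg ENNReal.ofReal this)]
    simp only [mul_assoc, hrc']
    rw [lintegral_mul_const _ (hβP t), mul_comm]
  rw [hN.lintegral_eq_bruhat (j := N.subtype) continuous_subtype_val N.range_subtype hβ hβ1
    (Φ := fun a => F a * ENNReal.ofReal (r a)) (by fun_prop)
    (fun s hs a => by
      have h1 := hFinv s (hNP hs) a
      have h2 := hrinv s hs a
      simp only [h1, h2])]
  have e1 : ∀ a, β a * (F a * ENNReal.ofReal (r a)) * ENNReal.ofReal (ρN a)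
      = (β a * (F a * c)) * ENNReal.ofReal (ρP a) := fun a => by
    rw [mul_assoc, mul_assoc, hrc]
    ring
  simp only [e1]
  rw [hP.formula _ (by fun_prop)]
  rw [← lintegral_const_mul _ (hFinv.measurable hF)]
  congr 1
  ext z
  have e2 : ∀ u : P, F (u * z.out) = F z.out := fun u => hFinv u u.2 _
  simp only [e2]
  rw [lintegral_mul_const _ (hβP _), hfibre z.out]
  ring

end Tower

end ApqSpace

namespace ApqSpace

/-! ### Families of measures -/

section Families

open MeasurableSpace in
theorem exists_countable_piSystem (X : Type*) [mX : MeasurableSpace X] [CountablyGenerated X] :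
    ∃ C : Set (Set X), C.Countable ∧ IsPiSystem C ∧ mX = generateFrom C ∧ Set.univ ∈ C := by
  have h := isSetAlgebra_generateSetAlgebra (𝒜 := countableGeneratingSet X)
  refine ⟨generateSetAlgebra (countableGeneratingSet X),
    countable_generateSetAlgebra (countable_countableGeneratingSet (α := X)),
    fun s hs t ht _ => h.inter_mem hs ht, ?_, h.univ_mem⟩
  rw [generateFrom_generateSetAlgebra_eq, generateFrom_countableGeneratingSet]

theorem eq_of_withDensity_eq {X : Type*} [MeasurableSpace X] {m1 m2 : Measure X} {k : X → ℝ≥0∞}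
    (hk : Measurable k) (hk0 : ∀ x, k x ≠ 0) (hk1 : ∀ x, k x ≠ ∞)
    (h : m1.withDensity k = m2.withDensity k) : m1 = m2 := by
  rw [← withDensity_inv_same (μ := m1) hk (.of_forall hk0) (.of_forall hk1), h,
    withDensity_inv_same hk (.of_forall hk0) (.of_forall hk1)]

theorem sigmaFinite_of_lintegral {X : Type*} [MeasurableSpace X] {m : Measure X} {k : X → ℝ≥0∞}
    (hk : Measurable k) (hk0 : ∀ x, k x ≠ 0) (hk1 : ∫⁻ x, k x ∂m ≠ ∞) : SigmaFinite m := by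
  have h1 : IsFiniteMeasure (m.withDensity k) := isFiniteMeasure_withDensity hk1
  rw [← withDensity_inv_same hk (.of_forall hk0) (ae_lt_top hk hk1 |>.mono fun x hx => hx.ne)]
  exact SigmaFinite.withDensity_of_ne_top (.of_forall fun x => ENNReal.inv_ne_top.2 (hk0 x))

/-- A positive finite integrable function for a `σ`-finite measure. -/
theorem exists_weight {X : Type*} [MeasurableSpace X] (m : Measure X) [SigmaFinite m] :
    ∃ k : X → ℝ≥0∞, Measurable k ∧ (∀ x, k x ≠ 0) ∧ (∀ x, k x ≠ ∞) ∧ ∫⁻ x, k x ∂m ≠ ∞ := by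
  obtain ⟨g, hg0, hgm, hg⟩ := exists_pos_lintegral_lt_of_sigmaFinite m one_ne_zero
  exact ⟨fun x => g x, hgm.coe_nnreal_ennreal, fun x => by simpa using (hg0 x).ne', fun x => by simp,
    (hg.trans ENNReal.one_lt_top).ne⟩

variable {Y X : Type*} [MeasurableSpace Y] [MeasurableSpace X]
  [MeasurableSpace.CountablyGenerated X] {μ : Measure Y} [SigmaFinite μ]

/-- Uniqueness of disintegrations. -/
theorem ae_eq_of_forall_setLIntegral_lintegral_eq {m1 m2 : Y → Measure X}
    (h1 : ∀ F : X → ℝ≥0∞, Measurable F → AEMeasurable (fun y => ∫⁻ x, F x ∂(m1 y)) μ)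
    (h2 : ∀ F : X → ℝ≥0∞, Measurable F → AEMeasurable (fun y => ∫⁻ x, F x ∂(m2 y)) μ)
    (h : ∀ s : Set Y, MeasurableSet s → ∀ F : X → ℝ≥0∞, Measurable F →
      ∫⁻ y in s, ∫⁻ x, F x ∂(m1 y) ∂μ = ∫⁻ y in s, ∫⁻ x, F x ∂(m2 y) ∂μ)
    {k : X → ℝ≥0∞} (hk : Measurable k) (hk0 : ∀ x, k x ≠ 0) (hk1 : ∀ x, k x ≠ ∞)
    (hk2 : ∫⁻ y, ∫⁻ x, k x ∂(m1 y) ∂μ ≠ ∞) : ∀ᵐ y ∂μ, m1 y = m2 y := by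
  obtain ⟨C, hC, hpi, hgen, huniv⟩ := exists_countable_piSystem X
  have hCm : ∀ B ∈ C, MeasurableSet B := fun B hB => by
    rw [hgen]; exact MeasurableSpace.measurableSet_generateFrom hB
  -- Countability of the `π`-system leaves a single exceptional null set. The weight `k` makes the
  -- measures finite for almost every `y`, so agreement on the `π`-system determines them.
  have hae : ∀ B ∈ C, ∀ᵐ y ∂μ, (m1 y).withDensity k B = (m2 y).withDensity k B := by
    intro B hB
    have hm : Measurable (B.indicator k) := hk.indicator (hCm B hB)
    have := ae_eq_of_forall_setLIntegral_eq_of_sigmaFinite₀ (h1 _ hm) (h2 _ hm)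
      fun s hs _ => h s hs _ hm
    filter_upwards [this] with y hy
    rw [withDensity_apply _ (hCm B hB), withDensity_apply _ (hCm B hB),
      ← lintegral_indicator (hCm B hB), ← lintegral_indicator (hCm B hB)]
    exact hy
  have hfin : ∀ᵐ y ∂μ, ∫⁻ x, k x ∂(m1 y) < ∞ := ae_lt_top' (h1 k hk) hk2
  filter_upwards [(ae_ball_iff hC).2 hae, hfin] with y hy hfy
  refine eq_of_withDensity_eq hk hk0 hk1 ?_
  have : IsFiniteMeasure ((m1 y).withDensity k) := isFiniteMeasure_withDensity hfy.ne
  exact ext_of_generate_finite C hgen hpi hy (hy _ huniv)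

/-- A family of measures with measurable integrals is almost everywhere given by a finite kernel,
up to a change of densities. -/
theorem exists_kernel_of_family {m : Y → Measure X}
    (hm : ∀ F : X → ℝ≥0∞, Measurable F → AEMeasurable (fun y => ∫⁻ x, F x ∂(m y)) μ)
    {k : X → ℝ≥0∞} (hk : Measurable k) (hk0 : ∀ x, k x ≠ 0)
    (hk2 : ∫⁻ y, ∫⁻ x, k x ∂(m y) ∂μ ≠ ∞) (hm0 : ∀ᵐ y ∂μ, m y ≠ 0) :
    ∃ (η : ProbabilityTheory.Kernel Y X) (T : Y → ℝ≥0), ProbabilityTheory.IsFiniteKernel η ∧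
      Measurable T ∧ ∀ᵐ y ∂μ, (m y).withDensity k = T y • η y := by
  obtain ⟨C, hC, hpi, hgen, huniv⟩ := exists_countable_piSystem X
  have hCm : ∀ B ∈ C, MeasurableSet B := fun B hB => by
    rw [hgen]; exact MeasurableSpace.measurableSet_generateFrom hB
  have hTm : AEMeasurable (fun y => ∫⁻ x, k x ∂(m y)) μ := hm k hk
  have hfin : ∀ᵐ y ∂μ, ∫⁻ x, k x ∂(m y) < ∞ := ae_lt_top' hTm hk2
  -- The weighted measures are normalized to mass one, so the kernel is uniformly bounded. The total
  -- mass is recorded separately as `T`.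
  set u : Set X → Y → ℝ≥0∞ := fun B y => (m y).withDensity k B / ∫⁻ x, k x ∂(m y)
  have hu : ∀ B ∈ C, AEMeasurable (u B) μ := by
    intro B hB
    refine AEMeasurable.div ?_ hTm
    have := hm _ (hk.indicator (hCm B hB))
    refine this.congr (.of_forall fun y => ?_)
    simp only
    rw [withDensity_apply _ (hCm B hB), lintegral_indicator (hCm B hB)]
  choose! v hvm hv using hu
  have hgood : ∀ᵐ y ∂μ, (∀ B ∈ C, u B y = v B y) ∧ ∫⁻ x, k x ∂(m y) = hTm.mk _ y ∧
      (∫⁻ x, k x ∂(m y) < ∞ ∧ m y ≠ 0) := by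
    filter_upwards [(ae_ball_iff hC).2 hv, hTm.ae_eq_mk, hfin, hm0] with y h1 h2 h3 h4
    exact ⟨h1, h2, h3, h4⟩
  -- On the measurable null set `Z` the kernel is set to zero. Off `Z` its values on the countable
  -- generating system agree with the measurable versions `v`, which is enough for measurability.
  obtain ⟨Z, hZ, hZm, hZ0⟩ := exists_measurable_superset_of_null hgood
  have hZgood : ∀ y, y ∉ Z → (∀ B ∈ C, u B y = v B y) ∧ ∫⁻ x, k x ∂(m y) = hTm.mk _ y ∧
      (∫⁻ x, k x ∂(m y) < ∞ ∧ m y ≠ 0) := fun y hy => by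
    by_contra hcon
    exact hy (hZ hcon)
  have hpos : ∀ y, y ∉ Z → ∫⁻ x, k x ∂(m y) ≠ 0 := by
    intro y hy h0
    rw [lintegral_eq_zero_iff hk] at h0
    refine (hZgood y hy).2.2.2 (ae_eq_bot.1 ?_)
    rw [← Filter.empty_mem_iff_bot]
    filter_upwards [h0] with x hx
    exact hk0 x hx
  classical
  set η0 : Y → Measure X := fun y =>
    if y ∈ Z then 0 else (∫⁻ x, k x ∂(m y))⁻¹ • (m y).withDensity k
  have hη0B : ∀ B ∈ C, ∀ y, η0 y B = if y ∈ Z then 0 else v B y := by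
    intro B hB y
    by_cases hy : y ∈ Z
    · simp [η0, hy]
    · simp only [η0, hy, if_false, Measure.smul_apply, smul_eq_mul]
      rw [← (hZgood y hy).1 B hB]
      simp only [u, div_eq_mul_inv, mul_comm]
  have hη0univ : ∀ y, η0 y Set.univ ≤ 1 := by
    intro y
    by_cases hy : y ∈ Z
    · simp [η0, hy]
    · simp only [η0, hy, if_false, Measure.smul_apply, smul_eq_mul, withDensity_apply _
        MeasurableSet.univ, Measure.restrict_univ]
      exact ENNReal.inv_mul_le_one _
  have hfin0 : ∀ y, IsFiniteMeasure (η0 y) := fun y =>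
    ⟨(hη0univ y).trans_lt ENNReal.one_lt_top⟩
  have hmeas : Measurable η0 := by
    have hB : ∀ B ∈ C, Measurable fun y => η0 y B := by
      intro B hB
      simp only [hη0B B hB]
      exact Measurable.ite hZm measurable_const (hvm B hB)
    exact Measurable.measure_of_isPiSystem hgen hpi hB (hB _ huniv)
  refine ⟨⟨η0, hmeas⟩, fun y => (hTm.mk _ y).toNNReal, ⟨⟨1, ENNReal.one_lt_top, hη0univ⟩⟩,
    hTm.measurable_mk.ennreal_toNNReal, ?_⟩
  have : ∀ᵐ y ∂μ, y ∉ Z := measure_eq_zero_iff_ae_notMem.1 hZ0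
  filter_upwards [this] with y hy
  change _ = (hTm.mk _ y).toNNReal • η0 y
  rw [← (hZgood y hy).2.1]
  simp only [η0, hy, if_false]
  have hne := (hZgood y hy).2.2.1.ne
  ext B hB
  rw [Measure.smul_apply, Measure.smul_apply, ENNReal.smul_def, smul_eq_mul, smul_eq_mul,
    ENNReal.coe_toNNReal hne, ← mul_assoc, ENNReal.mul_inv_cancel (hpos y hy) hne, one_mul]

end Families

end ApqSpace

namespace ApqSpace

/-! ### Double cosets and orbits -/

section Orbits

variable {G : Type*} [Group G] {H K : Subgroup G}

theorem DCoset.mk_eq_iff {x y x' y' : G} :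
    DCoset.mk H K (x, y) = DCoset.mk H K (x', y') ↔
      ∃ h ∈ H, ∃ k ∈ K, ∃ s, x' = h * x * s ∧ y' = k * y * s := by
  rw [Quotient.eq, DoubleCoset.rel_iff]
  constructor
  · rintro ⟨⟨h, k⟩, hhk, ⟨_, _⟩, ⟨s, hs⟩, e⟩
    obtain ⟨rfl, rfl⟩ : s = _ ∧ s = _ := by simpa using hs
    rw [Subgroup.mem_prod] at hhk
    exact ⟨h, hhk.1, k, hhk.2, s, by simpa using e⟩
  · rintro ⟨h, hh, k, hk, s, rfl, rfl⟩
    exact ⟨(h, k), Subgroup.mem_prod.2 ⟨hh, hk⟩, (s, s), ⟨s, rfl⟩, rfl⟩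

theorem DCoset.mk_mul {h k : G} (hh : h ∈ H) (hk : k ∈ K) (x y s : G) :
    DCoset.mk H K (h * x * s, k * y * s) = DCoset.mk H K (x, y) :=
  (DCoset.mk_eq_iff.2 ⟨h, hh, k, hk, s, rfl, rfl⟩).symm

theorem DCoset.mk_out (d : DCoset H K) : DCoset.mk H K d.out = d := Quotient.out_eq d

/-- The point `(H x t, K y t)` of `G / H × G / K`. -/
def orb (H K : Subgroup G) (x y t : G) : RCoset H × RCoset K :=
  (RCoset.mk H (x * t), RCoset.mk K (y * t))

theorem mem_stab {x y s : G} : s ∈ stab H K x y ↔ x * s * x⁻¹ ∈ H ∧ y * s * y⁻¹ ∈ K := Iff.rfl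

theorem CosetInv.stab_left {β : Type*} {f : G → β} (hf : CosetInv H f) (x y : G) :
    CosetInv (stab H K x y) fun t => f (x * t) := fun s hs t => by
  have := hf _ (mem_stab.1 hs).1 (x * t)
  simpa [mul_assoc] using this

theorem CosetInv.stab_right {β : Type*} {f : G → β} (hf : CosetInv K f) (x y : G) :
    CosetInv (stab H K x y) fun t => f (y * t) := fun s hs t => by
  have := hf _ (mem_stab.1 hs).2 (y * t)
  simpa [mul_assoc] using this

theorem orb_cosetInv (x y : G) : CosetInv (stab H K x y) (orb H K x y) := fun s hs t => by
  have h1 := (CosetInv.comp_mk (S := H) id).stab_left (K := K) x y s hs t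
  have h2 := (CosetInv.comp_mk (S := K) id).stab_right (H := H) x y s hs t
  exact Prod.ext h1 h2

theorem orbitMap_mk (x y t : G) : orbitMap H K x y (RCoset.mk _ t) = orb H K x y t :=
  (orb_cosetInv x y).out t

theorem orbitMap_injective (x y : G) : Function.Injective (orbitMap H K x y) := by
  intro z z' h
  obtain ⟨t, rfl⟩ := Quotient.exists_rep z
  obtain ⟨t', rfl⟩ := Quotient.exists_rep z'
  change orbitMap H K x y (RCoset.mk _ t) = orbitMap H K x y (RCoset.mk _ t') at h
  rw [orbitMap_mk, orbitMap_mk, orb, orb, Prod.mk.injEq, RCoset.mk_eq_iff, RCoset.mk_eq_iff] at h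
  obtain ⟨⟨a, ha, e⟩, b, hb, e'⟩ := h
  refine RCoset.mk_eq_iff.2 ⟨t' * t⁻¹, mem_stab.2 ⟨?_, ?_⟩, by simp⟩
  · convert ha using 1
    rw [← mul_assoc, e]; group
  · convert hb using 1
    rw [← mul_assoc, e']; group

/-- The double coset of a point of `G / H × G / K`. -/
def toDCoset (H K : Subgroup G) (q : RCoset H × RCoset K) : DCoset H K :=
  DCoset.mk H K (q.1.out, q.2.out)

theorem toDCoset_mk (x y : G) :
    toDCoset H K (RCoset.mk H x, RCoset.mk K y) = DCoset.mk H K (x, y) := by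
  obtain ⟨h, hh, e⟩ := RCoset.exists_out H x
  obtain ⟨k, hk, e'⟩ := RCoset.exists_out K y
  have := DCoset.mk_mul hh hk x y 1
  simp only [mul_one] at this
  simp only [toDCoset, e, e', this]

theorem toDCoset_orb (x y t : G) : toDCoset H K (orb H K x y t) = DCoset.mk H K (x, y) := by
  rw [orb, toDCoset_mk]
  simpa using DCoset.mk_mul H.one_mem K.one_mem x y t

/-- Simultaneous right translation on `G / H × G / K`. -/
def translate₂ (H K : Subgroup G) (s : G) (q : RCoset H × RCoset K) : RCoset H × RCoset K :=
  (RCoset.translate H s q.1, RCoset.translate K s q.2)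

theorem translate₂_orb (x y t s : G) :
    translate₂ H K s (orb H K x y t) = orb H K x y (t * s) := by
  simp only [translate₂, orb, RCoset.translate_mk, mul_assoc]

theorem translate₂_mk (s x y : G) : translate₂ H K s (RCoset.mk H x, RCoset.mk K y)
    = (RCoset.mk H (x * s), RCoset.mk K (y * s)) := rfl

theorem toDCoset_translate₂ (s : G) (q : RCoset H × RCoset K) :
    toDCoset H K (translate₂ H K s q) = toDCoset H K q := by
  obtain ⟨a, b⟩ := q
  obtain ⟨a, rfl⟩ := Quotient.exists_rep a
  obtain ⟨b, rfl⟩ := Quotient.exists_rep b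
  change toDCoset H K (translate₂ H K s (RCoset.mk H a, RCoset.mk K b))
    = toDCoset H K (RCoset.mk H a, RCoset.mk K b)
  rw [translate₂_mk, toDCoset_mk, toDCoset_mk]
  simpa using DCoset.mk_mul H.one_mem K.one_mem a b s

theorem translate₂_inv (s : G) (q : RCoset H × RCoset K) :
    translate₂ H K s⁻¹ (translate₂ H K s q) = q := by
  obtain ⟨a, b⟩ := q
  obtain ⟨a, rfl⟩ := Quotient.exists_rep a
  obtain ⟨b, rfl⟩ := Quotient.exists_rep b
  change translate₂ H K s⁻¹ (translate₂ H K s (RCoset.mk H a, RCoset.mk K b))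
    = (RCoset.mk H a, RCoset.mk K b)
  simp [translate₂_mk]

variable [TopologicalSpace G] [IsTopologicalGroup G] [LocallyCompactSpace G]
  [SecondCountableTopology G] [T2Space G] [MeasurableSpace G] [BorelSpace G]

theorem measurable_orb : Measurable fun q : (G × G) × G => orb H K q.1.1 q.1.2 q.2 := by
  have h1 := RCoset.measurable_mk H
  have h2 := RCoset.measurable_mk K
  unfold orb
  fun_prop

theorem measurable_orb_right (x y : G) : Measurable (orb H K x y) :=
  measurable_orb.comp (measurable_const.prodMk measurable_id : Measurable fun t : G => ((x, y), t))

theorem measurable_orbitMap (x y : G) : Measurable (orbitMap H K x y) :=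
  (orb_cosetInv x y).measurable (measurable_orb_right x y)

theorem measurable_translate₂ (s : G) : Measurable (translate₂ H K s) :=
  ((RCoset.measurable_translate H s).comp measurable_fst).prodMk
    ((RCoset.measurable_translate K s).comp measurable_snd)

variable [hH : IsClosed (H : Set G)] [hK : IsClosed (K : Set G)]

/-- A measurable surjection between standard Borel spaces is a quotient map for the `σ`-algebras.
Measurability on `G/H × G/K` can therefore be tested on `G × G`, where the map is the quotient map
onto `Υ`. -/
theorem measurable_toDCoset : Measurable (toDCoset H K) := by
  have := polishSpace_of_locallyCompact G
  have hq : Measurable fun w : G × G => (RCoset.mk H w.1, RCoset.mk K w.2) :=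
    ((RCoset.measurable_mk H).comp measurable_fst).prodMk
      ((RCoset.measurable_mk K).comp measurable_snd)
  have hs : Function.Surjective fun w : G × G => (RCoset.mk H w.1, RCoset.mk K w.2) :=
    fun q => ⟨(q.1.out, q.2.out), Prod.ext (RCoset.mk_out _) (RCoset.mk_out _)⟩
  rw [← hq.measurable_comp_iff_of_surjective hs]
  have : toDCoset H K ∘ (fun w : G × G => (RCoset.mk H w.1, RCoset.mk K w.2))
      = DCoset.mk H K := by
    ext w
    exact toDCoset_mk _ _
  rw [this]
  exact measurable_quotient_mk''

/-- An injective measurable map between standard Borel spaces is a measurable embedding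
(Lusin–Souslin). Consequently functions on an orbit extend to `G/H × G/K`, and measures on the orbit
can be compared after being pushed there. -/
theorem measurableEmbedding_orbitMap (x y : G) : MeasurableEmbedding (orbitMap H K x y) :=
  (measurable_orbitMap x y).measurableEmbedding (orbitMap_injective x y)

end Orbits

/-! ### Properties of almost every double coset, and the orbit measures -/

namespace CosetMeasures

variable {G : Type*} [Group G] [TopologicalSpace G] [IsTopologicalGroup G] [LocallyCompactSpace G]
  [SecondCountableTopology G] [T2Space G] [MeasurableSpace G] [BorelSpace G]
  {H K : Subgroup G} [hH : IsClosed (H : Set G)] [hK : IsClosed (K : Set G)]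
  (D : CosetMeasures H K)

/-- A property holds on almost every double coset. -/
def Generic (P : G → G → Prop) : Prop :=
  ∀ᵐ d ∂D.μHK, ∀ x y : G, DCoset.mk H K (x, y) = d → P x y

variable {D}

theorem Generic.mono {P Q : G → G → Prop} (h : D.Generic P) (hPQ : ∀ x y, P x y → Q x y) :
    D.Generic Q := by
  filter_upwards [h] with d hd x y hxy
  exact hPQ x y (hd x y hxy)

theorem Generic.and {P Q : G → G → Prop} (h : D.Generic P) (h' : D.Generic Q) :
    D.Generic fun x y => P x y ∧ Q x y := by
  filter_upwards [h, h'] with d hd hd' x y hxy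
  exact ⟨hd x y hxy, hd' x y hxy⟩

theorem Generic.ae {P : G → G → Prop} (h : D.Generic P) :
    ∀ᵐ w ∂((rightHaar G).prod (rightHaar G)), P w.1 w.2 := by
  obtain ⟨Z, hZ, hZm, hZ0⟩ := exists_measurable_superset_of_null h
  have := (D.admissible Z hZm).1 hZ0
  filter_upwards [measure_eq_zero_iff_ae_notMem.1 this] with w hw
  by_contra hcon
  exact hw (hZ fun hd => hcon (hd w.1 w.2 rfl))

/-- A property of the double coset, tested on representatives. -/
theorem generic_of_ae_out {P : G → G → Prop}
    (hP : ∀ h ∈ H, ∀ k ∈ K, ∀ x y s, P x y → P (h * x * s) (k * y * s))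
    (h : ∀ᵐ d ∂D.μHK, P d.out.1 d.out.2) : D.Generic P := by
  filter_upwards [h] with d hd x y hxy
  have : DCoset.mk H K (d.out.1, d.out.2) = DCoset.mk H K (x, y) := by
    rw [hxy]; exact DCoset.mk_out d
  obtain ⟨h, hh, k, hk, s, rfl, rfl⟩ := DCoset.mk_eq_iff.1 this
  exact hP h hh k hk _ _ s hd

variable (D)

instance : SigmaFinite D.μH := D.sigmaFiniteH
instance : SigmaFinite D.μK := D.sigmaFiniteK
instance : SigmaFinite D.μHK := D.sigmaFiniteHK

/-- The image in `G / H × G / K` of the measure on the orbit. -/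
def orbMeasure (x y : G) : Measure (RCoset H × RCoset K) :=
  (D.μ x y).map (orbitMap H K x y)

theorem lintegral_orbMeasure (x y : G) {F : RCoset H × RCoset K → ℝ≥0∞} (hF : Measurable F) :
    ∫⁻ q, F q ∂(D.orbMeasure x y) = ∫⁻ z, F (orbitMap H K x y z) ∂(D.μ x y) :=
  lintegral_map hF (measurable_orbitMap x y)

theorem shift_mk {h k : G} (hh : h ∈ H) (hk : k ∈ K) (x y s t : G) :
    RCoset.mk (stab H K (h * x * s) (k * y * s)) (s⁻¹ * (RCoset.mk (stab H K x y) t).out)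
      = RCoset.mk (stab H K (h * x * s) (k * y * s)) (s⁻¹ * t) := by
  refine (CosetInv.out (S := stab H K x y)
    (f := fun t => RCoset.mk (stab H K (h * x * s) (k * y * s)) (s⁻¹ * t)) ?_ t)
  intro n hn t
  rw [eq_comm, RCoset.mk_eq_iff]
  refine ⟨s⁻¹ * n * s, mem_stab.2 ⟨?_, ?_⟩, by group⟩
  · have := H.mul_mem (H.mul_mem hh (mem_stab.1 hn).1) (H.inv_mem hh)
    convert this using 1
    group
  · have := K.mul_mem (K.mul_mem hk (mem_stab.1 hn).2) (K.inv_mem hk)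
    convert this using 1
    group

theorem measurable_shift {h k : G} (hh : h ∈ H) (hk : k ∈ K) (x y s : G) :
    Measurable fun z : RCoset (stab H K x y) =>
      RCoset.mk (stab H K (h * x * s) (k * y * s)) (s⁻¹ * z.out) := by
  rw [RCoset.measurable_iff]
  simp only [shift_mk hh hk]
  exact (RCoset.measurable_mk _).comp (measurable_const_mul _)

theorem orbitMap_shift {h k : G} (hh : h ∈ H) (hk : k ∈ K) (x y s : G)
    (z : RCoset (stab H K x y)) :
    orbitMap H K (h * x * s) (k * y * s)
      (RCoset.mk (stab H K (h * x * s) (k * y * s)) (s⁻¹ * z.out)) = orbitMap H K x y z := by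
  rw [orbitMap_mk]
  simp only [orb, orbitMap, mul_assoc, mul_inv_cancel_left, RCoset.mk_mul hh, RCoset.mk_mul hk]

/-- The measure `D.μ x y` lives on a space that varies with `(x, y)`, but its image in `G/H × G/K`
does not. Equivariance says that a move along the double coset only reparametrizes the same orbit,
so the image can be attached to the double coset itself. -/
theorem orbMeasure_mul {h k : G} (hh : h ∈ H) (hk : k ∈ K) (x y s : G) :
    D.orbMeasure (h * x * s) (k * y * s) = D.orbMeasure x y := by
  rw [orbMeasure, orbMeasure, D.equivariant h hh k hk,
    Measure.map_map (measurable_orbitMap _ _) (measurable_shift hh hk x y s)]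
  congr 1
  ext z : 1
  exact orbitMap_shift hh hk x y s z

theorem orbMeasure_congr {x y x' y' : G} (h : DCoset.mk H K (x, y) = DCoset.mk H K (x', y')) :
    D.orbMeasure x y = D.orbMeasure x' y' := by
  obtain ⟨h, hh, k, hk, s, rfl, rfl⟩ := DCoset.mk_eq_iff.1 h
  exact (D.orbMeasure_mul hh hk x y s).symm

/-- The measure on the orbit of a double coset. -/
def dMeasure (d : DCoset H K) : Measure (RCoset H × RCoset K) := D.orbMeasure d.out.1 d.out.2

theorem dMeasure_mk (x y : G) : D.dMeasure (DCoset.mk H K (x, y)) = D.orbMeasure x y :=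
  D.orbMeasure_congr (DCoset.mk_out _)

theorem aemeasurable_dMeasure {F : RCoset H × RCoset K → ℝ≥0∞} (hF : Measurable F) :
    AEMeasurable (fun d => ∫⁻ q, F q ∂(D.dMeasure d)) D.μHK := by
  simp only [dMeasure, D.lintegral_orbMeasure _ _ hF]
  exact D.aemeasurable_orbit F hF

theorem lintegral_dMeasure {F : RCoset H × RCoset K → ℝ≥0∞} (hF : Measurable F) :
    ∫⁻ d, ∫⁻ q, F q ∂(D.dMeasure d) ∂D.μHK = ∫⁻ q, F q ∂(D.μH.prod D.μK) := by
  rw [lintegral_prod _ hF.aemeasurable, D.disintegration F hF]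
  simp only [dMeasure, D.lintegral_orbMeasure _ _ hF]

/-- The measure of `d` is carried by the fibre of `toDCoset` over `d`, so restricting to `s` amounts
to cutting `F` down to the preimage of `s`. This localization over `Υ` is what uniqueness of
disintegrations needs. -/
theorem setLIntegral_dMeasure {F : RCoset H × RCoset K → ℝ≥0∞} (hF : Measurable F)
    {s : Set (DCoset H K)} (hs : MeasurableSet s) :
    ∫⁻ d in s, ∫⁻ q, F q ∂(D.dMeasure d) ∂D.μHK
      = ∫⁻ q, (toDCoset H K ⁻¹' s).indicator F q ∂(D.μH.prod D.μK) := by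
  have hs' := measurable_toDCoset hs
  rw [← D.lintegral_dMeasure (hF.indicator hs'), ← lintegral_indicator hs]
  congr 1
  ext d
  rw [dMeasure, D.lintegral_orbMeasure _ _ (hF.indicator hs'), Set.indicator]
  have e : ∀ z, toDCoset H K (orbitMap H K d.out.1 d.out.2 z) = d := fun z => by
    have := toDCoset_orb (H := H) (K := K) d.out.1 d.out.2 z.out
    rw [← orbitMap_mk, RCoset.mk_out] at this
    rw [this]
    exact DCoset.mk_out d
  by_cases hd : d ∈ s
  · rw [if_pos hd, dMeasure, D.lintegral_orbMeasure _ _ hF]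
    congr 1
    ext z
    rw [Set.indicator_of_mem]
    simpa [e] using hd
  · rw [if_neg hd]
    symm
    rw [lintegral_eq_zero_iff' ]
    · refine .of_forall fun z => ?_
      exact Set.indicator_of_notMem (by simpa [e] using hd) F
    · exact ((hF.indicator hs').comp (measurable_orbitMap _ _)).aemeasurable

end CosetMeasures

end ApqSpace

namespace ApqSpace

/-! ### Conjugate subgroups -/

section Subgroups

variable {G : Type*} [Group G] [TopologicalSpace G] [IsTopologicalGroup G] [LocallyCompactSpace G]
  [SecondCountableTopology G] [T2Space G] [MeasurableSpace G] [BorelSpace G]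

/-- The fibre integrals of a positive function that is integrable for `ρ dν_G` form a positive
integrable function on the coset space. -/
theorem Corresponds.sigmaFinite {S : Subgroup G} [IsClosed (S : Set G)] {ρ : G → ℝ}
    {μ : Measure (RCoset S)}
    (h : Corresponds S ((↑) : S → G) (rightHaar G) (rightHaar S) ρ μ) : SigmaFinite μ := by
  have hρ : Measurable fun a => ENNReal.ofReal (ρ a) := h.continuous.measurable.ennreal_ofReal
  have : SigmaFinite ((rightHaar G).withDensity fun a => ENNReal.ofReal (ρ a)) :=
    SigmaFinite.withDensity_of_ne_top (.of_forall fun a => ENNReal.ofReal_ne_top)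
  obtain ⟨k, hk, hk0, hk1, hk2⟩ :=
    exists_weight ((rightHaar G).withDensity fun a => ENNReal.ofReal (ρ a))
  rw [lintegral_withDensity_eq_lintegral_mul _ hρ hk] at hk2
  have hS : S.subtype.range = S := S.range_subtype
  refine sigmaFinite_of_lintegral (k := fun z : RCoset S => ∫⁻ l : S, k (l * z.out) ∂(rightHaar S))
    (measurable_lintegral_out (j := S.subtype) continuous_subtype_val hS hk) (fun z h0 => ?_) ?_
  · have : Measurable fun l : S => k (l * z.out) := by fun_prop
    rw [lintegral_eq_zero_iff this] at h0
    obtain ⟨l, hl⟩ := Filter.Eventually.exists h0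
    exact hk0 _ hl
  · rw [← h.formula k hk]
    convert hk2 using 3
    simp [mul_comm]

theorem conj_cosetInv (S : Subgroup G) (x : G) :
    CosetInv S fun a => RCoset.mk (conj S x) (x⁻¹ * a) := fun s hs a => by
  rw [eq_comm, RCoset.mk_eq_iff]
  refine ⟨x⁻¹ * s * x, ?_, by group⟩
  change x * (x⁻¹ * s * x) * x⁻¹ ∈ S
  convert hs using 1
  group

theorem conj_cosetInv' (S : Subgroup G) (x : G) :
    CosetInv (conj S x) fun a => RCoset.mk S (x * a) := fun s hs a => by
  rw [eq_comm, RCoset.mk_eq_iff]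
  exact ⟨x * s * x⁻¹, hs, by group⟩

theorem lintegral_conjMeasure {S : Subgroup G} (μ : Measure (RCoset S)) (x : G)
    {F : G → ℝ≥0∞} (hF : Measurable F) (hinv : CosetInv (conj S x) F) :
    ∫⁻ z : RCoset (conj S x), F z.out ∂(conjMeasure S μ x)
      = ∫⁻ u : RCoset S, F (x⁻¹ * u.out) ∂μ := by
  have hm : Measurable fun u : RCoset S => RCoset.mk (conj S x) (x⁻¹ * u.out) :=
    (conj_cosetInv S x).measurable ((RCoset.measurable_mk _).comp (measurable_const_mul _))
  rw [conjMeasure, lintegral_map (hinv.measurable hF) hm]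
  simp only [hinv.out]

/-- Left translation by `x⁻¹` carries `μ` to `conjMeasure` and commutes with right translations. The
two ratios are densities of the same right translation, seen on `G/S` and on `G/S^x`; evaluation at
`a = x` gives the formula. -/
theorem Corresponds.conj_ratio {S : Subgroup G} [IsClosed (S : Set G)] {ρ ρ' : G → ℝ}
    {μ : Measure (RCoset S)} {x : G}
    (h : Corresponds S ((↑) : S → G) (rightHaar G) (rightHaar S) ρ μ)
    (h' : Corresponds (conj S x) ((↑) : conj S x → G) (rightHaar G) (rightHaar (conj S x)) ρ'
      (conjMeasure S μ x)) (t : G) : ρ' t / ρ' 1 = ρ (x * t) / ρ x := by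
  have := h.sigmaFinite
  have hS := S.range_subtype
  have hSe := isClosedEmbedding_subtype S
  have hC := (conj S x).range_subtype
  have hCe := isClosedEmbedding_subtype (conj S x)
  have hr := h.ratio_cosetInv (j := S.subtype) hSe hS t
  have hr' := h'.ratio_cosetInv (j := (conj S x).subtype) hCe hC t
  have hc := h.continuous
  have hc' := h'.continuous
  have hA : Measurable fun z : RCoset S => ENNReal.ofReal (ρ (z.out * t) / ρ z.out) := by
    refine (hr.measurable ?_).ennreal_ofReal
    have := hc.measurable
    fun_prop
  have hrx : CosetInv S fun a => ρ' (x⁻¹ * a * t) / ρ' (x⁻¹ * a) := fun s hs a => by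
    have := hr' (x⁻¹ * s * x) (by
      change x * (x⁻¹ * s * x) * x⁻¹ ∈ S
      convert hs using 1
      group) (x⁻¹ * a)
    have e : x⁻¹ * s * x * (x⁻¹ * a) = x⁻¹ * (s * a) := by group
    simpa only [e] using this
  have hB : Measurable fun z : RCoset S =>
      ENNReal.ofReal (ρ' (x⁻¹ * z.out * t) / ρ' (x⁻¹ * z.out)) := by
    refine (hrx.measurable ?_).ennreal_ofReal
    have := hc'.measurable
    fun_prop
  have hrm' : Measurable fun a => ENNReal.ofReal (ρ' (a * t) / ρ' a) := by
    have := hc'.measurable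
    fun_prop
  have hae : (fun z : RCoset S => ENNReal.ofReal (ρ (z.out * t) / ρ z.out)) =ᵐ[μ] fun z =>
      ENNReal.ofReal (ρ' (x⁻¹ * z.out * t) / ρ' (x⁻¹ * z.out)) := by
    refine ae_eq_of_forall_lintegral_mul hA hB fun f hf => ?_
    have hfm : Measurable fun a => f (RCoset.mk S a) := hf.comp (RCoset.measurable_mk S)
    have hfinv : CosetInv S fun a => f (RCoset.mk S a) := CosetInv.comp_mk f
    have hgm : Measurable fun a => f (RCoset.mk S (x * a)) := hfm.comp (measurable_const_mul x)
    have hginv : CosetInv (conj S x) fun a => f (RCoset.mk S (x * a)) :=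
      (conj_cosetInv' S x).comp f
    have h1 := h.lintegral_translate (j := S.subtype) hSe hS hfm hfinv t⁻¹
    have h2 := h'.lintegral_translate (j := (conj S x).subtype) hCe hC hgm hginv t⁻¹
    rw [inv_inv] at h1 h2
    rw [lintegral_conjMeasure μ x (F := fun a => f (RCoset.mk S (x * (a * t⁻¹))))
      (hgm.comp (measurable_mul_const t⁻¹)) (hginv.mul_right t⁻¹),
      lintegral_conjMeasure μ x
        (F := fun a => f (RCoset.mk S (x * a)) * ENNReal.ofReal (ρ' (a * t) / ρ' a))
        (hgm.mul hrm') (fun s hs a => by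
          have e1 := hginv s hs a
          have e2 := hr' s hs a
          simp only at e1
          simp only [e1, e2])] at h2
    simp only [mul_assoc x⁻¹, mul_inv_cancel_left] at h2
    rw [h1] at h2
    simpa only [RCoset.mk_out, ← mul_assoc] using h2
  rw [Filter.EventuallyEq, h.ae_iff hS (measurableSet_eq_fun hA hB)] at hae
  have heq : (fun a => ρ (a * t) / ρ a) = fun a => ρ' (x⁻¹ * a * t) / ρ' (x⁻¹ * a) := by
    refine eq_of_ae_eq_rightHaar ?_ ?_ ?_
    · exact (hc.comp (continuous_mul_const t)).div hc fun a => (h.pos a).ne'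
    · refine Continuous.div ?_ ?_ fun a => (h'.pos _).ne'
      · exact hc'.comp (by fun_prop)
      · exact hc'.comp (by fun_prop)
    · filter_upwards [hae] with a ha
      have e1 := hr.out a
      have e2 := hrx.out a
      rw [e1, e2] at ha
      exact (ENNReal.ofReal_eq_ofReal_iff (div_pos (h.pos _) (h.pos _)).le
        (div_pos (h'.pos _) (h'.pos _)).le).1 ha
  have := congrFun heq x
  simp at this
  exact this.symm

end Subgroups

/-! ### Factorization of `λ_{x,y}` on almost every double coset -/

namespace CosetMeasures

variable {G : Type*} [Group G] [TopologicalSpace G] [IsTopologicalGroup G] [LocallyCompactSpace G]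
  [SecondCountableTopology G] [T2Space G] [MeasurableSpace G] [BorelSpace G]
  {H K : Subgroup G} [hH : IsClosed (H : Set G)] [hK : IsClosed (K : Set G)]
  (D : CosetMeasures H K)

theorem lamH_pos (x t : G) : 0 < D.lamH x t := div_pos (D.corrH.pos _) (D.corrH.pos _)
theorem lamK_pos (x t : G) : 0 < D.lamK x t := div_pos (D.corrK.pos _) (D.corrK.pos _)

theorem lamH_cosetInv (t : G) : CosetInv H fun x => D.lamH x t :=
  D.corrH.ratio_cosetInv (j := H.subtype) (isClosedEmbedding_subtype H) H.range_subtype t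

theorem lamK_cosetInv (t : G) : CosetInv K fun x => D.lamK x t :=
  D.corrK.ratio_cosetInv (j := K.subtype) (isClosedEmbedding_subtype K) K.range_subtype t

theorem lamH_mul (x s t : G) : D.lamH x (s * t) = D.lamH x s * D.lamH (x * s) t := by
  have := (D.corrH.pos x).ne'
  have := (D.corrH.pos (x * s)).ne'
  simp only [lamH, mul_assoc] at *
  field_simp

theorem lamK_mul (x s t : G) : D.lamK x (s * t) = D.lamK x s * D.lamK (x * s) t := by
  have := (D.corrK.pos x).ne'
  have := (D.corrK.pos (x * s)).ne'
  simp only [lamK, mul_assoc] at *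
  field_simp

theorem continuous_lamH : Continuous fun w : G × G => D.lamH w.1 w.2 := by
  have := D.corrH.continuous
  exact (this.comp continuous_mul).div (this.comp continuous_fst) fun w => (D.corrH.pos _).ne'

theorem continuous_lamK : Continuous fun w : G × G => D.lamK w.1 w.2 := by
  have := D.corrK.continuous
  exact (this.comp continuous_mul).div (this.comp continuous_fst) fun w => (D.corrK.pos _).ne'

theorem continuous_lamH_right (x : G) : Continuous (D.lamH x) :=
  D.continuous_lamH.comp (continuous_const.prodMk continuous_id : Continuous fun t : G => (x, t))

theorem continuous_lamK_right (x : G) : Continuous (D.lamK x) :=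
  D.continuous_lamK.comp (continuous_const.prodMk continuous_id : Continuous fun t : G => (x, t))

theorem continuous_lamH_left (t : G) : Continuous fun x => D.lamH x t :=
  D.continuous_lamH.comp (continuous_id.prodMk continuous_const : Continuous fun x : G => (x, t))

theorem continuous_lamK_left (t : G) : Continuous fun x => D.lamK x t :=
  D.continuous_lamK.comp (continuous_id.prodMk continuous_const : Continuous fun x : G => (x, t))

instance (x y : G) : SigmaFinite (D.μ x y) := (D.corr x y).sigmaFinite

/-- The density of the translate by `s` of the product measure on `G / H × G / K`. -/
def transDensity (s : G) (q : RCoset H × RCoset K) : ℝ≥0∞ :=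
  ENNReal.ofReal (D.lamH q.1.out s⁻¹) * ENNReal.ofReal (D.lamK q.2.out s⁻¹)

theorem measurable_lamH_out (s : G) : Measurable fun z : RCoset H => D.lamH z.out s :=
  (D.lamH_cosetInv s).measurable (D.continuous_lamH_left s).measurable

theorem measurable_lamK_out (s : G) : Measurable fun z : RCoset K => D.lamK z.out s :=
  (D.lamK_cosetInv s).measurable (D.continuous_lamK_left s).measurable

theorem measurable_transDensity (s : G) : Measurable (D.transDensity s) := by
  have h1 := D.measurable_lamH_out s⁻¹
  have h2 := D.measurable_lamK_out s⁻¹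
  exact (h1.comp measurable_fst).ennreal_ofReal.mul (h2.comp measurable_snd).ennreal_ofReal

theorem transDensity_orb (s x y t : G) : D.transDensity s (orb H K x y t)
    = ENNReal.ofReal (D.lamH (x * t) s⁻¹) * ENNReal.ofReal (D.lamK (y * t) s⁻¹) := by
  simp only [transDensity, orb]
  rw [(D.lamH_cosetInv s⁻¹).out, (D.lamK_cosetInv s⁻¹).out]

theorem lintegral_translate_H {f : RCoset H → ℝ≥0∞} (hf : Measurable f) (s : G) :
    ∫⁻ u, f (RCoset.translate H s u) ∂D.μH
      = ∫⁻ u, f u * ENNReal.ofReal (D.lamH u.out s⁻¹) ∂D.μH := by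
  have := D.corrH.lintegral_translate (j := H.subtype) (isClosedEmbedding_subtype H)
    H.range_subtype (hf.comp (RCoset.measurable_mk H)) (CosetInv.comp_mk f) s
  simp only [Function.comp_def, RCoset.mk_out] at this
  refine Eq.trans (lintegral_congr fun u => ?_) this
  rw [← RCoset.translate_mk, RCoset.mk_out]

theorem lintegral_translate_K {f : RCoset K → ℝ≥0∞} (hf : Measurable f) (s : G) :
    ∫⁻ u, f (RCoset.translate K s u) ∂D.μK
      = ∫⁻ u, f u * ENNReal.ofReal (D.lamK u.out s⁻¹) ∂D.μK := by
  have := D.corrK.lintegral_translate (j := K.subtype) (isClosedEmbedding_subtype K)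
    K.range_subtype (hf.comp (RCoset.measurable_mk K)) (CosetInv.comp_mk f) s
  simp only [Function.comp_def, RCoset.mk_out] at this
  refine Eq.trans (lintegral_congr fun u => ?_) this
  rw [← RCoset.translate_mk, RCoset.mk_out]

theorem lintegral_translate₂ {F : RCoset H × RCoset K → ℝ≥0∞} (hF : Measurable F) (s : G) :
    ∫⁻ q, F (translate₂ H K s q) ∂(D.μH.prod D.μK)
      = ∫⁻ q, F q * D.transDensity s q ∂(D.μH.prod D.μK) := by
  have h1 := (D.measurable_lamH_out s⁻¹).ennreal_ofReal
  have h2 := (D.measurable_lamK_out s⁻¹).ennreal_ofReal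
  have hFτ : Measurable fun q => F (translate₂ H K s q) := hF.comp (measurable_translate₂ s)
  have hFL : Measurable fun q => F q * D.transDensity s q := hF.mul (D.measurable_transDensity s)
  rw [lintegral_prod _ hFτ.aemeasurable, lintegral_prod _ hFL.aemeasurable]
  have e1 : ∀ u, ∫⁻ v, F (translate₂ H K s (u, v)) ∂D.μK
      = ∫⁻ v, F (RCoset.translate H s u, v) * ENNReal.ofReal (D.lamK v.out s⁻¹) ∂D.μK := fun u =>
    D.lintegral_translate_K (f := fun v => F (RCoset.translate H s u, v))
      (hF.comp (measurable_const.prodMk measurable_id)) s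
  simp only [e1]
  have hm : Measurable fun q : RCoset H × RCoset K => F q * ENNReal.ofReal (D.lamK q.2.out s⁻¹) :=
    hF.mul (h2.comp measurable_snd)
  rw [D.lintegral_translate_H
    (f := fun u => ∫⁻ v, F (u, v) * ENNReal.ofReal (D.lamK v.out s⁻¹) ∂D.μK)
    hm.lintegral_prod_right']
  refine lintegral_congr fun u => ?_
  have hmu : Measurable fun v => F (u, v) * ENNReal.ofReal (D.lamK v.out s⁻¹) :=
    hm.comp (measurable_const.prodMk measurable_id : Measurable fun v : RCoset K => (u, v))
  rw [← lintegral_mul_const _ hmu]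
  refine lintegral_congr fun v => ?_
  simp only [transDensity]
  ring

/-- On almost every orbit the translate by `s` has the expected density. -/
theorem ae_map_translate (s : G) : ∀ᵐ d ∂D.μHK,
    (D.dMeasure d).map (translate₂ H K s) = (D.dMeasure d).withDensity (D.transDensity s) := by
  obtain ⟨k, hk, hk0, hk1, hk2⟩ := exists_weight (D.μH.prod D.μK)
  have hτ := measurable_translate₂ (H := H) (K := K) s
  have hτ' := measurable_translate₂ (H := H) (K := K) s⁻¹
  have hL := D.measurable_transDensity s
  have e1 : ∀ F : RCoset H × RCoset K → ℝ≥0∞, Measurable F → ∀ d,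
      ∫⁻ q, F q ∂((D.dMeasure d).map (translate₂ H K s))
        = ∫⁻ q, F (translate₂ H K s q) ∂(D.dMeasure d) := fun F hF d => lintegral_map hF hτ
  have e2 : ∀ F : RCoset H × RCoset K → ℝ≥0∞, Measurable F → ∀ d,
      ∫⁻ q, F q ∂((D.dMeasure d).withDensity (D.transDensity s))
        = ∫⁻ q, F q * D.transDensity s q ∂(D.dMeasure d) := fun F hF d => by
    rw [lintegral_withDensity_eq_lintegral_mul _ hL hF]
    simp [mul_comm]
  -- The weight is translated by `s⁻¹` so that its integral against the translated family is the
  -- integral of `k` over `G/H × G/K`, which is finite.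
  refine ae_eq_of_forall_setLIntegral_lintegral_eq (k := fun q => k (translate₂ H K s⁻¹ q))
    ?_ ?_ ?_ (hk.comp hτ') (fun q => hk0 _) (fun q => hk1 _) ?_
  · intro F hF
    simp only [e1 F hF]
    exact D.aemeasurable_dMeasure (hF.comp hτ)
  · intro F hF
    simp only [e2 F hF]
    exact D.aemeasurable_dMeasure (hF.mul hL)
  · intro S hS F hF
    simp only [e1 F hF, e2 F hF]
    have hFτ : Measurable fun q => F (translate₂ H K s q) := hF.comp hτ
    have hFL : Measurable fun q => F q * D.transDensity s q := hF.mul hL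
    rw [D.setLIntegral_dMeasure hFτ hS, D.setLIntegral_dMeasure hFL hS]
    have := D.lintegral_translate₂ (hF.indicator (measurable_toDCoset hS)) s
    refine Eq.trans (lintegral_congr fun q => ?_) (this.trans (lintegral_congr fun q => ?_))
    · have hq : translate₂ H K s q ∈ toDCoset H K ⁻¹' S ↔ q ∈ toDCoset H K ⁻¹' S := by
        simp only [Set.mem_preimage, toDCoset_translate₂]
      by_cases h : q ∈ toDCoset H K ⁻¹' S
      · rw [Set.indicator_of_mem h, Set.indicator_of_mem (hq.2 h)]
      · rw [Set.indicator_of_notMem h, Set.indicator_of_notMem (mt hq.1 h)]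
    · by_cases hq : q ∈ toDCoset H K ⁻¹' S <;> simp only [Set.indicator, hq, if_true, if_false,
        zero_mul]
  · have hkτ : Measurable fun q => k (translate₂ H K s⁻¹ q) := hk.comp hτ'
    simp only [e1 _ hkτ, translate₂_inv]
    rwa [D.lintegral_dMeasure hk]

/-- On almost every double coset `λ_{x,y}(e,t) = λ_H(x,t) λ_K(y,t)`. -/
theorem generic_lam : D.Generic fun x y => ∀ t, D.lam x y t = D.lamH x t * D.lamK y t := by
  -- The exceptional null set depends on the translation, so only a countable dense family of
  -- translations is used.
  have hae : ∀ᵐ d ∂D.μHK, ∀ n : ℕ, (D.dMeasure d).map (translate₂ H K (TopologicalSpace.denseSeq G n))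
      = (D.dMeasure d).withDensity (D.transDensity (TopologicalSpace.denseSeq G n)) :=
    ae_all_iff.2 fun n => D.ae_map_translate _
  filter_upwards [hae] with d hd x y hxy
  rw [← hxy, dMeasure_mk] at hd
  have hc := (D.corr x y).continuous
  have hpos := (D.corr x y).pos
  have hN := (stab H K x y).range_subtype
  have hNe := isClosedEmbedding_subtype (stab H K x y)
  have key : ∀ n : ℕ, (fun t => D.ρ x y (t * (TopologicalSpace.denseSeq G n)⁻¹) / D.ρ x y t)
      = fun t => D.lamH (x * t) (TopologicalSpace.denseSeq G n)⁻¹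
        * D.lamK (y * t) (TopologicalSpace.denseSeq G n)⁻¹ := by
    intro n
    set s := TopologicalSpace.denseSeq G n
    have hs := hd n
    have hr := (D.corr x y).ratio_cosetInv (j := (stab H K x y).subtype) hNe hN s⁻¹
    have hrm : Measurable fun t => D.ρ x y (t * s⁻¹) / D.ρ x y t := by
      have := hc.measurable
      fun_prop
    have hA : Measurable fun z : RCoset (stab H K x y) =>
        ENNReal.ofReal (D.ρ x y (z.out * s⁻¹) / D.ρ x y z.out) :=
      (hr.measurable hrm).ennreal_ofReal
    have hB : Measurable fun z : RCoset (stab H K x y) =>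
        D.transDensity s (orbitMap H K x y z) :=
      (D.measurable_transDensity s).comp (measurable_orbitMap x y)
    have hae : (fun z : RCoset (stab H K x y) =>
        ENNReal.ofReal (D.ρ x y (z.out * s⁻¹) / D.ρ x y z.out)) =ᵐ[D.μ x y] fun z =>
          D.transDensity s (orbitMap H K x y z) := by
      refine ae_eq_of_forall_lintegral_mul hA hB fun f hf => ?_
      -- Every test function on `G/N_{x,y}` extends along the orbit embedding. The equality of
      -- measures on `G/H × G/K` thus becomes an equality of densities on `G/N_{x,y}`.
      obtain ⟨F, hF, hFf⟩ := (measurableEmbedding_orbitMap (H := H) (K := K) x y).exists_measurable_extend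
        hf (fun _ => ⟨0⟩)
      have hFf' : ∀ z, F (orbitMap H K x y z) = f z := fun z => congrFun hFf z
      have h1 := (D.corr x y).lintegral_translate (j := (stab H K x y).subtype) hNe hN
        (hf.comp (RCoset.measurable_mk _)) (CosetInv.comp_mk f) s
      simp only [Function.comp_def, RCoset.mk_out] at h1
      rw [← h1]
      have h2 : ∫⁻ q, F q ∂((D.orbMeasure x y).map (translate₂ H K s))
          = ∫⁻ q, F q ∂((D.orbMeasure x y).withDensity (D.transDensity s)) := by rw [hs]
      have hFτ : Measurable fun q => F (translate₂ H K s q) := hF.comp (measurable_translate₂ s)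
      rw [lintegral_map hF (measurable_translate₂ s),
        lintegral_withDensity_eq_lintegral_mul _ (D.measurable_transDensity s) hF,
        D.lintegral_orbMeasure _ _ hFτ,
        D.lintegral_orbMeasure _ _ ((D.measurable_transDensity s).mul hF)] at h2
      simp only [Pi.mul_apply, hFf'] at h2
      simp only [mul_comm (f _)]
      rw [← h2]
      refine lintegral_congr fun z => ?_
      rw [← hFf', orbitMap_mk, ← translate₂_orb, ← orbitMap_mk, RCoset.mk_out]
    rw [Filter.EventuallyEq, (D.corr x y).ae_iff hN (measurableSet_eq_fun hA hB)] at hae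
    have c1 := D.continuous_lamH_left s⁻¹
    have c2 := D.continuous_lamK_left s⁻¹
    refine eq_of_ae_eq_rightHaar ?_ ?_ ?_
    · exact (hc.comp (continuous_mul_const _)).div hc fun t => (hpos t).ne'
    · exact (c1.comp (continuous_const_mul x)).mul (c2.comp (continuous_const_mul y))
    · filter_upwards [hae] with t ht
      rw [hr.out t, orbitMap_mk, D.transDensity_orb,
        ← ENNReal.ofReal_mul (D.lamH_pos _ _).le] at ht
      exact (ENNReal.ofReal_eq_ofReal_iff (div_pos (hpos _) (hpos _)).le
        (mul_pos (D.lamH_pos _ _) (D.lamK_pos _ _)).le).1 ht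
  -- At `t = 1` the previous identity gives the claim for inverses of the dense sequence, and both
  -- sides are continuous in `s`.
  have hdense : (fun s : G => D.lam x y s⁻¹) = fun s => D.lamH x s⁻¹ * D.lamK y s⁻¹ := by
    refine (TopologicalSpace.denseRange_denseSeq G).equalizer ?_ ?_ ?_
    · exact (hc.comp continuous_inv).div_const _
    · exact ((D.continuous_lamH_right x).comp continuous_inv).mul
        ((D.continuous_lamK_right y).comp continuous_inv)
    · ext n
      have := congrFun (key n) 1
      simpa [lam] using this
  intro t
  simpa using congrFun hdense t⁻¹

end CosetMeasures

end ApqSpace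

namespace ApqSpace

/-! ### From `G × G` to double cosets, and measurable densities for the orbit measures -/

namespace CosetMeasures

variable {G : Type*} [Group G] [TopologicalSpace G] [IsTopologicalGroup G] [LocallyCompactSpace G]
  [SecondCountableTopology G] [T2Space G] [MeasurableSpace G] [BorelSpace G]
  {H K : Subgroup G} [hH : IsClosed (H : Set G)] [hK : IsClosed (K : Set G)]
  (D : CosetMeasures H K)

/-- A property that holds almost everywhere on `G × G` holds at almost every translate of every
point of almost every double coset. -/
theorem generic_of_ae {P : G → G → Prop}
    (hP : ∀ᵐ w ∂((rightHaar G).prod (rightHaar G)), P w.1 w.2) :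
    D.Generic fun x y => ∀ᵐ s ∂(rightHaar G), ∃ h ∈ H, ∃ k ∈ K, P (h * x * s) (k * y * s) := by
  obtain ⟨B, hB, hBm, hB0⟩ := exists_measurable_superset_of_null hP
  set φ : G → G → G × H × K → ℝ≥0∞ := fun x y q =>
    B.indicator 1 (q.2.1 * x * q.1, q.2.2 * y * q.1)
  have h1B : Measurable (B.indicator (1 : G × G → ℝ≥0∞)) := measurable_one.indicator hBm
  have hφ : Measurable fun z : (G × G) × (G × H × K) => φ z.1.1 z.1.2 z.2 := by
    apply h1B.comp
    fun_prop
  set m : Measure (G × H × K) := (rightHaar G).prod ((rightHaar H).prod (rightHaar K))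
  -- `g w` measures the triples `(s, h, k)` that move `w` into the bad set `B`. Its vanishing
  -- depends only on the double coset, and it vanishes almost everywhere by Tonelli's theorem.
  set g : G × G → ℝ≥0∞ := fun w => ∫⁻ q, φ w.1 w.2 q ∂m
  have hg : Measurable g := hφ.lintegral_prod_right'
  have hφq : ∀ x y, Measurable (φ x y) := fun x y =>
    hφ.comp (measurable_const.prodMk measurable_id : Measurable fun q : G × H × K => ((x, y), q))
  have hgnest : ∀ x y, g (x, y) = ∫⁻ s, ∫⁻ h, ∫⁻ k, φ x y (s, h, k)
      ∂(rightHaar K) ∂(rightHaar H) ∂(rightHaar G) := by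
    intro x y
    simp only [g, m]
    rw [lintegral_prod _ (hφq x y).aemeasurable]
    refine lintegral_congr fun s => ?_
    exact lintegral_prod _ ((hφq x y).comp
      (measurable_const.prodMk measurable_id : Measurable fun q : H × K => (s, q))).aemeasurable
  have hginv : ∀ h0 ∈ H, ∀ k0 ∈ K, ∀ x y s0, g (x, y) = 0 → g (h0 * x * s0, k0 * y * s0) = 0 := by
    intro h0 hh0 k0 hk0 x y s0 h
    obtain ⟨c, -, hc⟩ := exists_lintegral_mul_left_rightHaar s0
    have e1 : ∀ s, ∫⁻ h : H, ∫⁻ k : K, φ (h0 * x * s0) (k0 * y * s0) (s, h, k)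
        ∂(rightHaar K) ∂(rightHaar H)
        = ∫⁻ h : H, ∫⁻ k : K, φ x y (s0 * s, h, k) ∂(rightHaar K) ∂(rightHaar H) := by
      intro s
      rw [← lintegral_rightHaar_mul_right (fun h : H => ∫⁻ k : K, φ x y (s0 * s, h, k)
        ∂(rightHaar K)) ⟨h0, hh0⟩]
      refine lintegral_congr fun h => ?_
      rw [← lintegral_rightHaar_mul_right (fun k : K => φ x y (s0 * s, h * ⟨h0, hh0⟩, k))
        ⟨k0, hk0⟩]
      simp only [φ, Subgroup.coe_mul, mul_assoc]
    have hm3 : Measurable fun s => ∫⁻ h : H, ∫⁻ k : K, φ x y (s, h, k)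
        ∂(rightHaar K) ∂(rightHaar H) := by
      have : Measurable fun z : (G × H) × K => φ x y (z.1.1, z.1.2, z.2) :=
        (hφq x y).comp (by fun_prop)
      exact this.lintegral_prod_right'.lintegral_prod_right'
    rw [hgnest]
    simp only [e1]
    rw [hc _ hm3, ← hgnest, h, mul_zero]
  -- For fixed `(s, h, k)` the map `w ↦ (h x s, k y s)` multiplies Haar measure on `G × G` by a
  -- constant, so it pulls the null set `B` back to a null set.
  have hg0 : ∀ᵐ w ∂((rightHaar G).prod (rightHaar G)), g w = 0 := by
    refine (lintegral_eq_zero_iff hg).1 ?_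
    simp only [g]
    rw [lintegral_lintegral_swap hφ.aemeasurable]
    refine (lintegral_eq_zero_iff hφ.lintegral_prod_left').2 (.of_forall ?_)
    rintro ⟨s, h, k⟩
    have hw : Measurable fun w : G × G => φ w.1 w.2 (s, h, k) :=
      hφ.comp (measurable_id.prodMk measurable_const :
        Measurable fun w : G × G => (w, (s, h, k)))
    obtain ⟨c, -, hc⟩ := exists_lintegral_mul_left_rightHaar (h : G)
    obtain ⟨c', -, hc'⟩ := exists_lintegral_mul_left_rightHaar (k : G)
    have hB' : ∫⁻ x, ∫⁻ y, B.indicator (1 : G × G → ℝ≥0∞) (x, y) ∂(rightHaar G) ∂(rightHaar G)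
        = 0 := by
      rw [← lintegral_prod _ h1B.aemeasurable, lintegral_indicator_one hBm, hB0]
    have e1 : ∀ x, ∫⁻ y, φ x y (s, h, k) ∂(rightHaar G)
        = c' * ∫⁻ y, B.indicator (1 : G × G → ℝ≥0∞) (h * x * s, y) ∂(rightHaar G) := by
      intro x
      have hm1 : Measurable fun y => B.indicator (1 : G × G → ℝ≥0∞) (h * x * s, y) :=
        h1B.comp (measurable_const.prodMk measurable_id)
      rw [← lintegral_rightHaar_mul_right (fun y => B.indicator (1 : G × G → ℝ≥0∞)
        (h * x * s, y)) s]
      have hm1' : Measurable fun y => B.indicator (1 : G × G → ℝ≥0∞) (h * x * s, y * s) :=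
        hm1.comp (measurable_mul_const s)
      rw [← hc' _ hm1']
    change ∫⁻ w : G × G, φ w.1 w.2 (s, h, k) ∂((rightHaar G).prod (rightHaar G)) = 0
    rw [lintegral_prod _ hw.aemeasurable]
    simp only [e1]
    have hm2 : Measurable fun x => ∫⁻ y, B.indicator (1 : G × G → ℝ≥0∞) (x, y) ∂(rightHaar G) :=
      h1B.lintegral_prod_right'
    rw [lintegral_const_mul' _ _ ENNReal.coe_ne_top,
      hc (fun x => ∫⁻ y, B.indicator (1 : G × G → ℝ≥0∞) (x * s, y) ∂(rightHaar G))
        (hm2.comp (measurable_mul_const s)),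
      lintegral_rightHaar_mul_right (fun x => ∫⁻ y, B.indicator (1 : G × G → ℝ≥0∞) (x, y)
        ∂(rightHaar G)), hB']
    simp
  have hgen : D.Generic fun x y => g (x, y) = 0 := by
    refine generic_of_ae_out hginv ?_
    -- The set where `g` is nonzero is saturated, so it is the preimage of a measurable subset of
    -- `Υ`, and admissibility turns Haar-null into `μHK`-null.
    have hpre : DCoset.mk H K ⁻¹' {d | g d.out ≠ 0} = {w | g w ≠ 0} := by
      have key : ∀ w w' : G × G, DCoset.mk H K w = DCoset.mk H K w' → g w = 0 → g w' = 0 := by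
        rintro ⟨x, y⟩ ⟨x', y'⟩ hw h
        obtain ⟨h0, hh0, k0, hk0, s, rfl, rfl⟩ := DCoset.mk_eq_iff.1 hw
        exact hginv h0 hh0 k0 hk0 x y s h
      ext w
      have := DCoset.mk_out (DCoset.mk H K w)
      exact not_congr ⟨key _ _ this, key _ _ this.symm⟩
    have hF : MeasurableSet {d : DCoset H K | g d.out ≠ 0} := by
      have : MeasurableSet (DCoset.mk H K ⁻¹' {d | g d.out ≠ 0}) := by
        rw [hpre]
        exact (hg (measurableSet_singleton 0)).compl
      exact this
    refine (D.admissible _ hF).2 ?_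
    rw [hpre]
    exact hg0
  refine hgen.mono fun x y hxy => ?_
  have hae : ∀ᵐ q ∂m, φ x y q = 0 := (lintegral_eq_zero_iff (hφq x y)).1 hxy
  filter_upwards [Measure.ae_ae_of_ae_prod hae] with s hs
  have hmH : (ae (rightHaar H)).NeBot := ae_neBot.2 (NeZero.ne _)
  have hmK : (ae (rightHaar K)).NeBot := ae_neBot.2 (NeZero.ne _)
  obtain ⟨h, hh⟩ := (Measure.ae_ae_of_ae_prod hs).exists
  obtain ⟨k, hhk⟩ := hh.exists
  refine ⟨h, h.2, k, k.2, ?_⟩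
  by_contra hcon
  have : ((h : G) * x * s, (k : G) * y * s) ∈ B := hB hcon
  simp [φ, this] at hhk

theorem orbMeasure_ne_zero (x y : G) : D.orbMeasure x y ≠ 0 := by
  intro h
  have h1 : D.orbMeasure x y Set.univ = 0 := by rw [h]; simp
  rw [orbMeasure, Measure.map_apply (measurable_orbitMap x y) MeasurableSet.univ,
    Set.preimage_univ, (D.corr x y).null_iff (j := (stab H K x y).subtype)
    (stab H K x y).range_subtype MeasurableSet.univ, Set.preimage_univ,
    Measure.measure_univ_eq_zero] at h1
  exact NeZero.ne (rightHaar G) h1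

open ProbabilityTheory in
/-- The measures on the orbits are the images of measures on the group, with densities that
depend measurably on the orbit. -/
theorem exists_lift : ∃ (P : Measure G) (b : G × G → G → ℝ≥0), IsFiniteMeasure P ∧
    Measurable (Function.uncurry b) ∧ D.Generic fun x y =>
      D.μ x y = (P.withDensity fun t => b (x, y) t).map (RCoset.mk (stab H K x y)) := by
  set P : Measure G := (rightHaar G).toFinite
  obtain ⟨k, hk, hk0, hk1, hk2⟩ := exists_weight (D.μH.prod D.μK)
  obtain ⟨η, T, hη, hT, hηT⟩ := exists_kernel_of_family (μ := D.μHK) (m := D.dMeasure)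
    (fun F hF => D.aemeasurable_dMeasure hF) hk hk0 (by rwa [D.lintegral_dMeasure hk])
    (.of_forall fun d => D.orbMeasure_ne_zero _ _)
  have hmk : Measurable (DCoset.mk H K) := measurable_quotient_mk''
  set η' : Kernel (G × G) (RCoset H × RCoset K) := η.comap (DCoset.mk H K) hmk
  -- `κ w` is the image of a fixed finite measure, equivalent to Haar measure, under the orbit map
  -- of `w`. The Radon–Nikodym derivative of one kernel with respect to another is jointly
  -- measurable, which is where the joint measurability of `b` comes from.
  set κ : Kernel (G × G) (RCoset H × RCoset K) :=
    (Kernel.id ×ₖ Kernel.const (G × G) P).map fun q => orb H K q.1.1 q.1.2 q.2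
  have hκ : ∀ x y, κ (x, y) = P.map (orb H K x y) := by
    intro x y
    simp only [κ]
    rw [Kernel.map_apply _ measurable_orb, Kernel.prod_apply, Kernel.id_apply, Kernel.const_apply,
      Measure.dirac_prod, Measure.map_map measurable_orb (by fun_prop)]
    rfl
  have hκfin : IsFiniteKernel κ := by
    have := measurable_orb (H := H) (K := K)
    simp only [κ]
    infer_instance
  set r := η'.rnDeriv κ
  have hr : Measurable fun z : (G × G) × (RCoset H × RCoset K) => r z.1 z.2 :=
    Kernel.measurable_rnDeriv _ _
  -- The density restores the total mass `T` and undoes the weight `k` that made the orbit measures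
  -- finite.
  refine ⟨P, fun w t => T (DCoset.mk H K w) * (r w (orb H K w.1 w.2 t)).toNNReal
      * (k (orb H K w.1 w.2 t))⁻¹.toNNReal, inferInstance, ?_, ?_⟩
  · have h1 : Measurable fun z : (G × G) × G => T (DCoset.mk H K z.1) :=
      hT.comp (hmk.comp measurable_fst)
    have h2 : Measurable fun z : (G × G) × G => r z.1 (orb H K z.1.1 z.1.2 z.2) :=
      hr.comp (measurable_fst.prodMk measurable_orb)
    have h3 : Measurable fun z : (G × G) × G => k (orb H K z.1.1 z.1.2 z.2) :=
      hk.comp measurable_orb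
    exact (h1.mul h2.ennreal_toNNReal).mul h3.inv.ennreal_toNNReal
  · filter_upwards [hηT] with d hd x y hxy
    rw [← hxy, dMeasure_mk] at hd
    have hηw : η' (x, y) = η (DCoset.mk H K (x, y)) := rfl
    have horb := measurable_orb_right (H := H) (K := K) x y
    have horbM := measurable_orbitMap (H := H) (K := K) x y
    have hN := (stab H K x y).range_subtype
    have hT0 : T (DCoset.mk H K (x, y)) ≠ 0 := by
      intro h0
      rw [h0, zero_smul] at hd
      refine D.orbMeasure_ne_zero x y (eq_of_withDensity_eq hk hk0 hk1 ?_)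
      rw [hd, withDensity_zero_left]
    -- A quasi-invariant measure on `G/N_{x,y}` has the same null sets as Haar measure on `G`, read
    -- through the coset map. Since `T` does not vanish here, the weighted orbit measure passes this
    -- on to `η'`.
    have hac : η' (x, y) ≪ κ (x, y) := by
      refine Measure.AbsolutelyContinuous.mk fun B hB h0 => ?_
      rw [hκ, Measure.map_apply horb hB] at h0
      have h1 : rightHaar G (orb H K x y ⁻¹' B) = 0 := absolutelyContinuous_toFinite _ h0
      have h2 : D.orbMeasure x y B = 0 := by
        rw [orbMeasure, Measure.map_apply horbM hB, (D.corr x y).null_iff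
          (j := (stab H K x y).subtype) hN (horbM hB)]
        convert h1 using 2
        ext t
        simp only [Set.mem_preimage, orbitMap_mk]
      have h3 : (D.orbMeasure x y).withDensity k B = 0 :=
        withDensity_absolutelyContinuous _ _ h2
      rw [hd, Measure.smul_apply, ENNReal.smul_def, smul_eq_mul, mul_eq_zero] at h3
      exact h3.resolve_left (by simpa using hT0)
    have hrn : η' (x, y) = (κ (x, y)).withDensity (r (x, y)) := by
      rw [← Kernel.withDensity_rnDeriv_eq hac, Kernel.withDensity_apply _
        (Kernel.measurable_rnDeriv _ _)]
    have hrfin : ∀ᵐ q ∂(κ (x, y)), r (x, y) q ≠ ∞ := Kernel.rnDeriv_ne_top _ _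
    have hrm : Measurable (r (x, y)) := hr.comp
      (measurable_const.prodMk measurable_id :
        Measurable fun q : RCoset H × RCoset K => ((x, y), q))
    set c : RCoset H × RCoset K → ℝ≥0∞ := fun q => ((T (DCoset.mk H K (x, y)) *
      (r (x, y) q).toNNReal * (k q)⁻¹.toNNReal : ℝ≥0) : ℝ≥0∞)
    have hc : Measurable c :=
      ((hrm.ennreal_toNNReal.const_mul _).mul hk.inv.ennreal_toNNReal).coe_nnreal_ennreal
    have horbeq : D.orbMeasure x y = (κ (x, y)).withDensity c := by
      refine eq_of_withDensity_eq hk hk0 hk1 ?_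
      have hsm : ∀ m' : Measure (RCoset H × RCoset K), T (DCoset.mk H K (x, y)) • m' =
          ((T (DCoset.mk H K (x, y)) : ℝ≥0) : ℝ≥0∞) • m' := fun _ => rfl
      rw [hd, ← hηw, hrn, ← withDensity_mul _ hc hk, hsm,
        ← withDensity_smul' _ _ ENNReal.coe_ne_top]
      refine withDensity_congr_ae ?_
      filter_upwards [hrfin] with q hq
      simp only [Pi.smul_apply, Pi.mul_apply, smul_eq_mul, c, ENNReal.coe_mul,
        ENNReal.coe_toNNReal hq, ENNReal.coe_toNNReal (ENNReal.inv_ne_top.2 (hk0 q))]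
      rw [mul_assoc, ENNReal.inv_mul_cancel (hk0 q) (hk1 q), mul_one]
    refine (measurableEmbedding_orbitMap (H := H) (K := K) x y).map_injective ?_
    have hb : Measurable fun t => c (orb H K x y t) := hc.comp horb
    change D.orbMeasure x y = Measure.map _ (Measure.map _ (P.withDensity fun t =>
      c (orb H K x y t)))
    rw [Measure.map_map horbM (RCoset.measurable_mk _), horbeq, hκ]
    have : orbitMap H K x y ∘ RCoset.mk (stab H K x y) = orb H K x y := by
      ext t : 1
      exact orbitMap_mk x y t
    rw [this]
    ext B hB
    rw [Measure.map_apply horb hB, withDensity_apply _ hB, withDensity_apply _ (horb hB),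
      setLIntegral_map hB hc horb]

end CosetMeasures

end ApqSpace

namespace ApqSpace

/-! ### Functoriality of the projective tensor product -/

section Projective

variable {V W V' W' : Type*} [NormedAddCommGroup V] [NormedSpace ℂ V]
  [NormedAddCommGroup W] [NormedSpace ℂ W] [NormedAddCommGroup V'] [NormedSpace ℂ V']
  [NormedAddCommGroup W'] [NormedSpace ℂ W']

theorem norm_algTensor_le {u : AlgTensor V W} {c : ℝ} (hc : c ∈ projCosts u) : ‖u‖ ≤ c :=
  csInf_le (projCosts_bddBelow u) hc

theorem norm_algTmul_le (v : V) (w : W) : ‖algTmul v w‖ ≤ ‖v‖ * ‖w‖ :=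
  norm_algTensor_le ⟨[(v, w)], by simp, by simp⟩

theorem norm_tmul_le (v : V) (w : W) : ‖tmul v w‖ ≤ ‖v‖ * ‖w‖ := by
  rw [tmul, UniformSpace.Completion.norm_coe]
  exact norm_algTmul_le v w

variable (V W) in
/-- The elementary tensor as a continuous bilinear map. -/
def tmulL : V →L[ℂ] W →L[ℂ] ProjTensor V W :=
  LinearMap.mkContinuous₂
    (LinearMap.mk₂ ℂ (fun v w => (tmul v w : ProjTensor V W))
      (fun v v' w => by
        rw [tmul, show algTmul (v + v') w = algTmul v w + algTmul v' w from
          TensorProduct.add_tmul v v' w]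
        exact UniformSpace.Completion.coe_add _ _)
      (fun c v w => by
        rw [tmul, show algTmul (c • v) w = c • algTmul v w from rfl]
        exact UniformSpace.Completion.coe_smul _ _)
      (fun v w w' => by
        rw [tmul, show algTmul v (w + w') = algTmul v w + algTmul v w' from
          TensorProduct.tmul_add v w w']
        exact UniformSpace.Completion.coe_add _ _)
      (fun c v w => by
        rw [tmul, show algTmul v (c • w) = c • algTmul v w from TensorProduct.tmul_smul c v w]
        exact UniformSpace.Completion.coe_smul _ _)) 1
    (fun v w => by simpa using norm_tmul_le v w)

theorem tmulL_apply (v : V) (w : W) : tmulL V W v w = tmul v w := rfl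

theorem continuous_tmul : Continuous fun z : V × W => (tmul z.1 z.2 : ProjTensor V W) :=
  (tmulL V W).continuous₂

/-- The functoriality of the algebraic tensor product. -/
def algMap (A : V →L[ℂ] V') (B : W →L[ℂ] W') : AlgTensor V W →ₗ[ℂ] AlgTensor V' W' :=
  (TensorProduct.map (A : V →ₗ[ℂ] V') (B : W →ₗ[ℂ] W') : V ⊗[ℂ] W →ₗ[ℂ] V' ⊗[ℂ] W')

theorem algMap_algTmul (A : V →L[ℂ] V') (B : W →L[ℂ] W') (v : V) (w : W) :
    algMap A B (algTmul v w) = algTmul (A v) (B w) :=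
  TensorProduct.map_tmul _ _ _ _

theorem norm_algMap_le (A : V →L[ℂ] V') (B : W →L[ℂ] W') (u : AlgTensor V W) :
    ‖algMap A B u‖ ≤ ‖A‖ * ‖B‖ * ‖u‖ := by
  have key : ∀ c ∈ projCosts u, ‖algMap A B u‖ ≤ ‖A‖ * ‖B‖ * c := by
    rintro c ⟨l, rfl, rfl⟩
    induction l with
    | nil => simp
    | cons a l ih =>
      simp only [List.map_cons, List.sum_cons, map_add, mul_add]
      refine (norm_add_le _ _).trans (add_le_add ?_ ih)
      rw [algMap_algTmul]
      refine (norm_algTmul_le _ _).trans ?_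
      calc ‖A a.1‖ * ‖B a.2‖ ≤ (‖A‖ * ‖a.1‖) * (‖B‖ * ‖a.2‖) :=
            mul_le_mul (A.le_opNorm _) (B.le_opNorm _) (norm_nonneg _) (by positivity)
        _ = ‖A‖ * ‖B‖ * (‖a.1‖ * ‖a.2‖) := by ring
  refine le_of_forall_pos_le_add fun ε hε => ?_
  obtain ⟨c, hc, hcε⟩ := Real.lt_sInf_add_pos (projCosts_nonempty u)
    (show 0 < ε / (‖A‖ * ‖B‖ + 1) by positivity)
  have hu : sInf (projCosts u) = ‖u‖ := rfl
  rw [hu] at hcε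
  have h1 : ‖A‖ * ‖B‖ * (ε / (‖A‖ * ‖B‖ + 1)) ≤ ε := by
    rw [mul_div_assoc', div_le_iff₀ (by positivity)]
    nlinarith
  have h2 : ‖A‖ * ‖B‖ * c ≤ ‖A‖ * ‖B‖ * (‖u‖ + ε / (‖A‖ * ‖B‖ + 1)) :=
    mul_le_mul_of_nonneg_left hcε.le (by positivity)
  linarith [key c hc]

/-- The functoriality of the projective tensor product. -/
def projMap (A : V →L[ℂ] V') (B : W →L[ℂ] W') : ProjTensor V W →L[ℂ] ProjTensor V' W' :=
  ((algMap A B).mkContinuous (‖A‖ * ‖B‖) (norm_algMap_le A B)).completion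

theorem projMap_tmul (A : V →L[ℂ] V') (B : W →L[ℂ] W') (v : V) (w : W) :
    projMap A B (tmul v w) = tmul (A v) (B w) := by
  rw [projMap, tmul, ContinuousLinearMap.completion_apply_coe]
  simp only [LinearMap.mkContinuous_apply, algMap_algTmul, tmul]

theorem norm_projMap_le (A : V →L[ℂ] V') (B : W →L[ℂ] W') (hA : ‖A‖ ≤ 1) (hB : ‖B‖ ≤ 1)
    (u : ProjTensor V W) : ‖projMap A B u‖ ≤ ‖u‖ := by
  induction u using UniformSpace.Completion.induction_on with
  | hp => exact isClosed_le (by fun_prop) (by fun_prop)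
  | ih a =>
    rw [projMap, ContinuousLinearMap.completion_apply_coe, UniformSpace.Completion.norm_coe,
      UniformSpace.Completion.norm_coe]
    refine (norm_algMap_le A B a).trans ?_
    have : ‖A‖ * ‖B‖ ≤ 1 := mul_le_one₀ hA (norm_nonneg _) hB
    exact mul_le_of_le_one_left (norm_nonneg _) this

end Projective

/-! ### The action of `H × K` on the fibres -/

section Fibres

variable {G : Type*} [Group G] {V W : Type*} [NormedAddCommGroup V] [NormedSpace ℂ V]
  [NormedAddCommGroup W] [NormedSpace ℂ W] {H K : Subgroup G}
  (π : H →* (V ≃ₗᵢ[ℂ] V)) (γ : K →* (W ≃ₗᵢ[ℂ] W))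

theorem norm_dualAct_le (k : K) (η : StrongDual ℂ W) : ‖dualAct γ k η‖ ≤ ‖η‖ := by
  refine ContinuousLinearMap.opNorm_le_bound _ (norm_nonneg _) fun w => ?_
  refine (η.le_opNorm _).trans_eq ?_
  congr 1
  exact (γ k⁻¹).norm_map w

theorem dualAct_mul (k k' : K) (η : StrongDual ℂ W) :
    dualAct γ (k * k') η = dualAct γ k (dualAct γ k' η) := by
  ext w
  simp [dualAct]

theorem dualAct_one (η : StrongDual ℂ W) : dualAct γ 1 η = η := by
  ext w
  simp [dualAct]

theorem norm_dualAct (k : K) (η : StrongDual ℂ W) : ‖dualAct γ k η‖ = ‖η‖ := by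
  refine le_antisymm (norm_dualAct_le γ k η) ?_
  conv_lhs => rw [← dualAct_one γ η, ← inv_mul_cancel k, dualAct_mul]
  exact norm_dualAct_le γ _ _

theorem dualAct_inv (k : K) (η : StrongDual ℂ W) :
    η.comp ((γ k).toContinuousLinearEquiv : W →L[ℂ] W) = dualAct γ k⁻¹ η := by
  rw [dualAct, inv_inv]

/-- The dual representation as continuous linear maps. -/
def dualActL (k : K) : StrongDual ℂ W →L[ℂ] StrongDual ℂ W :=
  LinearMap.mkContinuous
    { toFun := dualAct γ k
      map_add' := fun _ _ => rfl
      map_smul' := fun _ _ => rfl } 1 (fun η => (norm_dualAct_le γ k η).trans_eq (one_mul _).symm)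

theorem dualActL_apply (k : K) (η : StrongDual ℂ W) : dualActL γ k η = dualAct γ k η := rfl

/-- The action `π(h) ⊗ γ*(k)` of `H × K` on the projective tensor product. -/
def tensorAct (h : H) (k : K) : ProjTensor V (StrongDual ℂ W) →L[ℂ] ProjTensor V (StrongDual ℂ W) :=
  projMap ((π h).toContinuousLinearEquiv : V →L[ℂ] V) (dualActL γ k)

theorem tensorAct_tmul (h : H) (k : K) (ξ : V) (η : StrongDual ℂ W) :
    tensorAct π γ h k (tmul ξ η) = tmul (π h ξ) (dualAct γ k η) :=
  projMap_tmul _ _ _ _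

theorem norm_tensorAct_le (h : H) (k : K) (u : ProjTensor V (StrongDual ℂ W)) :
    ‖tensorAct π γ h k u‖ ≤ ‖u‖ := by
  refine norm_projMap_le _ _ ?_ ?_ u
  · refine ContinuousLinearMap.opNorm_le_bound _ zero_le_one fun v => ?_
    rw [one_mul]
    exact ((π h).norm_map v).le
  · exact LinearMap.mkContinuous_norm_le _ zero_le_one _

/-- A relation at `(x, y)` given by `(h', k')` is carried to the relation at `(hx, ky)` given by the
conjugates `h h' h⁻¹` and `k k' k⁻¹`. Translation by `s` changes nothing, and continuity passes from
the span to its closure. -/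
theorem tensorAct_mem_balancing {x y s : G} (h : H) (k : K) {u : ProjTensor V (StrongDual ℂ W)}
    (hu : u ∈ balancing π γ x y) :
    tensorAct π γ h k u ∈ balancing π γ (h * x * s) (k * y * s) := by
  rw [balancing_mul]
  have hset : ∀ u ∈ balancingSet π γ x y,
      tensorAct π γ h k u ∈ balancingSet π γ (h * x) (k * y) := by
    rintro _ ⟨h', k', ξ, η, heq, rfl⟩
    refine ⟨h * h' * h⁻¹, k * k' * k⁻¹, π h ξ, dualAct γ k η, ?_, ?_⟩
    · have : ∀ a b c : G, (a * c)⁻¹ * (a * b * a⁻¹) * (a * c) = c⁻¹ * b * c := by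
        intro a b c
        group
      simpa only [Subgroup.coe_mul, Subgroup.coe_inv, this] using heq
    · rw [map_sub, tensorAct_tmul, tensorAct_tmul, dualAct_inv, dualAct_inv]
      have e1 : π (h * h' * h⁻¹) (π h ξ) = π h (π h' ξ) := by
        have e : ∀ a b : H, ∀ v, π (a * b) v = π a (π b v) := fun a b v => by
          rw [map_mul]
          rfl
        rw [← e, ← e, inv_mul_cancel_right]
      have e2 : dualAct γ (k * k' * k⁻¹)⁻¹ (dualAct γ k η) = dualAct γ k (dualAct γ k'⁻¹ η) := by
        rw [← dualAct_mul, ← dualAct_mul]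
        congr 1
        group
      rw [e1, e2]
  have hspan : Submodule.span ℂ (balancingSet π γ x y) ≤
      (Submodule.span ℂ (balancingSet π γ (h * x) (k * y))).comap
        (tensorAct π γ h k : _ →ₗ[ℂ] _) :=
    Submodule.span_le.2 fun u hu => Submodule.subset_span (hset u hu)
  have hu' : u ∈ closure (Submodule.span ℂ (balancingSet π γ x y) :
    Set (ProjTensor V (StrongDual ℂ W))) := hu
  have := map_mem_closure (tensorAct π γ h k).continuous hu'
    (t := (Submodule.span ℂ (balancingSet π γ (h * x) (k * y)) :
      Set (ProjTensor V (StrongDual ℂ W)))) fun u hu => hspan hu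
  exact this

/-- The bundle quotient map. -/
def toFibre (x y : G) : ProjTensor V (StrongDual ℂ W) →L[ℂ] Fibre π γ x y :=
  (balancing π γ x y).mkQ.mkContinuous 1 (fun u => by
    rw [one_mul]
    exact Submodule.Quotient.norm_mk_le (balancing π γ x y) u)

theorem toFibre_apply (x y : G) (u : ProjTensor V (StrongDual ℂ W)) :
    toFibre π γ x y u = Submodule.Quotient.mk u := rfl

theorem norm_toFibre_le (x y : G) (u : ProjTensor V (StrongDual ℂ W)) :
    ‖toFibre π γ x y u‖ ≤ ‖u‖ :=
  Submodule.Quotient.norm_mk_le (balancing π γ x y) u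

/-- The map between the fibres over points of a double coset. -/
def fibreMap (x y s : G) (h : H) (k : K) :
    Fibre π γ x y →L[ℂ] Fibre π γ (h * x * s) (k * y * s) :=
  ((balancing π γ x y).mapQ (balancing π γ (h * x * s) (k * y * s))
    (tensorAct π γ h k).toLinearMap
    (fun u hu => tensorAct_mem_balancing (s := s) π γ h k hu)).mkContinuous 1
    (fun u => by
      rw [one_mul]
      refine le_of_forall_pos_le_add fun ε hε => ?_
      obtain ⟨m, rfl, hm⟩ := Submodule.Quotient.norm_mk_lt u hε
      refine le_trans ?_ hm.le
      rw [Submodule.mapQ_apply]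
      exact (Submodule.Quotient.norm_mk_le _ _).trans (norm_tensorAct_le π γ h k m))

theorem fibreMap_toFibre (x y s : G) (h : H) (k : K) (u : ProjTensor V (StrongDual ℂ W)) :
    fibreMap π γ x y s h k (toFibre π γ x y u) =
      toFibre π γ (h * x * s) (k * y * s) (tensorAct π γ h k u) := rfl

theorem norm_fibreMap_le (x y s : G) (h : H) (k : K) (u : Fibre π γ x y) :
    ‖fibreMap π γ x y s h k u‖ ≤ ‖u‖ := by
  have := (fibreMap π γ x y s h k).le_of_opNorm_le
    (LinearMap.mkContinuous_norm_le _ zero_le_one _) u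
  simpa using this

/-- Elementary tensors of equivariant functions are constant on the cosets of the stabilizer. -/
theorem toFibre_tmul_stab {f : G → V} {g : G → StrongDual ℂ W}
    (hf : ∀ (h : H) (x : G), f (h * x) = π h (f x))
    (hg : ∀ (k : K) (x : G), g (k * x) = dualAct γ k (g x)) (x y : G) {s : G}
    (hs : s ∈ stab H K x y) (t : G) :
    toFibre π γ x y (tmul (f (x * (s * t))) (g (y * (s * t)))) =
      toFibre π γ x y (tmul (f (x * t)) (g (y * t))) := by
  have hs1 : x * s * x⁻¹ ∈ H := hs.1
  have hs2 : y * s * y⁻¹ ∈ K := hs.2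
  have e1 : x * (s * t) = (⟨x * s * x⁻¹, hs1⟩ : H) * (x * t) := by simp; group
  have e2 : y * (s * t) = (⟨y * s * y⁻¹, hs2⟩ : K) * (y * t) := by simp; group
  rw [e1, e2, hf, hg, toFibre_apply, toFibre_apply, Submodule.Quotient.eq]
  -- The generator is taken with `η = γ*(k) g(yt)`. Its second term then applies `γ*(k)⁻¹` to `η`
  -- and becomes the untranslated tensor.
  refine Submodule.le_topologicalClosure _ (Submodule.subset_span
    ⟨⟨x * s * x⁻¹, hs1⟩, ⟨y * s * y⁻¹, hs2⟩, f (x * t), dualAct γ ⟨y * s * y⁻¹, hs2⟩ (g (y * t)),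
      ?_, ?_⟩)
  · simp; group
  · rw [dualAct_inv, ← dualAct_mul, inv_mul_cancel, dualAct_one]

end Fibres

end ApqSpace

namespace ApqSpace

/-! ### Weak and strong measurability in separable spaces -/

section Pettis

variable {U : Type*} [NormedAddCommGroup U] [NormedSpace ℂ U]
  [TopologicalSpace.SeparableSpace U]

/-- Norming functionals of a dense sequence suffice, because all the functionals are 1-Lipschitz. -/
theorem exists_norming_seq (U : Type*) [NormedAddCommGroup U] [NormedSpace ℂ U]
    [TopologicalSpace.SeparableSpace U] :
    ∃ φ : ℕ → StrongDual ℂ U, ∀ u : U, ‖u‖ₑ = ⨆ n, ‖φ n u‖ₑ := by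
  have : Nonempty U := ⟨0⟩
  choose φ hφ1 hφ2 using fun n => exists_dual_vector'' ℂ (TopologicalSpace.denseSeq U n)
  refine ⟨φ, fun u => le_antisymm ?_ (iSup_le fun n => ?_)⟩
  · refine ENNReal.le_of_forall_pos_le_add fun ε hε _ => ?_
    obtain ⟨n, hn⟩ := Metric.denseRange_iff.1 (TopologicalSpace.denseRange_denseSeq U) u (ε / 2)
      (by positivity)
    set d := TopologicalSpace.denseSeq U n
    rw [dist_eq_norm] at hn
    have h1 : ‖u‖ ≤ ‖φ n u‖ + ε := by
      have e1 : ‖u‖ ≤ ‖u - d‖ + ‖d‖ := by simpa using norm_add_le (u - d) d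
      have e2 : ‖d‖ = ‖φ n d‖ := by rw [hφ2 n]; simp [d]
      have e3 : ‖φ n d‖ ≤ ‖φ n u‖ + ‖φ n (u - d)‖ := by
        have := norm_sub_le (φ n u) (φ n (u - d))
        rwa [← map_sub, sub_sub_cancel] at this
      have e4 : ‖φ n (u - d)‖ ≤ ‖u - d‖ := (φ n).le_of_opNorm_le_of_le (hφ1 n) le_rfl |>.trans_eq
        (one_mul _)
      linarith
    have h2 : ‖u‖ₑ ≤ ‖φ n u‖ₑ + ε := by
      have : ‖u‖₊ ≤ ‖φ n u‖₊ + ε := h1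
      simp only [enorm_eq_nnnorm]
      exact_mod_cast this
    exact h2.trans (add_le_add_left (le_iSup (fun n => ‖φ n u‖ₑ) n) _)
  · have : ‖φ n u‖ ≤ ‖u‖ := ((φ n).le_of_opNorm_le_of_le (hφ1 n) le_rfl).trans_eq (one_mul _)
    have h : ‖φ n u‖₊ ≤ ‖u‖₊ := this
    simp only [enorm_eq_nnnorm]
    exact_mod_cast h

/-- In a separable space every open set is a countable union of balls, and preimages of balls are
sublevel sets of distances. -/
theorem measurable_of_enorm_sub {X : Type*} [MeasurableSpace X] [MeasurableSpace U] [BorelSpace U]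
    {f : X → U} (hf : ∀ c : U, Measurable fun x => ‖f x - c‖ₑ) : Measurable f := by
  have := UniformSpace.secondCountable_of_separable U
  refine measurable_of_isOpen fun s hs => ?_
  obtain ⟨T, hTc, hT⟩ := TopologicalSpace.isOpen_iUnion_countable
    (fun q : {q : U × ℝ≥0∞ // Metric.eball q.1 q.2 ⊆ s} => Metric.eball q.1.1 q.1.2)
    fun _ => Metric.isOpen_eball
  have hs' : s = ⋃ q ∈ T, Metric.eball q.1.1 q.1.2 := by
    rw [hT]
    ext u
    simp only [Set.mem_iUnion, Subtype.exists]
    constructor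
    · intro hu
      obtain ⟨ε, hε, h⟩ := EMetric.isOpen_iff.1 hs u hu
      exact ⟨(u, ε), h, Metric.mem_eball_self hε⟩
    · rintro ⟨q, hq, hu⟩
      exact hq hu
  rw [hs', Set.preimage_iUnion₂]
  refine MeasurableSet.biUnion hTc fun q _ => ?_
  have : f ⁻¹' Metric.eball q.1.1 q.1.2 = {x | ‖f x - q.1.1‖ₑ < q.1.2} := by
    ext x
    simp [Metric.mem_eball, edist_eq_enorm_sub]
  rw [this]
  exact measurableSet_lt (hf _) measurable_const

/-- A weakly measurable function with values in a separable space is strongly measurable. -/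
theorem stronglyMeasurable_of_dual {X : Type*} [MeasurableSpace X] {f : X → U}
    (hf : ∀ φ : StrongDual ℂ U, Measurable fun x => φ (f x)) : StronglyMeasurable f := by
  borelize U
  have := UniformSpace.secondCountable_of_separable U
  obtain ⟨φ, hφ⟩ := exists_norming_seq U
  refine (measurable_of_enorm_sub fun c => ?_).stronglyMeasurable
  simp only [hφ, map_sub]
  exact Measurable.iSup fun n => ((hf _).sub_const _).enorm

end Pettis

/-! ### Norm continuity of the dual representation -/

section DualAction

variable {G : Type*} [Group G] [TopologicalSpace G] [IsTopologicalGroup G] [LocallyCompactSpace G]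
  [SecondCountableTopology G] [T2Space G] [MeasurableSpace G] [BorelSpace G]
  {K : Subgroup G} [hK : IsClosed (K : Set G)]
  {W : Type*} [NormedAddCommGroup W] [NormedSpace ℂ W]
  [TopologicalSpace.SeparableSpace W] [TopologicalSpace.SeparableSpace (StrongDual ℂ W)]
  (γ : K →* (W ≃ₗᵢ[ℂ] W)) (hγ : ∀ w : W, Continuous fun k => γ k w)

include hγ in
-- A priori `γ*` is only weak-* continuous. The dual norm is a supremum over a dense sequence in
-- `W`, so distances to fixed functionals are measurable, and separability of the dual does the
-- rest.
theorem stronglyMeasurable_dualAct (η : StrongDual ℂ W) :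
    StronglyMeasurable fun k => dualAct γ k η := by
  borelize (StrongDual ℂ W)
  have := UniformSpace.secondCountable_of_separable (StrongDual ℂ W)
  have hd : Continuous fun n : ℕ => n := continuous_id
  refine (measurable_of_enorm_sub fun c => ?_).stronglyMeasurable
  have : Nonempty W := ⟨0⟩
  have hnorm : ∀ φ : StrongDual ℂ W, ‖φ‖ₑ =
      ⨆ n, ‖φ (TopologicalSpace.denseSeq W n)‖ₑ / ‖TopologicalSpace.denseSeq W n‖ₑ := by
    intro φ
    refine le_antisymm ?_ (iSup_le fun n => ?_)
    · set s := ⨆ n, ‖φ (TopologicalSpace.denseSeq W n)‖ₑ / ‖TopologicalSpace.denseSeq W n‖ₑ with hs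
      by_cases hst : s = ∞
      · rw [hst]; exact le_top
      have h1 : ∀ w, ‖φ w‖ ≤ s.toReal * ‖w‖ := by
        intro w
        refine (TopologicalSpace.denseRange_denseSeq W).induction_on
          (p := fun w => ‖φ w‖ ≤ s.toReal * ‖w‖) w
          (isClosed_le (by fun_prop) (by fun_prop)) fun n => ?_
        have h2 : ‖φ (TopologicalSpace.denseSeq W n)‖ₑ ≤ s * ‖TopologicalSpace.denseSeq W n‖ₑ := by
          by_cases h0 : TopologicalSpace.denseSeq W n = 0
          · simp [h0]
          · exact (ENNReal.div_le_iff (by simpa using h0) (by simp)).1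
              (le_iSup (fun n => ‖φ (TopologicalSpace.denseSeq W n)‖ₑ /
                ‖TopologicalSpace.denseSeq W n‖ₑ) n)
        have h3 := ENNReal.toReal_mono (ENNReal.mul_ne_top hst (by simp)) h2
        simpa [ENNReal.toReal_mul] using h3
      have h4 := φ.opNorm_le_bound ENNReal.toReal_nonneg h1
      rw [← ofReal_norm]
      exact ENNReal.ofReal_le_of_le_toReal h4
    · refine ENNReal.div_le_of_le_mul ?_
      have : ‖φ (TopologicalSpace.denseSeq W n)‖₊ ≤ ‖φ‖₊ * ‖TopologicalSpace.denseSeq W n‖₊ :=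
        φ.le_opNorm _
      simp only [enorm_eq_nnnorm]
      exact_mod_cast this
  simp only [hnorm]
  refine Measurable.iSup fun n => Measurable.div_const (Measurable.enorm ?_) _
  have hc : Continuous fun k : K => η (γ k⁻¹ (TopologicalSpace.denseSeq W n)) :=
    η.continuous.comp ((hγ _).comp continuous_inv)
  exact (hc.sub (continuous_const (y := c (TopologicalSpace.denseSeq W n)))).measurable

include hγ in
-- Automatic continuity by Steinhaus. Separability covers `K` by countably many measurable sets on
-- which the orbit of `η` varies by less than `ε`. One of them has positive Haar measure, and its
-- quotient set is a neighbourhood of `1` that moves `η` by less than `ε`. The action is isometric,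
-- so this settles continuity everywhere.
theorem continuous_dualAct (η : StrongDual ℂ W) : Continuous fun k => dualAct γ k η := by
  have hm := stronglyMeasurable_dualAct γ hγ η
  borelize (StrongDual ℂ W)
  have : Nonempty (StrongDual ℂ W) := ⟨0⟩
  set d := TopologicalSpace.denseSeq (StrongDual ℂ W)
  have hone : Filter.Tendsto (fun k => dualAct γ k η) (𝓝 1) (𝓝 η) := by
    rw [Metric.tendsto_nhds]
    intro ε hε
    set E : ℕ → Set K := fun n => {k | ‖dualAct γ k⁻¹ η - d n‖ < ε / 2}
    have hE : ∀ n, MeasurableSet (E n) := fun n => by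
      have hmk : Measurable fun k => ‖dualAct γ k⁻¹ η - d n‖ :=
        ((hm.comp_measurable measurable_inv).sub stronglyMeasurable_const).norm.measurable
      exact measurableSet_lt hmk measurable_const
    have hU : ⋃ n, E n = Set.univ := by
      refine Set.eq_univ_of_forall fun k => Set.mem_iUnion.2 ?_
      obtain ⟨n, hn⟩ := Metric.denseRange_iff.1
        (TopologicalSpace.denseRange_denseSeq (StrongDual ℂ W)) (dualAct γ k⁻¹ η) (ε / 2)
        (by positivity)
      exact ⟨n, by rwa [dist_eq_norm] at hn⟩
    obtain ⟨n, hn⟩ : ∃ n, 0 < (Measure.haar : Measure K) (E n) := by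
      by_contra hcon
      push Not at hcon
      have h0 : (Measure.haar : Measure K) (⋃ n, E n) = 0 :=
        measure_iUnion_null fun n => le_antisymm (hcon n) bot_le
      rw [hU, Measure.measure_univ_eq_zero] at h0
      exact NeZero.ne (Measure.haar : Measure K) h0
    filter_upwards [Measure.div_mem_nhds_one_of_haar_pos Measure.haar (E n) (hE n) hn] with k hk
    obtain ⟨a, ha, b, hb, rfl⟩ := Set.mem_div.1 hk
    rw [dist_eq_norm]
    have e : ‖dualAct γ (a / b) η - η‖ = ‖dualAct γ b⁻¹ η - dualAct γ a⁻¹ η‖ := by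
      rw [← norm_dualAct γ a⁻¹ (dualAct γ (a / b) η - η), ← dualActL_apply, map_sub,
        dualActL_apply, dualActL_apply, ← dualAct_mul]
      congr 3
      rw [div_eq_mul_inv, inv_mul_cancel_left]
    rw [e]
    have ha' : ‖dualAct γ a⁻¹ η - d n‖ < ε / 2 := ha
    have hb' : ‖dualAct γ b⁻¹ η - d n‖ < ε / 2 := hb
    calc _ = ‖(dualAct γ b⁻¹ η - d n) - (dualAct γ a⁻¹ η - d n)‖ := by rw [sub_sub_sub_cancel_right]
      _ ≤ _ := norm_sub_le _ _
      _ < ε := by linarith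
  refine continuous_iff_continuousAt.2 fun k => ?_
  have h1 : Filter.Tendsto (fun k' => dualAct γ (k⁻¹ * k') η) (𝓝 k) (𝓝 η) := by
    refine hone.comp ?_
    have : Filter.Tendsto (fun k' : K => k⁻¹ * k') (𝓝 k) (𝓝 (k⁻¹ * k)) :=
      (continuous_const_mul k⁻¹).tendsto k
    rwa [inv_mul_cancel] at this
  have h2 := ((dualActL γ k).continuous.tendsto η).comp h1
  refine Filter.Tendsto.congr (fun k' => ?_) h2
  simp only [Function.comp_apply, dualActL_apply]
  rw [← dualAct_mul, mul_inv_cancel_left]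

end DualAction

/-! ### Measurability of the norm in a varying fibre -/

section NormMeasurable

variable {G : Type*} [Group G] [TopologicalSpace G] [IsTopologicalGroup G] [LocallyCompactSpace G]
  [SecondCountableTopology G] [T2Space G] [MeasurableSpace G] [BorelSpace G]
  {H K : Subgroup G} [hH : IsClosed (H : Set G)] [hK : IsClosed (K : Set G)]
  {V W : Type*} [NormedAddCommGroup V] [NormedSpace ℂ V] [TopologicalSpace.SeparableSpace V]
  [NormedAddCommGroup W] [NormedSpace ℂ W]
  [TopologicalSpace.SeparableSpace W] [TopologicalSpace.SeparableSpace (StrongDual ℂ W)]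
  (π : H →* (V ≃ₗᵢ[ℂ] V)) (hπ : ∀ v : V, Continuous fun h => π h v)
  (γ : K →* (W ≃ₗᵢ[ℂ] W)) (hγ : ∀ w : W, Continuous fun k => γ k w)

/-- The generators of the subspaces by which the fibres are formed. -/
def balancingTensor (a : H × K) (ζ : V × StrongDual ℂ W) : ProjTensor V (StrongDual ℂ W) :=
  tmul (π a.1 ζ.1) ζ.2 - tmul ζ.1 (dualAct γ a.2⁻¹ ζ.2)

theorem continuous_balancingTensor_right (a : H × K) : Continuous (balancingTensor π γ a) := by
  have h1 : Continuous fun ζ : V × StrongDual ℂ W => (π a.1 ζ.1, ζ.2) := by fun_prop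
  have h2 : Continuous fun ζ : V × StrongDual ℂ W => (ζ.1, dualActL γ a.2⁻¹ ζ.2) := by fun_prop
  exact (continuous_tmul.comp h1).sub (continuous_tmul.comp h2)

include hπ hγ in
theorem continuous_balancingTensor_left (ζ : V × StrongDual ℂ W) :
    Continuous fun a => balancingTensor π γ a ζ := by
  have h1 : Continuous fun a : H × K => (π a.1 ζ.1, ζ.2) :=
    ((hπ _).comp continuous_fst).prodMk continuous_const
  have h2 : Continuous fun a : H × K => (ζ.1, dualAct γ a.2⁻¹ ζ.2) :=
    continuous_const.prodMk ((continuous_dualAct γ hγ _).comp continuous_snd.inv)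
  exact (continuous_tmul.comp h1).sub (continuous_tmul.comp h2)

theorem balancingTensor_smul (a : H × K) (c : ℂ) (ζ : V × StrongDual ℂ W) :
    balancingTensor π γ a (c • ζ.1, ζ.2) = c • balancingTensor π γ a ζ := by
  simp only [balancingTensor, ← tmulL_apply, map_smul, smul_apply, smul_sub]

/-- The quotient norm is an infimum over the span of the generators. Scalars are absorbed into the
first vectors, and density lets all vectors run through a sequence, so the only uncountable
parameters left are finitely many group elements. The bound `≤ q` with `q` rational keeps the
conditions closed. -/
theorem norm_toFibre_lt_iff {x y : G} {v : ProjTensor V (StrongDual ℂ W)} {ε : ℝ}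
    {d : ℕ → V × StrongDual ℂ W} (hd : DenseRange d) :
    ‖toFibre π γ x y v‖ < ε ↔ ∃ (n : ℕ) (i : Fin n → ℕ) (q : ℚ), (q : ℝ) < ε ∧
      ∃ a : Fin n → H × K, (∀ j, x⁻¹ * (a j).1 * x = y⁻¹ * (a j).2 * y) ∧
        ‖v - ∑ j, balancingTensor π γ (a j) (d (i j))‖ ≤ q := by
  constructor
  · intro h
    obtain ⟨δ, hδ0, hδ⟩ : ∃ δ, 0 < δ ∧ ‖toFibre π γ x y v‖ + δ = ε :=
      ⟨ε - ‖toFibre π γ x y v‖, by linarith, by ring⟩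
    obtain ⟨m, hm, hmε⟩ := Submodule.Quotient.norm_mk_lt (toFibre π γ x y v) (half_pos hδ0)
    have hmem : v - m ∈ closure (Submodule.span ℂ (balancingSet π γ x y) :
        Set (ProjTensor V (StrongDual ℂ W))) := (Submodule.Quotient.eq _).1 hm.symm
    obtain ⟨u, hu, huv⟩ := Metric.mem_closure_iff.1 hmem (δ / 2) (half_pos hδ0)
    obtain ⟨n, c, b, rfl⟩ := Submodule.mem_span_set'.1 hu
    choose h' k' ξ η hbal hb using fun j => (b j).2
    have hsum : ∑ j, c j • (b j : ProjTensor V (StrongDual ℂ W)) =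
        ∑ j, balancingTensor π γ (h' j, k' j) (c j • ξ j, η j) := by
      refine Finset.sum_congr rfl fun j _ => ?_
      rw [hb, balancingTensor_smul π γ (h' j, k' j) (c j) (ξ j, η j), balancingTensor, dualAct_inv]
    have hcont : Continuous fun ζ : Fin n → V × StrongDual ℂ W =>
        ‖v - ∑ j, balancingTensor π γ (h' j, k' j) (ζ j)‖ := by
      refine (continuous_const.sub (continuous_finsetSum _ fun j _ => ?_)).norm
      exact (continuous_balancingTensor_right π γ _).comp (continuous_apply j)
    have hlt : ‖v - ∑ j, balancingTensor π γ (h' j, k' j) (c j • ξ j, η j)‖ < ε := by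
      rw [← hsum]
      rw [dist_eq_norm] at huv
      calc _ = ‖m + ((v - m) - ∑ j, c j • (b j : ProjTensor V (StrongDual ℂ W)))‖ := by
            congr 1; abel
        _ ≤ _ := norm_add_le _ _
        _ < ε := by linarith
    have hdn : DenseRange fun i : Fin n → ℕ => fun j => d (i j) := DenseRange.piMap fun _ => hd
    obtain ⟨i, hi⟩ := hdn.exists_mem_open (hcont.isOpen_preimage _ isOpen_Iio)
      ⟨fun j => (c j • ξ j, η j), hlt⟩
    obtain ⟨q, hq1, hq2⟩ := exists_rat_btwn (show _ < ε from hi)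
    exact ⟨n, i, q, hq2, fun j => (h' j, k' j), hbal, hq1.le⟩
  · rintro ⟨n, i, q, hq, a, ha, hle⟩
    refine lt_of_le_of_lt ?_ hq
    refine le_trans ?_ hle
    have hmem : ∑ j, balancingTensor π γ (a j) (d (i j)) ∈ balancing π γ x y := by
      refine Submodule.sum_mem _ fun j _ => Submodule.le_topologicalClosure _
        (Submodule.subset_span ⟨(a j).1, (a j).2, (d (i j)).1, (d (i j)).2, ha j, ?_⟩)
      rw [dualAct_inv, balancingTensor]
    have : toFibre π γ x y v = toFibre π γ x y (v - ∑ j, balancingTensor π γ (a j) (d (i j))) := by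
      rw [toFibre_apply, toFibre_apply, Submodule.Quotient.eq, sub_sub_cancel]
      exact hmem
    rw [this]
    exact norm_toFibre_le π γ x y _

include hπ hγ in
theorem measurable_norm_toFibre_const (v : ProjTensor V (StrongDual ℂ W)) :
    Measurable fun w : G × G => ‖toFibre π γ w.1 w.2 v‖ := by
  have : Nonempty (V × StrongDual ℂ W) := ⟨0⟩
  set d := TopologicalSpace.denseSeq (V × StrongDual ℂ W)
  have hd : DenseRange d := TopologicalSpace.denseRange_denseSeq _
  refine measurable_of_Iio fun ε => ?_
  have : (fun w : G × G => ‖toFibre π γ w.1 w.2 v‖) ⁻¹' Set.Iio ε =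
      ⋃ (n : ℕ) (i : Fin n → ℕ) (q : {q : ℚ // (q : ℝ) < ε}),
        (Prod.fst : (G × G) × (Fin n → H × K) → G × G) '' {z |
          (∀ j, z.1.1⁻¹ * (z.2 j).1 * z.1.1 = z.1.2⁻¹ * (z.2 j).2 * z.1.2) ∧
          ‖v - ∑ j, balancingTensor π γ (z.2 j) (d (i j))‖ ≤ q} := by
    ext w
    rw [Set.mem_preimage, Set.mem_Iio, norm_toFibre_lt_iff π γ hd]
    simp only [Set.mem_iUnion]
    constructor
    · rintro ⟨n, i, q, hq, a, ha⟩
      exact ⟨n, i, ⟨q, hq⟩, (w, a), ha, rfl⟩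
    · rintro ⟨n, i, q, ⟨w', a⟩, ha, rfl⟩
      exact ⟨n, i, q, q.2, a, ha⟩
  rw [this]
  refine .iUnion fun n => .iUnion fun i => .iUnion fun q => ?_
  -- The ambient space is `σ`-compact, so this closed set is too, and so is its projection. No
  -- theory of analytic sets is needed.
  have hclosed : IsClosed {z : (G × G) × (Fin n → H × K) |
      (∀ j, z.1.1⁻¹ * (z.2 j).1 * z.1.1 = z.1.2⁻¹ * (z.2 j).2 * z.1.2) ∧
        ‖v - ∑ j, balancingTensor π γ (z.2 j) (d (i j))‖ ≤ q} := by
    refine IsClosed.inter ?_ (isClosed_le (Continuous.norm (continuous_const.sub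
      (continuous_finsetSum _ fun j _ => ?_))) continuous_const)
    · have : {z : (G × G) × (Fin n → H × K) |
          ∀ j, z.1.1⁻¹ * ((z.2 j).1 : G) * z.1.1 = z.1.2⁻¹ * ((z.2 j).2 : G) * z.1.2} = ⋂ j,
          {z | z.1.1⁻¹ * ((z.2 j).1 : G) * z.1.1 = z.1.2⁻¹ * ((z.2 j).2 : G) * z.1.2} := by
        ext z; simp
      refine (this ▸ isClosed_iInter fun j => isClosed_eq (by fun_prop) (by fun_prop) :)
    · exact (continuous_balancingTensor_left π hπ γ hγ _).comp
        ((continuous_apply j).comp continuous_snd)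
  have hsc := (isSigmaCompact_univ.of_isClosed_subset hclosed (Set.subset_univ _)).image
    (continuous_fst : Continuous (Prod.fst : (G × G) × (Fin n → H × K) → G × G))
  obtain ⟨C, hC, hCU⟩ := hsc
  rw [← hCU]
  exact .iUnion fun n => (hC n).isClosed.measurableSet

include hπ hγ in
theorem measurable_norm_toFibre {h : G × G → ProjTensor V (StrongDual ℂ W)}
    (hh : StronglyMeasurable h) : Measurable fun w : G × G => ‖toFibre π γ w.1 w.2 (h w)‖ := by
  refine measurable_of_tendsto_metrizable (f := fun n w => ‖toFibre π γ w.1 w.2 (hh.approx n w)‖)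
    (fun n => ?_) (tendsto_pi_nhds.2 fun w => ?_)
  · refine measurable_of_Iio fun ε => ?_
    have : (fun w => ‖toFibre π γ w.1 w.2 (hh.approx n w)‖) ⁻¹' Set.Iio ε =
        ⋃ v ∈ (hh.approx n).range, (hh.approx n ⁻¹' {v}) ∩
          ((fun w : G × G => ‖toFibre π γ w.1 w.2 v‖) ⁻¹' Set.Iio ε) := by
      ext w
      simp
    rw [this]
    exact Finset.measurableSet_biUnion _ fun v _ => ((hh.approx n).measurableSet_fiber v).inter
      (measurable_norm_toFibre_const π hπ γ hγ v measurableSet_Iio)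
  · exact (((toFibre π γ w.1 w.2).continuous.tendsto _).comp (hh.tendsto_approx w)).norm

end NormMeasurable

end ApqSpace

namespace ApqSpace

section Descend

variable {A : Type*} [Group A] [MeasurableSpace A]

theorem stronglyMeasurable_rcoset {U : Type*} [TopologicalSpace U]
    [TopologicalSpace.PseudoMetrizableSpace U] {S : Subgroup A} {f : RCoset S → U}
    (hf : StronglyMeasurable fun a => f (RCoset.mk S a)) : StronglyMeasurable f := by
  borelize U
  rw [stronglyMeasurable_iff_measurable_separable] at hf ⊢
  refine ⟨RCoset.measurable_iff.2 hf.1, ?_⟩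
  have : Set.range f = Set.range fun a => f (RCoset.mk S a) := by
    ext u
    constructor
    · rintro ⟨z, rfl⟩
      exact ⟨z.out, by simp only [RCoset.mk_out]⟩
    · rintro ⟨a, rfl⟩
      exact ⟨_, rfl⟩
  rw [this]
  exact hf.2

end Descend

variable {G : Type*} [Group G] [TopologicalSpace G] [IsTopologicalGroup G] [LocallyCompactSpace G]
  [SecondCountableTopology G] [T2Space G] [MeasurableSpace G] [BorelSpace G]
  {H K : Subgroup G} [hH : IsClosed (H : Set G)] [hK : IsClosed (K : Set G)]

/-! ### The weight as a multiplicative cocycle -/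

namespace CosetMeasures

variable (D : CosetMeasures H K)

/-- The weight `λ_H(x,t)^{1/p-1} λ_K(y,t)^{1/q'-1}`. -/
def wt (p qd : ℝ) (x y t : G) : ℝ := D.lamH x t ^ (1 / p - 1) * D.lamK y t ^ (1 / qd - 1)

variable {p qd : ℝ}

theorem wt_pos (x y t : G) : 0 < D.wt p qd x y t :=
  mul_pos (Real.rpow_pos_of_pos (D.lamH_pos _ _) _) (Real.rpow_pos_of_pos (D.lamK_pos _ _) _)

theorem wt_mul (x y s t : G) :
    D.wt p qd x y (s * t) = D.wt p qd x y s * D.wt p qd (x * s) (y * s) t := by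
  simp only [wt, lamH_mul, lamK_mul]
  rw [Real.mul_rpow (D.lamH_pos _ _).le (D.lamH_pos _ _).le,
    Real.mul_rpow (D.lamK_pos _ _).le (D.lamK_pos _ _).le]
  ring

theorem wt_left {h k : G} (hh : h ∈ H) (hk : k ∈ K) (x y t : G) :
    D.wt p qd (h * x) (k * y) t = D.wt p qd x y t := by
  have e1 : D.lamH (h * x) t = D.lamH x t := D.lamH_cosetInv t h hh x
  have e2 : D.lamK (k * y) t = D.lamK y t := D.lamK_cosetInv t k hk y
  simp only [wt, e1, e2]

theorem wt_shift {h k : G} (hh : h ∈ H) (hk : k ∈ K) (x y s t : G) :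
    D.wt p qd (h * x * s) (k * y * s) (s⁻¹ * t) = (D.wt p qd x y s)⁻¹ * D.wt p qd x y t := by
  have := D.wt_mul (p := p) (qd := qd) x y s (s⁻¹ * t)
  rw [mul_inv_cancel_left] at this
  rw [mul_assoc h, mul_assoc k, D.wt_left hh hk, this, inv_mul_cancel_left₀ (D.wt_pos _ _ _).ne']

theorem wt_stab {x y s : G} (hs : s ∈ stab H K x y) (h1 : D.wt p qd x y s = 1) (t : G) :
    D.wt p qd x y (s * t) = D.wt p qd x y t := by
  rw [wt_mul, h1, one_mul]
  have e1 : x * s = (x * s * x⁻¹) * x := by group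
  have e2 : y * s = (y * s * y⁻¹) * y := by group
  rw [e1, e2, D.wt_left (mem_stab.1 hs).1 (mem_stab.1 hs).2]

theorem continuous_wt : Continuous fun z : (G × G) × G => D.wt p qd z.1.1 z.1.2 z.2 := by
  have h1 : Continuous fun z : (G × G) × G => D.lamH z.1.1 z.2 :=
    D.continuous_lamH.comp (by fun_prop : Continuous fun z : (G × G) × G => (z.1.1, z.2))
  have h2 : Continuous fun z : (G × G) × G => D.lamK z.1.2 z.2 :=
    D.continuous_lamK.comp (by fun_prop : Continuous fun z : (G × G) × G => (z.1.2, z.2))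
  exact (h1.rpow_const fun z => Or.inl (D.lamH_pos _ _).ne').mul
    (h2.rpow_const fun z => Or.inl (D.lamK_pos _ _).ne')

theorem continuous_wt_right (x y : G) : Continuous (D.wt p qd x y) :=
  ((D.continuous_lamH_right x).rpow_const fun _ => Or.inl (D.lamH_pos _ _).ne').mul
    ((D.continuous_lamK_right y).rpow_const fun _ => Or.inl (D.lamK_pos _ _).ne')

/-- This is the only use of the factorization of `λ_{x,y}` in the integrand: dividing by it lowers
both exponents by one. -/
theorem coefficient_eq {x y t : G} (h : D.lam x y t = D.lamH x t * D.lamK y t) :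
    (D.lam x y t)⁻¹ * D.lamH x t ^ (1 / p) * D.lamK y t ^ (1 / qd) = D.wt p qd x y t := by
  have h1 := D.lamH_pos x t
  have h2 := D.lamK_pos y t
  rw [wt, Real.rpow_sub_one h1.ne', Real.rpow_sub_one h2.ne', h]
  field_simp

end CosetMeasures

variable {V W : Type*} [NormedAddCommGroup V] [NormedSpace ℂ V] [TopologicalSpace.SeparableSpace V]
  [NormedAddCommGroup W] [NormedSpace ℂ W] [TopologicalSpace.SeparableSpace W]
  [TopologicalSpace.SeparableSpace (StrongDual ℂ W)]
  {π : H →* (V ≃ₗᵢ[ℂ] V)} {γ : K →* (W ≃ₗᵢ[ℂ] W)} {D : CosetMeasures H K} {p qd : ℝ}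

/-! ### Convergence, equivariance and measurability of the convolution -/

namespace TensorSeries

variable (F : TensorSeries π γ D p qd)

theorem stronglyMeasurable_f (i : ℕ) : StronglyMeasurable (F.f i) :=
  stronglyMeasurable_of_dual (F.memf i).1

theorem stronglyMeasurable_g (i : ℕ) : StronglyMeasurable (F.g i) :=
  stronglyMeasurable_of_dual (F.memg i).1

theorem cosetInv_f (i : ℕ) : CosetInv H fun x => ‖F.f i x‖ₑ := fun h hh x => by
  have := (F.memf i).2.1 ⟨h, hh⟩ x
  change ‖F.f i (h * x)‖ₑ = ‖F.f i x‖ₑ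
  simp only at this
  rw [this, ← ofReal_norm, LinearIsometryEquiv.norm_map, ofReal_norm]

theorem cosetInv_g (i : ℕ) : CosetInv K fun x => ‖F.g i x‖ₑ := fun k hk x => by
  have := (F.memg i).2.1 ⟨k, hk⟩ x
  change ‖F.g i (k * x)‖ₑ = ‖F.g i x‖ₑ
  simp only at this
  rw [this, ← ofReal_norm, norm_dualAct, ofReal_norm]

/-- The `i`-th term of the integrand, in the form it takes on almost every double coset, before
passing to the quotient. -/
def preTerm (x y : G) (i : ℕ) (t : G) : ProjTensor V (StrongDual ℂ W) :=
  ((D.wt p qd x y t : ℝ) : ℂ) • tmul (F.f i (x * t)) (F.g i (y * t))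

/-- The majorant of the norm of the `i`-th term. -/
def majorant (x y : G) (i : ℕ) (t : G) : ℝ≥0∞ :=
  ENNReal.ofReal (D.wt p qd x y t) * (‖F.f i (x * t)‖ₑ * ‖F.g i (y * t)‖ₑ)

/-- The integral of the sum of the majorants. -/
def bound (x y : G) : ℝ≥0∞ :=
  ∫⁻ z : RCoset (stab H K x y), ∑' i, F.majorant x y i z.out ∂(D.μ x y)

/-- The conditions under which the integral over a given orbit is meaningful. -/
structure Good (x y : G) : Prop where
  lam : ∀ t, D.lam x y t = D.lamH x t * D.lamK y t
  wt : ∀ s ∈ stab H K x y, D.wt p qd x y s = 1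
  bound : F.bound x y ≠ ∞

theorem term_eq {x y : G} (h : ∀ t, D.lam x y t = D.lamH x t * D.lamK y t) (i : ℕ) (t : G) :
    F.term x y i t = toFibre π γ x y (F.preTerm x y i t) := by
  rw [term, D.coefficient_eq (h t), preTerm, map_smul, toFibre_apply]

theorem enorm_preTerm_le (x y : G) (i : ℕ) (t : G) :
    ‖F.preTerm x y i t‖ₑ ≤ F.majorant x y i t := by
  rw [preTerm, enorm_smul, majorant]
  gcongr
  · rw [← ofReal_norm, Complex.norm_real, Real.norm_of_nonneg (D.wt_pos _ _ _).le]
  · have : ‖(tmul (F.f i (x * t)) (F.g i (y * t)) : ProjTensor V (StrongDual ℂ W))‖₊ ≤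
        ‖F.f i (x * t)‖₊ * ‖F.g i (y * t)‖₊ := norm_tmul_le _ _
    simp only [enorm_eq_nnnorm]
    exact_mod_cast this

theorem enorm_toFibre_le (x y : G) (u : ProjTensor V (StrongDual ℂ W)) :
    ‖toFibre π γ x y u‖ₑ ≤ ‖u‖ₑ := by
  have : ‖toFibre π γ x y u‖₊ ≤ ‖u‖₊ := norm_toFibre_le π γ x y u
  simp only [enorm_eq_nnnorm]
  exact_mod_cast this

theorem stronglyMeasurable_preTerm (i : ℕ) :
    StronglyMeasurable fun z : (G × G) × G => F.preTerm z.1.1 z.1.2 i z.2 := by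
  have h1 : StronglyMeasurable fun z : (G × G) × G => F.f i (z.1.1 * z.2) :=
    (F.stronglyMeasurable_f i).comp_measurable (by fun_prop)
  have h2 : StronglyMeasurable fun z : (G × G) × G => F.g i (z.1.2 * z.2) :=
    (F.stronglyMeasurable_g i).comp_measurable (by fun_prop)
  have h3 : StronglyMeasurable fun z : (G × G) × G => ((D.wt p qd z.1.1 z.1.2 z.2 : ℝ) : ℂ) :=
    (Complex.continuous_ofReal.comp D.continuous_wt).stronglyMeasurable
  exact h3.smul (continuous_tmul.comp_stronglyMeasurable (h1.prodMk h2))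

theorem measurable_majorant (i : ℕ) :
    Measurable fun z : (G × G) × G => F.majorant z.1.1 z.1.2 i z.2 := by
  have h1 : StronglyMeasurable fun z : (G × G) × G => F.f i (z.1.1 * z.2) :=
    (F.stronglyMeasurable_f i).comp_measurable (by fun_prop)
  have h2 : StronglyMeasurable fun z : (G × G) × G => F.g i (z.1.2 * z.2) :=
    (F.stronglyMeasurable_g i).comp_measurable (by fun_prop)
  exact D.continuous_wt.measurable.ennreal_ofReal.mul (h1.enorm.mul h2.enorm)

theorem measurable_majorant_right (x y : G) (i : ℕ) : Measurable (F.majorant x y i) := by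
  have h1 : StronglyMeasurable fun t => F.f i (x * t) :=
    (F.stronglyMeasurable_f i).comp_measurable (measurable_const_mul x)
  have h2 : StronglyMeasurable fun t => F.g i (y * t) :=
    (F.stronglyMeasurable_g i).comp_measurable (measurable_const_mul y)
  exact (D.continuous_wt_right x y).measurable.ennreal_ofReal.mul (h1.enorm.mul h2.enorm)

theorem stronglyMeasurable_preTerm_right (x y : G) (i : ℕ) :
    StronglyMeasurable (F.preTerm x y i) := by
  have h1 : StronglyMeasurable fun t => F.f i (x * t) :=
    (F.stronglyMeasurable_f i).comp_measurable (measurable_const_mul x)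
  have h2 : StronglyMeasurable fun t => F.g i (y * t) :=
    (F.stronglyMeasurable_g i).comp_measurable (measurable_const_mul y)
  exact (Complex.continuous_ofReal.comp (D.continuous_wt_right x y)).stronglyMeasurable.smul
    (continuous_tmul.comp_stronglyMeasurable (h1.prodMk h2))

variable {F} {x y : G}

theorem cosetInv_majorant (hw : ∀ s ∈ stab H K x y, D.wt p qd x y s = 1) (i : ℕ) :
    CosetInv (stab H K x y) (F.majorant x y i) := fun s hs t => by
  have e1 : ‖F.f i (x * (s * t))‖ₑ = ‖F.f i (x * t)‖ₑ := (F.cosetInv_f i).stab_left x y s hs t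
  have e2 : ‖F.g i (y * (s * t))‖ₑ = ‖F.g i (y * t)‖ₑ := (F.cosetInv_g i).stab_right x y s hs t
  rw [majorant, D.wt_stab hs (hw s hs), e1, e2, majorant]

theorem Good.cosetInv_term (hg : F.Good x y) (i : ℕ) :
    CosetInv (stab H K x y) (F.term x y i) := fun s hs t => by
  rw [F.term_eq hg.lam, F.term_eq hg.lam, preTerm, preTerm, D.wt_stab hs (hg.wt s hs),
    map_smul, map_smul]
  congr 1
  exact toFibre_tmul_stab π γ (fun h x => (F.memf i).2.1 h x) (fun k x => (F.memg i).2.1 k x)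
    x y hs t

theorem Good.stronglyMeasurable_term (hg : F.Good x y) (i : ℕ) :
    StronglyMeasurable fun z : RCoset (stab H K x y) => F.term x y i z.out := by
  refine stronglyMeasurable_rcoset ?_
  simp only [(hg.cosetInv_term i).out, F.term_eq hg.lam]
  exact (toFibre π γ x y).continuous.comp_stronglyMeasurable
    (F.stronglyMeasurable_preTerm_right x y i)

theorem Good.enorm_term_le (hg : F.Good x y) (i : ℕ) (t : G) :
    ‖F.term x y i t‖ₑ ≤ F.majorant x y i t := by
  rw [F.term_eq hg.lam]
  exact (enorm_toFibre_le x y _).trans (F.enorm_preTerm_le x y i t)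

theorem Good.ae_majorant (hg : F.Good x y) :
    ∀ᵐ z : RCoset (stab H K x y) ∂(D.μ x y), ∑' i, F.majorant x y i z.out ≠ ∞ := by
  have hm : Measurable fun z : RCoset (stab H K x y) => ∑' i, F.majorant x y i z.out :=
    Measurable.tsum fun i =>
      (cosetInv_majorant hg.wt i).measurable (F.measurable_majorant_right x y i)
  filter_upwards [ae_lt_top hm hg.bound] with z hz
  exact hz.ne

theorem summable_of_tsum_enorm {U : Type*} [NormedAddCommGroup U] {u : ℕ → U}
    {m : ℕ → ℝ≥0∞} (hu : ∀ i, ‖u i‖ₑ ≤ m i) (hm : ∑' i, m i ≠ ∞) : Summable fun i => ‖u i‖ := by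
  have h1 : ∑' i, ‖u i‖ₑ ≠ ∞ := ne_top_of_le_ne_top hm (ENNReal.tsum_le_tsum hu)
  have h2 : Summable fun i => ‖u i‖₊ := ENNReal.tsum_coe_ne_top_iff_summable.1 h1
  exact NNReal.summable_coe.2 h2

theorem Good.ae_summable (hg : F.Good x y) :
    ∀ᵐ z : RCoset (stab H K x y) ∂(D.μ x y), Summable fun i => ‖F.term x y i z.out‖ := by
  filter_upwards [hg.ae_majorant] with z hz
  exact summable_of_tsum_enorm (fun i => hg.enorm_term_le i _) hz

theorem Good.aestronglyMeasurable (hg : F.Good x y) :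
    AEStronglyMeasurable (fun z : RCoset (stab H K x y) => ∑' i, F.term x y i z.out)
      (D.μ x y) := by
  refine aestronglyMeasurable_of_tendsto_ae Filter.atTop
    (f := fun n z => ∑ i ∈ Finset.range n, F.term x y i z.out) (fun n => ?_) ?_
  · exact (Finset.stronglyMeasurable_fun_sum _ fun i _ =>
      hg.stronglyMeasurable_term i).aestronglyMeasurable
  · filter_upwards [hg.ae_summable] with z hz
    exact hz.of_norm.hasSum.tendsto_sum_nat

theorem Good.enorm_tsum_le (hg : F.Good x y) (t : G) :
    ‖∑' i, F.term x y i t‖ₑ ≤ ∑' i, F.majorant x y i t := by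
  by_cases h : ∑' i, F.majorant x y i t = ∞
  · rw [h]; exact le_top
  refine le_trans ?_ (ENNReal.tsum_le_tsum fun i => hg.enorm_term_le i t)
  exact enorm_tsum_le_tsum_enorm (f := fun i => F.term x y i t)

theorem Good.lintegral_enorm_le (hg : F.Good x y) :
    ∫⁻ z : RCoset (stab H K x y), ‖∑' i, F.term x y i z.out‖ₑ ∂(D.μ x y) ≤ F.bound x y :=
  lintegral_mono fun z => hg.enorm_tsum_le z.out

theorem Good.integrable (hg : F.Good x y) :
    Integrable (fun z : RCoset (stab H K x y) => ∑' i, F.term x y i z.out) (D.μ x y) :=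
  ⟨hg.aestronglyMeasurable, hg.lintegral_enorm_le.trans_lt hg.bound.lt_top⟩

theorem Good.enorm_Psi_le (hg : F.Good x y) : ‖F.Psi (x, y)‖ₑ ≤ F.bound x y :=
  (enorm_integral_le_lintegral_enorm _).trans hg.lintegral_enorm_le

theorem converges_of_good (h : D.Generic F.Good) : F.Converges := by
  filter_upwards [h] with d hd x y hxy
  have hg := hd x y hxy
  exact ⟨fun i => hg.cosetInv_term i, hg.ae_summable, hg.integrable⟩

/-- The substitution `t ↦ s⁻¹ t` carries one orbit measure to the other. Each term then changes by
the action of `(h, k)` on the tensor and, by the cocycle rule for the weight, by the constant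
`wt(x,y,s)⁻¹`. Both pass through the sum and the integral. -/
theorem Good.Psi_shift (hg : F.Good x y) {s : G} {h : H} {k : K}
    (hg' : F.Good (h * x * s) (k * y * s)) :
    F.Psi (h * x * s, k * y * s) =
      (((D.wt p qd x y s)⁻¹ : ℝ) : ℂ) • fibreMap π γ x y s h k (F.Psi (x, y)) := by
  have hterm : ∀ i t, F.term (h * x * s) (k * y * s) i (s⁻¹ * t) =
      (((D.wt p qd x y s)⁻¹ : ℝ) : ℂ) • fibreMap π γ x y s h k (F.term x y i t) := by
    intro i t
    rw [F.term_eq hg.lam, F.term_eq hg'.lam, fibreMap_toFibre, preTerm, preTerm,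
      map_smul (tensorAct π γ h k), tensorAct_tmul, map_smul, map_smul, smul_smul, D.wt_shift h.2 k.2, ← Complex.ofReal_mul]
    have e1 : (h : G) * x * s * (s⁻¹ * t) = h * (x * t) := by group
    have e2 : (k : G) * y * s * (s⁻¹ * t) = k * (y * t) := by group
    rw [e1, e2, (F.memf i).2.1, (F.memg i).2.1]
  change ∫ z : RCoset (stab H K (h * x * s) (k * y * s)),
      ∑' i, F.term (h * x * s) (k * y * s) i z.out ∂(D.μ (h * x * s) (k * y * s)) = _
  have hmeas := hg'.aestronglyMeasurable
  rw [D.equivariant h h.2 k k.2] at hmeas ⊢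
  rw [integral_map (CosetMeasures.measurable_shift h.2 k.2 x y s).aemeasurable hmeas]
  change _ = (((D.wt p qd x y s)⁻¹ : ℝ) : ℂ) • fibreMap π γ x y s h k
    (∫ z : RCoset (stab H K x y), ∑' i, F.term x y i z.out ∂(D.μ x y))
  rw [← ContinuousLinearMap.integral_comp_comm _ hg.integrable, ← integral_smul]
  refine integral_congr_ae ?_
  filter_upwards [hg.ae_summable] with z hz
  rw [ContinuousLinearMap.map_tsum _ hz.of_norm,
    ← (((fibreMap π γ x y s h k).summable hz.of_norm)).tsum_const_smul]
  refine tsum_congr fun i => ?_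
  rw [← hterm]
  exact (hg'.cosetInv_term i).out _

theorem Good.norm_Psi_shift_le (hg : F.Good x y) {s : G} {h : H} {k : K}
    (hg' : F.Good (h * x * s) (k * y * s)) :
    ‖F.Psi (h * x * s, k * y * s)‖ ≤ (D.wt p qd x y s)⁻¹ * ‖F.Psi (x, y)‖ := by
  rw [hg.Psi_shift hg', norm_smul, Complex.norm_real,
    Real.norm_of_nonneg (inv_pos.2 (D.wt_pos x y s)).le]
  exact mul_le_mul_of_nonneg_left (norm_fibreMap_le π γ x y s h k _)
    (inv_pos.2 (D.wt_pos x y s)).le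

variable (F) in
/-- On almost every double coset the convolution is the image of a strongly measurable section
of the trivial bundle. -/
theorem exists_stronglyMeasurable_Psi (hF : D.Generic F.Good) :
    ∃ h : G × G → ProjTensor V (StrongDual ℂ W), StronglyMeasurable h ∧
      D.Generic fun x y => F.Psi (x, y) = toFibre π γ x y (h (x, y)) := by
  obtain ⟨P, b, hP, hb, hμ⟩ := D.exists_lift
  -- `A` is the jointly measurable set where the series of majorants converges. Cutting off to `A`
  -- makes the unquotiented series converge everywhere, hence strongly measurable.
  set A : Set ((G × G) × G) := {z | ∑' i, F.majorant z.1.1 z.1.2 i z.2 ≠ ∞}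
  have hA : MeasurableSet A :=
    ((Measurable.tsum F.measurable_majorant) (measurableSet_singleton ∞)).compl
  set e : (G × G) × G → ProjTensor V (StrongDual ℂ W) := fun z =>
    ∑' i, A.indicator (fun z => F.preTerm z.1.1 z.1.2 i z.2) z
  have hsum : ∀ z, Summable fun i => A.indicator (fun z => F.preTerm z.1.1 z.1.2 i z.2) z := by
    intro z
    by_cases hz : z ∈ A
    · simp only [Set.indicator_of_mem hz]
      exact (summable_of_tsum_enorm (fun i => F.enorm_preTerm_le _ _ i _) hz).of_norm
    · simp only [Set.indicator_of_notMem hz]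
      exact summable_zero
  have he : StronglyMeasurable e := by
    refine stronglyMeasurable_of_tendsto Filter.atTop
      (f := fun n z => ∑ i ∈ Finset.range n, A.indicator
        (fun z => F.preTerm z.1.1 z.1.2 i z.2) z) (fun n => ?_) ?_
    · exact Finset.stronglyMeasurable_fun_sum _ fun i _ =>
        (F.stronglyMeasurable_preTerm i).indicator hA
    · exact tendsto_pi_nhds.2 fun z => (hsum z).hasSum.tendsto_sum_nat
  -- Now the integration is over the fixed group `G` with a fixed measure, so the integral is
  -- strongly measurable in `w`.
  set u : G × G → G → ProjTensor V (StrongDual ℂ W) := fun w t => b w t • e (w, t)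
  have hu : StronglyMeasurable (Function.uncurry u) := hb.stronglyMeasurable.smul he
  refine ⟨fun w => ∫ t, u w t ∂P, hu.integral_prod_right, ?_⟩
  filter_upwards [hF, hμ] with d hd hd' x y hxy
  have hg := hd x y hxy
  have hμxy := hd' x y hxy
  have hmk := RCoset.measurable_mk (stab H K x y)
  have hbm : Measurable fun t => b (x, y) t :=
    hb.comp (measurable_const.prodMk measurable_id : Measurable fun t : G => ((x, y), t))
  have hmeas := hg.aestronglyMeasurable
  have hsA := hg.ae_majorant
  have hint := hg.integrable
  rw [hμxy] at hmeas hsA hint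
  have hsA' := ae_of_ae_map hmk.aemeasurable hsA
  have hout : ∀ t i, F.term x y i (RCoset.mk (stab H K x y) t).out = F.term x y i t :=
    fun t i => (hg.cosetInv_term i).out t
  have hmout : ∀ t i, F.majorant x y i (RCoset.mk (stab H K x y) t).out = F.majorant x y i t :=
    fun t i => (cosetInv_majorant hg.wt i).out t
  simp only [hmout] at hsA'
  rw [ae_withDensity_iff hbm.coe_nnreal_ennreal] at hsA'
  have hPsi : F.Psi (x, y) = ∫ t, b (x, y) t • ∑' i, F.term x y i t ∂P := by
    change ∫ z : RCoset (stab H K x y), ∑' i, F.term x y i z.out ∂(D.μ x y) = _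
    rw [hμxy, integral_map hmk.aemeasurable hmeas, integral_withDensity_eq_integral_smul hbm]
    simp only [hout]
  have hpt : ∀ᵐ t ∂P, b (x, y) t • ∑' i, F.term x y i t = toFibre π γ x y (u (x, y) t) := by
    filter_upwards [hsA'] with t ht
    -- Where the density vanishes nothing is known about the series, but both sides are zero.
    by_cases hbt : b (x, y) t = 0
    · simp [u, hbt]
    have hz : ((x, y), t) ∈ A := ht (by exact_mod_cast hbt)
    have hs : Summable fun i => F.preTerm x y i t :=
      (summable_of_tsum_enorm (fun i => F.enorm_preTerm_le _ _ i _) hz).of_norm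
    have hez : e ((x, y), t) = ∑' i, F.preTerm x y i t := by
      simp only [e, Set.indicator_of_mem hz]
    simp only [u, hez, NNReal.smul_def]
    rw [ContinuousLinearMap.map_smul_of_tower, ContinuousLinearMap.map_tsum _ hs]
    simp only [F.term_eq hg.lam]
  have huint : Integrable (u (x, y)) P := by
    refine ⟨(hu.comp_measurable (measurable_const.prodMk measurable_id :
      Measurable fun t : G => ((x, y), t))).aestronglyMeasurable, ?_⟩
    refine lt_of_le_of_lt ?_ hg.bound.lt_top
    have hb' : F.bound x y = ∫⁻ t, b (x, y) t * ∑' i, F.majorant x y i t ∂P := by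
      have hM : Measurable fun t => ∑' i, F.majorant x y i t :=
        Measurable.tsum fun i => F.measurable_majorant_right x y i
      have hM' : CosetInv (stab H K x y) fun t => ∑' i, F.majorant x y i t := fun s hs t =>
        tsum_congr fun i => cosetInv_majorant hg.wt i s hs t
      rw [bound, hμxy, lintegral_map (hM'.measurable hM) hmk]
      simp only [hmout]
      rw [lintegral_withDensity_eq_lintegral_mul _ hbm.coe_nnreal_ennreal hM]
      rfl
    rw [hb']
    refine lintegral_mono fun t => ?_
    simp only [u, NNReal.smul_def, enorm_smul]
    have e1 : ‖((b (x, y) t : ℝ≥0) : ℝ)‖ₑ = b (x, y) t := by simp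
    rw [e1]
    gcongr
    refine (enorm_tsum_le_tsum_enorm).trans (ENNReal.tsum_le_tsum fun i => ?_)
    refine le_trans ?_ (F.enorm_preTerm_le x y i t)
    exact enorm_indicator_le_enorm_self (s := A) (fun z => F.preTerm z.1.1 z.1.2 i z.2) _
  rw [hPsi, integral_congr_ae hpt, ContinuousLinearMap.integral_comp_comm _ huint]

end TensorSeries

end ApqSpace

namespace ApqSpace

/-! ### Descent to `(G × G)/Δ` and to the space of double cosets -/

section Identity

variable {V W : Type*} [NormedAddCommGroup V] [NormedSpace ℂ V]
  [NormedAddCommGroup W] [NormedSpace ℂ W]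

theorem projMap_id (u : ProjTensor V W) :
    projMap (ContinuousLinearMap.id ℂ V) (ContinuousLinearMap.id ℂ W) u = u := by
  induction u using UniformSpace.Completion.induction_on with
  | hp => exact isClosed_eq (by fun_prop) (by fun_prop)
  | ih a =>
    rw [projMap, ContinuousLinearMap.completion_apply_coe, LinearMap.mkContinuous_apply]
    congr 1
    exact LinearMap.congr_fun (TensorProduct.map_id (R := ℂ) (M := V) (N := W)) a

theorem tensorAct_one {G : Type*} [Group G] {H K : Subgroup G} (π : H →* (V ≃ₗᵢ[ℂ] V))
    (γ : K →* (W ≃ₗᵢ[ℂ] W)) (u : ProjTensor V (StrongDual ℂ W)) : tensorAct π γ 1 1 u = u := by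
  have h1 : ((π 1).toContinuousLinearEquiv : V →L[ℂ] V) = ContinuousLinearMap.id ℂ V := by
    ext v
    simp
  have h2 : dualActL γ 1 = ContinuousLinearMap.id ℂ (StrongDual ℂ W) := by
    ext1 η
    exact dualAct_one γ η
  rw [tensorAct, h1, h2, projMap_id]

end Identity

variable {G : Type*} [Group G] [TopologicalSpace G] [IsTopologicalGroup G] [LocallyCompactSpace G]
  [SecondCountableTopology G] [T2Space G] [MeasurableSpace G] [BorelSpace G]
  {H K : Subgroup G} [hH : IsClosed (H : Set G)] [hK : IsClosed (K : Set G)]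
  {V W : Type*} [NormedAddCommGroup V] [NormedSpace ℂ V] [TopologicalSpace.SeparableSpace V]
  [NormedAddCommGroup W] [NormedSpace ℂ W] [TopologicalSpace.SeparableSpace W]
  [TopologicalSpace.SeparableSpace (StrongDual ℂ W)]
  {π : H →* (V ≃ₗᵢ[ℂ] V)} {γ : K →* (W ≃ₗᵢ[ℂ] W)} {D : CosetMeasures H K} {p qd : ℝ}

/-- The representative `(x y⁻¹, 1)` of the coset `(x, y) Δ`. -/
def deltaRep : DeltaBase G → G × G :=
  Quotient.lift (fun w : G × G => (w.1 * w.2⁻¹, (1 : G))) (by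
    rintro ⟨x, y⟩ ⟨x', y'⟩ hab
    obtain ⟨s, hs⟩ := QuotientGroup.leftRel_apply.1 hab
    obtain ⟨h1, h2⟩ : s = x⁻¹ * x' ∧ s = y⁻¹ * y' := by simpa using hs
    have h1' : x' = x * s := by rw [h1]; group
    have h2' : y' = y * s := by rw [h2]; group
    simp [h1', h2'])

theorem measurable_deltaRep : Measurable (deltaRep : DeltaBase G → G × G) := by
  intro s hs
  have : Measurable fun w : G × G => (w.1 * w.2⁻¹, (1 : G)) := by fun_prop
  exact this hs

theorem measurable_dcoset_iff {β : Type*} [MeasurableSpace β] {f : DCoset H K → β} :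
    Measurable f ↔ Measurable fun w => f (DCoset.mk H K w) :=
  ⟨fun h => h.comp measurable_quotient_mk'', fun h _ hs => h hs⟩

/-- The exceptional set is enlarged to a measurable null set in `Υ`, so its preimage is saturated.
Cutting `N` off there gives a measurable function constant on all double cosets. -/
theorem exists_measurable_dcoset (D : CosetMeasures H K) {N : G × G → ℝ≥0∞} (hN : Measurable N)
    (hD : ∀ᵐ d ∂D.μHK, ∀ w w', DCoset.mk H K w = d → DCoset.mk H K w' = d → N w = N w') :
    ∃ n : DCoset H K → ℝ≥0∞, Measurable n ∧
      ∀ᵐ d ∂D.μHK, ∀ w, DCoset.mk H K w = d → N w = n d := by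
  obtain ⟨Z, hZ, hZm, hZ0⟩ := exists_measurable_superset_of_null hD
  have hconst : ∀ d ∉ Z, ∀ w w', DCoset.mk H K w = d → DCoset.mk H K w' = d → N w = N w' := by
    intro d hd
    by_contra hcon
    exact hd (hZ hcon)
  refine ⟨Zᶜ.indicator fun d => N d.out, ?_, ?_⟩
  · rw [measurable_dcoset_iff]
    have : (fun w => Zᶜ.indicator (fun d => N d.out) (DCoset.mk H K w)) =
        (DCoset.mk H K ⁻¹' Zᶜ).indicator N := by
      ext w
      by_cases hw : DCoset.mk H K w ∈ Z
      · rw [Set.indicator_of_notMem (by simpa using hw), Set.indicator_of_notMem (by simpa using hw)]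
      · rw [Set.indicator_of_mem (by simpa using hw), Set.indicator_of_mem (by simpa using hw)]
        exact hconst _ hw _ _ (DCoset.mk_out _) rfl
    rw [this]
    exact hN.indicator (measurable_quotient_mk'' hZm.compl)
  · filter_upwards [measure_eq_zero_iff_ae_notMem.1 hZ0] with d hd w hw
    rw [Set.indicator_of_mem (by simpa using hd)]
    exact hconst d hd _ _ hw (DCoset.mk_out d)

namespace TensorSeries

variable (F : TensorSeries π γ D p qd)

theorem measurableSection_Psi (hF : D.Generic F.Good) : MeasurableSection₂ π γ F.Psi := by
  obtain ⟨h, hh, hPsi⟩ := F.exists_stronglyMeasurable_Psi hF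
  exact ⟨h, hh, hPsi.ae⟩

theorem enorm_Psi_eq_of_wt {x y s : G} {h k : G} (hh : h ∈ H) (hk : k ∈ K) (hg : F.Good x y)
    (hg' : F.Good (h * x * s) (k * y * s)) (hw : D.wt p qd x y s = 1) :
    ‖F.Psi (h * x * s, k * y * s)‖ₑ ≤ ‖F.Psi (x, y)‖ₑ := by
  have := hg.norm_Psi_shift_le (h := ⟨h, hh⟩) (k := ⟨k, hk⟩) hg'
  rw [hw, inv_one, one_mul] at this
  have h' : ‖F.Psi (h * x * s, k * y * s)‖₊ ≤ ‖F.Psi (x, y)‖₊ := this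
  simp only [enorm_eq_nnnorm]
  exact_mod_cast h'

/-- The point `(x, y)` arises from `(x y⁻¹, 1)` by the shift `s = y` with `h = k = 1`. With weight
one, the same lift `u` therefore represents both values. -/
theorem Good.Psi_deltaRep {x y : G} {F : TensorSeries π γ D p qd} (hg : F.Good x y)
    (hg' : F.Good (x * y⁻¹) 1) (hw : D.wt p qd (x * y⁻¹) 1 y = 1)
    {u : ProjTensor V (StrongDual ℂ W)} (hu : F.Psi (x * y⁻¹, 1) = toFibre π γ (x * y⁻¹) 1 u) :
    F.Psi (x, y) = toFibre π γ x y u := by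
  -- The fibre type depends on the base point, so the equalities of base points have to be
  -- eliminated before the values can be compared.
  have key : ∀ x' y', x' = x → y' = y → F.Psi (x', y') = toFibre π γ x' y' u →
      F.Psi (x, y) = toFibre π γ x y u := by
    rintro _ _ rfl rfl h
    exact h
  have e1 : ((1 : H) : G) * (x * y⁻¹) * y = x := by simp
  have e2 : ((1 : K) : G) * 1 * y = y := by simp
  refine key _ _ e1 e2 ?_
  have hg2 : F.Good (((1 : H) : G) * (x * y⁻¹) * y) (((1 : K) : G) * 1 * y) := by rwa [e1, e2]
  rw [hg'.Psi_shift hg2, hw, hu, fibreMap_toFibre, tensorAct_one]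
  simp

/-- With weight one, the shift formula applied in both directions makes the norm constant on double
cosets. The section over `(G × G)/Δ` is obtained by sampling the measurable lift at the
representatives `(x y⁻¹, 1)`. -/
theorem Psi_mem_LrΔ₂ (hπ : ∀ v : V, Continuous fun h => π h v)
    (hγ : ∀ w : W, Continuous fun k => γ k w) (hF : D.Generic F.Good)
    (hw : D.Generic fun x y => ∀ s, D.wt p qd x y s = 1) {r : ℝ} (hr : 0 < r)
    {n : DCoset H K → ℝ≥0∞} (hn : ∀ᵐ d ∂D.μHK, ∀ x y, DCoset.mk H K (x, y) = d →
      F.bound x y ≤ n d) (hnr : ∫⁻ d, n d ^ r ∂D.μHK < ∞) :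
    F.Psi ∈ LrΔ₂ π γ D r := by
  obtain ⟨h, hh, hPsi⟩ := F.exists_stronglyMeasurable_Psi hF
  have hN : Measurable fun w : G × G => ‖toFibre π γ w.1 w.2 (h w)‖ₑ := by
    simp only [← ofReal_norm]
    exact (measurable_norm_toFibre π hπ γ hγ hh).ennreal_ofReal
  have hle : ∀ᵐ d ∂D.μHK, ∀ w w', DCoset.mk H K w = d → DCoset.mk H K w' = d →
      ‖F.Psi w'‖ₑ ≤ ‖F.Psi w‖ₑ := by
    filter_upwards [hF, hw] with d hd hwd
    rintro ⟨x, y⟩ ⟨x', y'⟩ hxy hxy'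
    obtain ⟨h, hh, k, hk, s, rfl, rfl⟩ := DCoset.mk_eq_iff.1 (hxy.trans hxy'.symm)
    exact F.enorm_Psi_eq_of_wt hh hk (hd _ _ hxy) (hd _ _ hxy') (hwd _ _ hxy s)
  obtain ⟨m, hm, hmN⟩ := exists_measurable_dcoset D hN (by
    filter_upwards [hle, hPsi] with d hd hPd
    intro w w' hw hw'
    have e1 := hPd w.1 w.2 hw
    have e2 := hPd w'.1 w'.2 hw'
    rw [← e1, ← e2]
    exact le_antisymm (hd _ _ hw' hw) (hd _ _ hw hw'))
  set σ : SectionΔ π γ := fun z => Submodule.Quotient.mk (h (deltaRep z))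
  have hσ : ∀ᵐ d ∂D.μHK, ∀ w : G × G, DCoset.mk H K w = d →
      F.Psi w = σ (QuotientGroup.mk w) := by
    filter_upwards [hF, hw, hPsi] with d hd hwd hPd
    rintro ⟨x, y⟩ hxy
    have hxy' : DCoset.mk H K (x * y⁻¹, 1) = d := by
      rw [← hxy]
      exact DCoset.mk_eq_iff.2 ⟨1, H.one_mem, 1, K.one_mem, y, by simp, by simp⟩
    exact (hd _ _ hxy).Psi_deltaRep (hd _ _ hxy') (hwd _ _ hxy' y) (hPd _ _ hxy')
  refine ⟨σ, ⟨⟨fun z => h (deltaRep z), hh.comp_measurable measurable_deltaRep,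
    .of_forall fun w => rfl⟩, m, hm, ?_, ?_⟩, hσ⟩
  · filter_upwards [hσ, hmN, hPsi] with d h1 h2 h3 w hwd
    rw [← h1 w hwd, ← h2 w hwd, ← h3 w.1 w.2 hwd]
    rfl
  · refine lt_of_le_of_lt (lintegral_mono_ae ?_) hnr
    filter_upwards [hn, hmN, hPsi, hF] with d h1 h2 h3 h4
    have key : ∀ w : G × G, DCoset.mk H K w = d → m d ≤ n d := by
      rintro ⟨x, y⟩ hd
      rw [← h2 _ hd, ← h3 _ _ hd]
      exact (h4 _ _ hd).enorm_Psi_le.trans (h1 _ _ hd)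
    gcongr
    exact key _ (DCoset.mk_out d)

end TensorSeries

end ApqSpace

namespace ApqSpace

/-! ### Hölder and Minkowski inequalities -/

section Inequalities

variable {X : Type*} [MeasurableSpace X] {m : Measure X}

theorem lintegral_mul_rpow_three_le {a b c : X → ℝ≥0∞} (ha : Measurable a) (hb : Measurable b)
    (hc : Measurable c) {α β δ : ℝ} (hα : 0 ≤ α) (hβ : 0 ≤ β) (hδ : 0 ≤ δ) (h : α + β + δ = 1) :
    ∫⁻ x, a x ^ α * b x ^ β * c x ^ δ ∂m ≤
      (∫⁻ x, a x ∂m) ^ α * (∫⁻ x, b x ∂m) ^ β * (∫⁻ x, c x ∂m) ^ δ := by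
  have := ENNReal.lintegral_prod_norm_pow_le (μ := m) (Finset.univ : Finset (Fin 3))
    (f := ![a, b, c]) (p := ![α, β, δ])
    (by intro i _; fin_cases i <;> simp [ha.aemeasurable, hb.aemeasurable, hc.aemeasurable])
    (by simpa [Fin.sum_univ_three] using h) (by intro i _; fin_cases i <;> simpa)
  simpa [Fin.prod_univ_three] using this

theorem lintegral_finsetSum_rpow_le {u : ℕ → X → ℝ≥0∞} (hu : ∀ i, AEMeasurable (u i) m) {r : ℝ}
    (hr : 1 ≤ r) (n : ℕ) :
    (∫⁻ x, (∑ i ∈ Finset.range n, u i x) ^ r ∂m) ^ (1 / r) ≤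
      ∑ i ∈ Finset.range n, (∫⁻ x, u i x ^ r ∂m) ^ (1 / r) := by
  have hr0 : 0 < r := by linarith
  induction n with
  | zero => simp [hr0]
  | succ n ih =>
    simp only [Finset.sum_range_succ]
    refine (ENNReal.lintegral_Lp_add_le (f := fun x => ∑ i ∈ Finset.range n, u i x)
      (Finset.aemeasurable_fun_sum _ fun i _ => hu i) (hu n) hr).trans ?_
    gcongr

/-- Minkowski's inequality for series. -/
theorem lintegral_tsum_rpow_le {u : ℕ → X → ℝ≥0∞} (hu : ∀ i, AEMeasurable (u i) m) {r : ℝ}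
    (hr : 1 ≤ r) {T : ℕ → ℝ≥0∞} (hT : ∀ i, ∫⁻ x, u i x ^ r ∂m ≤ T i ^ r) :
    ∫⁻ x, (∑' i, u i x) ^ r ∂m ≤ (∑' i, T i) ^ r := by
  have hr0 : 0 < r := by linarith
  have hfin : ∀ n, ∫⁻ x, (∑ i ∈ Finset.range n, u i x) ^ r ∂m ≤ (∑' i, T i) ^ r := by
    intro n
    have h1 := lintegral_finsetSum_rpow_le hu hr n
    have h2 : ∑ i ∈ Finset.range n, (∫⁻ x, u i x ^ r ∂m) ^ (1 / r) ≤ ∑' i, T i := by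
      refine le_trans (Finset.sum_le_sum fun i _ => ?_) (ENNReal.sum_le_tsum (Finset.range n))
      refine (ENNReal.rpow_le_rpow (hT i) (by positivity)).trans_eq ?_
      rw [← ENNReal.rpow_mul, mul_one_div_cancel hr0.ne', ENNReal.rpow_one]
    have h3 := ENNReal.rpow_le_rpow (h1.trans h2) hr0.le
    rwa [← ENNReal.rpow_mul, one_div_mul_cancel hr0.ne', ENNReal.rpow_one] at h3
  have hlim : ∀ x, (∑' i, u i x) ^ r = ⨆ n, (∑ i ∈ Finset.range n, u i x) ^ r := by
    intro x
    rw [ENNReal.tsum_eq_iSup_nat]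
    exact (ENNReal.orderIsoRpow r hr0).map_iSup _
  simp only [hlim]
  rw [lintegral_iSup' (fun n => (Finset.aemeasurable_fun_sum _ fun i _ => hu i).pow_const r)]
  · exact iSup_le hfin
  · refine .of_forall fun x n k hnk => ?_
    refine ENNReal.rpow_le_rpow ?_ hr0.le
    exact Finset.sum_le_sum_of_subset (Finset.range_mono hnk)

end Inequalities

variable {G : Type*} [Group G] [TopologicalSpace G] [IsTopologicalGroup G] [LocallyCompactSpace G]
  [SecondCountableTopology G] [T2Space G] [MeasurableSpace G] [BorelSpace G]
  {H K : Subgroup G} [hH : IsClosed (H : Set G)] [hK : IsClosed (K : Set G)]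
  {V W : Type*} [NormedAddCommGroup V] [NormedSpace ℂ V] [TopologicalSpace.SeparableSpace V]
  [NormedAddCommGroup W] [NormedSpace ℂ W] [TopologicalSpace.SeparableSpace W]
  [TopologicalSpace.SeparableSpace (StrongDual ℂ W)]
  {π : H →* (V ≃ₗᵢ[ℂ] V)} {γ : K →* (W ≃ₗᵢ[ℂ] W)} {D : CosetMeasures H K} {p qd : ℝ}

/-! ### The convolution estimate on an orbit -/

namespace TensorSeries

variable (F : TensorSeries π γ D p qd)

theorem measurable_f_out (i : ℕ) : Measurable fun z : RCoset H => ‖F.f i z.out‖ₑ :=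
  (F.cosetInv_f i).measurable (F.stronglyMeasurable_f i).enorm

theorem measurable_g_out (i : ℕ) : Measurable fun z : RCoset K => ‖F.g i z.out‖ₑ :=
  (F.cosetInv_g i).measurable (F.stronglyMeasurable_g i).enorm

theorem lpNorm_f_rpow (hp : 0 < p) (i : ℕ) :
    ∫⁻ z : RCoset H, ‖F.f i z.out‖ₑ ^ p ∂D.μH = lpNorm D.μH p (F.f i) ^ p := by
  rw [lpNorm, ← ENNReal.rpow_mul, one_div_mul_cancel hp.ne', ENNReal.rpow_one]

theorem lpNorm_g_rpow (hq : 0 < qd) (i : ℕ) :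
    ∫⁻ z : RCoset K, ‖F.g i z.out‖ₑ ^ qd ∂D.μK = lpNorm D.μK qd (F.g i) ^ qd := by
  rw [lpNorm, ← ENNReal.rpow_mul, one_div_mul_cancel hq.ne', ENNReal.rpow_one]

/-- The functions `(u, v) ↦ ‖fᵢ(u)‖ ^ a ‖gᵢ(v)‖ ^ b` on `G / H × G / K`. -/
def normProd (a b : ℝ) (i : ℕ) (q : RCoset H × RCoset K) : ℝ≥0∞ :=
  ‖F.f i q.1.out‖ₑ ^ a * ‖F.g i q.2.out‖ₑ ^ b

theorem measurable_normProd (a b : ℝ) (i : ℕ) : Measurable (F.normProd a b i) :=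
  (((F.measurable_f_out i).comp measurable_fst).pow_const a).mul
    (((F.measurable_g_out i).comp measurable_snd).pow_const b)

theorem normProd_orb (a b : ℝ) (i : ℕ) (x y t : G) :
    F.normProd a b i (RCoset.mk H (x * t), RCoset.mk K (y * t)) =
      ‖F.f i (x * t)‖ₑ ^ a * ‖F.g i (y * t)‖ₑ ^ b := by
  have h1 := (F.cosetInv_f i).out (x * t)
  have h2 := (F.cosetInv_g i).out (y * t)
  simp only [normProd, h1, h2]

theorem lintegral_normProd_dMeasure (a b : ℝ) (i : ℕ) (x y : G) :
    ∫⁻ q, F.normProd a b i q ∂(D.dMeasure (DCoset.mk H K (x, y))) =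
      ∫⁻ z : RCoset (stab H K x y), ‖F.f i (x * z.out)‖ₑ ^ a * ‖F.g i (y * z.out)‖ₑ ^ b
        ∂(D.μ x y) := by
  rw [D.dMeasure_mk, D.lintegral_orbMeasure _ _ (F.measurable_normProd a b i)]
  refine lintegral_congr fun z => ?_
  exact F.normProd_orb a b i x y z.out

theorem lintegral_normProd_prod (a b : ℝ) (i : ℕ) :
    ∫⁻ q, F.normProd a b i q ∂(D.μH.prod D.μK) =
      (∫⁻ z : RCoset H, ‖F.f i z.out‖ₑ ^ a ∂D.μH) * ∫⁻ z : RCoset K, ‖F.g i z.out‖ₑ ^ b ∂D.μK :=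
  lintegral_prod_mul ((F.measurable_f_out i).pow_const a).aemeasurable
    ((F.measurable_g_out i).pow_const b).aemeasurable

theorem lintegral_lintegral_normProd (a b : ℝ) (i : ℕ) :
    ∫⁻ d, ∫⁻ q, F.normProd a b i q ∂(D.dMeasure d) ∂D.μHK =
      (∫⁻ z : RCoset H, ‖F.f i z.out‖ₑ ^ a ∂D.μH) * ∫⁻ z : RCoset K, ‖F.g i z.out‖ₑ ^ b ∂D.μK := by
  rw [D.lintegral_dMeasure (F.measurable_normProd a b i), F.lintegral_normProd_prod]

/-- The integral of the `i`-th majorant. -/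
def termBound (x y : G) (i : ℕ) : ℝ≥0∞ :=
  ∫⁻ z : RCoset (stab H K x y), F.majorant x y i z.out ∂(D.μ x y)

theorem bound_eq_tsum {x y : G} (hw : ∀ s ∈ stab H K x y, D.wt p qd x y s = 1) :
    F.bound x y = ∑' i, F.termBound x y i :=
  lintegral_tsum fun i => ((cosetInv_majorant hw i).measurable
    (F.measurable_majorant_right x y i)).aemeasurable

variable (D) in
/-- The modular functions are trivial on the stabilizer, and the integrals of functions on
`G / H` and `G / K` over the orbit are given by the factors `I` and `J`. -/
structure Balanced (x y : G) (I J : ℝ≥0∞) : Prop where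
  lamH : ∀ s ∈ stab H K x y, D.lamH x s = 1
  lamK : ∀ s ∈ stab H K x y, D.lamK y s = 1
  intH : ∀ f : G → ℝ≥0∞, Measurable f → CosetInv H f →
    ∫⁻ z : RCoset (stab H K x y), f (x * z.out) * ENNReal.ofReal (D.lamK y z.out)⁻¹ ∂(D.μ x y) =
      I * ∫⁻ u : RCoset H, f u.out ∂D.μH
  intK : ∀ f : G → ℝ≥0∞, Measurable f → CosetInv K f →
    ∫⁻ z : RCoset (stab H K x y), f (y * z.out) * ENNReal.ofReal (D.lamH x z.out)⁻¹ ∂(D.μ x y) =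
      J * ∫⁻ u : RCoset K, f u.out ∂D.μK

variable {x y : G} {I J : ℝ≥0∞}

theorem Balanced.wt (h : Balanced D x y I J) (s : G) (hs : s ∈ stab H K x y) :
    D.wt p qd x y s = 1 := by
  rw [CosetMeasures.wt, h.lamH s hs, h.lamK s hs, Real.one_rpow, Real.one_rpow, one_mul]

theorem Balanced.cosetInv_lamH (h : Balanced D x y I J) :
    CosetInv (stab H K x y) (D.lamH x) := fun s hs t => by
  have e : x * s = (x * s * x⁻¹) * x := by group
  rw [D.lamH_mul, h.lamH s hs, one_mul, e]
  exact D.lamH_cosetInv t _ (mem_stab.1 hs).1 x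

theorem Balanced.cosetInv_lamK (h : Balanced D x y I J) :
    CosetInv (stab H K x y) (D.lamK y) := fun s hs t => by
  have e : y * s = (y * s * y⁻¹) * y := by group
  rw [D.lamK_mul, h.lamK s hs, one_mul, e]
  exact D.lamK_cosetInv t _ (mem_stab.1 hs).2 y

theorem rpow_mul_rpow_cancel (a : ℝ≥0∞) {s t : ℝ} (hs : 0 ≤ s) (ht : 0 ≤ t)
    (hst : s + t = 1) : a ^ s * a ^ t = a := by
  rw [← ENNReal.rpow_add_of_nonneg _ _ hs ht, hst, ENNReal.rpow_one]

/-- The exponents balance because `p (1/p + 1/q' - 1) + p (1 - 1/q') = 1`, and symmetrically for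
`q'`. Each modular factor is paired with the function of the other variable, since these are the
combinations that integration in stages can evaluate. -/
theorem majorant_eq (hp : 1 ≤ p) (hq : 1 ≤ qd) (he : 1 ≤ 1 / p + 1 / qd) (x y t : G) (i : ℕ) :
    F.majorant x y i t = (‖F.f i (x * t)‖ₑ ^ p * ‖F.g i (y * t)‖ₑ ^ qd) ^ (1 / p + 1 / qd - 1) *
      (‖F.f i (x * t)‖ₑ ^ p * ENNReal.ofReal (D.lamK y t)⁻¹) ^ (1 - 1 / qd) *
      (‖F.g i (y * t)‖ₑ ^ qd * ENNReal.ofReal (D.lamH x t)⁻¹) ^ (1 - 1 / p) := by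
  have hp0 : 0 < p := by linarith
  have hq0 : 0 < qd := by linarith
  have hp1 : 0 ≤ 1 - 1 / p := by
    rw [sub_nonneg, div_le_one hp0]; exact hp
  have hq1 : 0 ≤ 1 - 1 / qd := by
    rw [sub_nonneg, div_le_one hq0]; exact hq
  have he1 : 0 ≤ 1 / p + 1 / qd - 1 := by linarith
  have hpq : 0 < p * qd := by positivity
  set a := ‖F.f i (x * t)‖ₑ
  set b := ‖F.g i (y * t)‖ₑ
  have hl : ENNReal.ofReal (D.wt p qd x y t) = ENNReal.ofReal (D.lamK y t)⁻¹ ^ (1 - 1 / qd) *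
      ENNReal.ofReal (D.lamH x t)⁻¹ ^ (1 - 1 / p) := by
    have h1 := D.lamH_pos x t
    have h2 := D.lamK_pos y t
    rw [CosetMeasures.wt, ENNReal.ofReal_rpow_of_pos (inv_pos.2 h1),
      ENNReal.ofReal_rpow_of_pos (inv_pos.2 h2), ← ENNReal.ofReal_mul (by positivity)]
    congr 1
    rw [Real.inv_rpow h1.le, Real.inv_rpow h2.le, ← Real.rpow_neg h1.le, ← Real.rpow_neg h2.le,
      neg_sub, neg_sub, mul_comm]
  rw [majorant, hl, ENNReal.mul_rpow_of_nonneg _ _ he1, ENNReal.mul_rpow_of_nonneg _ _ hq1,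
    ENNReal.mul_rpow_of_nonneg _ _ hp1, ← ENNReal.rpow_mul, ← ENNReal.rpow_mul,
    ← ENNReal.rpow_mul, ← ENNReal.rpow_mul]
  have ea := rpow_mul_rpow_cancel a (s := p * (1 / p + 1 / qd - 1)) (t := p * (1 - 1 / qd))
    (by positivity) (by positivity) (by field_simp; ring)
  have eb := rpow_mul_rpow_cancel b (s := qd * (1 / p + 1 / qd - 1)) (t := qd * (1 - 1 / p))
    (by positivity) (by positivity) (by field_simp; ring)
  change _ * (a * b) = _
  nth_rewrite 1 [← ea, ← eb]
  ring

variable {F} in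
/-- The estimate of the terms of the convolution on an orbit. -/
theorem Balanced.termBound_le (h : Balanced D x y I J) (hp : 1 ≤ p) (hq : 1 ≤ qd)
    (he : 1 ≤ 1 / p + 1 / qd) (i : ℕ) :
    F.termBound x y i ≤
      (∫⁻ q, F.normProd p qd i q ∂(D.dMeasure (DCoset.mk H K (x, y)))) ^ (1 / p + 1 / qd - 1) *
      (I ^ (1 - 1 / qd) * J ^ (1 - 1 / p)) *
      ((lpNorm D.μH p (F.f i) ^ p) ^ (1 - 1 / qd) *
        (lpNorm D.μK qd (F.g i) ^ qd) ^ (1 - 1 / p)) := by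
  have hp0 : 0 < p := by linarith
  have hq0 : 0 < qd := by linarith
  have hp1 : 0 ≤ 1 - 1 / p := by
    rw [sub_nonneg, div_le_one hp0]; exact hp
  have hq1 : 0 ≤ 1 - 1 / qd := by
    rw [sub_nonneg, div_le_one hq0]; exact hq
  have hfm : Measurable fun t => ‖F.f i (x * t)‖ₑ :=
    (F.stronglyMeasurable_f i).enorm.comp (measurable_const_mul x)
  have hgm : Measurable fun t => ‖F.g i (y * t)‖ₑ :=
    (F.stronglyMeasurable_g i).enorm.comp (measurable_const_mul y)
  have hf : CosetInv (stab H K x y) fun t => ‖F.f i (x * t)‖ₑ := (F.cosetInv_f i).stab_left x y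
  have hg : CosetInv (stab H K x y) fun t => ‖F.g i (y * t)‖ₑ := (F.cosetInv_g i).stab_right x y
  have hlH : Measurable fun z : RCoset (stab H K x y) => ENNReal.ofReal (D.lamH x z.out)⁻¹ :=
    (h.cosetInv_lamH.measurable (D.continuous_lamH_right x).measurable).inv.ennreal_ofReal
  have hlK : Measurable fun z : RCoset (stab H K x y) => ENNReal.ofReal (D.lamK y z.out)⁻¹ :=
    (h.cosetInv_lamK.measurable (D.continuous_lamK_right y).measurable).inv.ennreal_ofReal
  have hfz := (hf.measurable hfm).pow_const p
  have hgz := (hg.measurable hgm).pow_const qd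
  have hH1 := h.intH (fun t => ‖F.f i t‖ₑ ^ p) ((F.stronglyMeasurable_f i).enorm.pow_const p)
    ((F.cosetInv_f i).comp (· ^ p))
  have hK1 := h.intK (fun t => ‖F.g i t‖ₑ ^ qd) ((F.stronglyMeasurable_g i).enorm.pow_const qd)
    ((F.cosetInv_g i).comp (· ^ qd))
  rw [termBound]
  simp only [F.majorant_eq hp hq he]
  refine (lintegral_mul_rpow_three_le (hfz.mul hgz) (hfz.mul hlK) (hgz.mul hlH)
    (by linarith) hq1 hp1 (by ring)).trans_eq ?_
  simp only [Pi.mul_apply]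
  rw [hH1, hK1, F.lpNorm_f_rpow hp0, F.lpNorm_g_rpow hq0, F.lintegral_normProd_dMeasure,
    ENNReal.mul_rpow_of_nonneg _ _ hq1, ENNReal.mul_rpow_of_nonneg _ _ hp1]
  ring

theorem lpNorm_combine (a b : ℝ≥0∞) (hp : 1 ≤ p) (hq : 1 ≤ qd)
    (he : 1 ≤ 1 / p + 1 / qd) :
    (a ^ p * b ^ qd) ^ (1 / p + 1 / qd - 1) * ((a ^ p) ^ (1 - 1 / qd) * (b ^ qd) ^ (1 - 1 / p)) =
      a * b := by
  have hp0 : 0 < p := by linarith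
  have hq0 : 0 < qd := by linarith
  have hp1 : 0 ≤ 1 - 1 / p := by
    rw [sub_nonneg, div_le_one hp0]; exact hp
  have hq1 : 0 ≤ 1 - 1 / qd := by
    rw [sub_nonneg, div_le_one hq0]; exact hq
  have he1 : 0 ≤ 1 / p + 1 / qd - 1 := by linarith
  have ea := rpow_mul_rpow_cancel a (s := p * (1 / p + 1 / qd - 1)) (t := p * (1 - 1 / qd))
    (by positivity) (by positivity) (by field_simp; ring)
  have eb := rpow_mul_rpow_cancel b (s := qd * (1 / p + 1 / qd - 1)) (t := qd * (1 - 1 / p))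
    (by positivity) (by positivity) (by field_simp; ring)
  rw [ENNReal.mul_rpow_of_nonneg _ _ he1, ← ENNReal.rpow_mul, ← ENNReal.rpow_mul,
    ← ENNReal.rpow_mul, ← ENNReal.rpow_mul]
  calc _ = (a ^ (p * (1 / p + 1 / qd - 1)) * a ^ (p * (1 - 1 / qd))) *
      (b ^ (qd * (1 / p + 1 / qd - 1)) * b ^ (qd * (1 - 1 / p))) := by ring
    _ = a * b := by rw [ea, eb]

/-- The majorant of the norm of the convolution in `L_r`, for `1/r = 1/p + 1/q' - 1`. -/
theorem exists_bound (hp : 1 ≤ p) (hq : 1 ≤ qd) (he : 1 < 1 / p + 1 / qd) {r : ℝ}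
    (hr : 1 / r = 1 / p + 1 / qd - 1) {C : ℝ≥0}
    (hbal : D.Generic fun x y => ∃ I J, Balanced D x y I J ∧
      I ^ (1 - 1 / qd) * J ^ (1 - 1 / p) ≤ C) :
    ∃ n : DCoset H K → ℝ≥0∞, Measurable n ∧ (∀ᵐ d ∂D.μHK, ∀ x y, DCoset.mk H K (x, y) = d →
      F.bound x y ≤ n d) ∧ ∫⁻ d, n d ^ r ∂D.μHK < ∞ := by
  have hp0 : 0 < p := by linarith
  have hq0 : 0 < qd := by linarith
  have he1 : 0 < 1 / r := by linarith
  have hr0 : 0 < r := one_div_pos.1 he1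
  have hr1 : 1 ≤ r := by
    refine (div_le_one hr0).1 ?_
    rw [hr]
    have h1 : 1 / p ≤ 1 := by rw [div_le_one hp0]; exact hp
    have h2 : 1 / qd ≤ 1 := by rw [div_le_one hq0]; exact hq
    linarith
  set A : ℕ → ℝ≥0∞ := fun i => (lpNorm D.μH p (F.f i) ^ p) ^ (1 - 1 / qd) *
        (lpNorm D.μK qd (F.g i) ^ qd) ^ (1 - 1 / p)
  set u : ℕ → DCoset H K → ℝ≥0∞ := fun i d =>
    (∫⁻ q, F.normProd p qd i q ∂(D.dMeasure d)) ^ (1 / p + 1 / qd - 1) * C * A i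
  have hu : ∀ i, AEMeasurable (u i) D.μHK := fun i =>
    (((D.aemeasurable_dMeasure (F.measurable_normProd p qd i)).pow_const _).mul_const _).mul_const _
  have hT : ∀ i, ∫⁻ d, u i d ^ r ∂D.μHK ≤
      (C * (lpNorm D.μH p (F.f i) * lpNorm D.μK qd (F.g i))) ^ r := by
    intro i
    -- The orbit integral enters with exponent `1/r`, so the `r`-th power is linear in it and the
    -- disintegration evaluates it exactly.
    have e : ∀ d, u i d ^ r =
        (∫⁻ q, F.normProd p qd i q ∂(D.dMeasure d)) * (C * A i) ^ r := by
      intro d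
      simp only [u]
      rw [mul_assoc, ENNReal.mul_rpow_of_nonneg _ _ hr0.le, ← hr, ← ENNReal.rpow_mul,
        one_div_mul_cancel hr0.ne', ENNReal.rpow_one]
    simp only [e]
    rw [lintegral_mul_const'' _ (D.aemeasurable_dMeasure (F.measurable_normProd p qd i)),
      F.lintegral_lintegral_normProd, F.lpNorm_f_rpow hp0, F.lpNorm_g_rpow hq0]
    have h1 := lpNorm_combine (lpNorm D.μH p (F.f i)) (lpNorm D.μK qd (F.g i)) hp hq he.le
    rw [← hr] at h1
    change _ ^ (1 / r) * A i = _ at h1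
    generalize A i = a at h1 ⊢
    refine le_of_eq ?_
    rw [← h1, mul_left_comm (C : ℝ≥0∞), ENNReal.mul_rpow_of_nonneg _ (C * a) hr0.le,
      ← ENNReal.rpow_mul, one_div_mul_cancel hr0.ne', ENNReal.rpow_one]
  have hsum : AEMeasurable (fun d => ∑' i, u i d) D.μHK := AEMeasurable.tsum hu
  refine ⟨hsum.mk _, hsum.measurable_mk, ?_, ?_⟩
  · filter_upwards [hbal, hsum.ae_eq_mk] with d hd hdm x y hxy
    obtain ⟨I, J, hB, hC⟩ := hd x y hxy
    rw [← hdm, F.bound_eq_tsum hB.wt]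
    refine ENNReal.tsum_le_tsum fun i => ?_
    refine (hB.termBound_le hp hq he.le i).trans ?_
    rw [hxy]
    simp only [u]
    gcongr
  · have : ∫⁻ d, hsum.mk _ d ^ r ∂D.μHK = ∫⁻ d, (∑' i, u i d) ^ r ∂D.μHK := by
      refine lintegral_congr_ae ?_
      filter_upwards [hsum.ae_eq_mk] with d hd
      rw [← hd]
    rw [this]
    refine (lintegral_tsum_rpow_le hu hr1 hT).trans_lt ?_
    rw [ENNReal.tsum_mul_left]
    exact ENNReal.rpow_lt_top_of_nonneg hr0.le (ENNReal.mul_ne_top ENNReal.coe_ne_top F.summable)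

end TensorSeries

end ApqSpace

namespace ApqSpace

/-! ### Finite invariant measures and the conditions (a), (b), (c) -/

section Finite

variable {X : Type*} [MeasurableSpace X] {m : Measure X}

theorem lintegral_le_rpow_mul_measure_univ {u : X → ℝ≥0∞} (hu : Measurable u) {p : ℝ}
    (hp : 1 ≤ p) : ∫⁻ x, u x ∂m ≤ m Set.univ ^ (1 - 1 / p) * (∫⁻ x, u x ^ p ∂m) ^ (1 / p) := by
  have hp0 : 0 < p := by linarith
  have hp1 : 0 ≤ 1 - 1 / p := by
    rw [sub_nonneg, div_le_one hp0]; exact hp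
  have := lintegral_mul_rpow_three_le (m := m) (hu.pow_const p) measurable_one measurable_one
    (α := 1 / p) (β := 1 - 1 / p) (δ := 0) (by positivity) hp1 le_rfl (by ring)
  simpa [← ENNReal.rpow_mul, hp0.ne', mul_comm] using this

end Finite

variable {G : Type*} [Group G] [TopologicalSpace G] [IsTopologicalGroup G] [LocallyCompactSpace G]
  [SecondCountableTopology G] [T2Space G] [MeasurableSpace G] [BorelSpace G]
  {H K : Subgroup G} [hH : IsClosed (H : Set G)] [hK : IsClosed (K : Set G)]
  {V W : Type*} [NormedAddCommGroup V] [NormedSpace ℂ V] [TopologicalSpace.SeparableSpace V]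
  [NormedAddCommGroup W] [NormedSpace ℂ W] [TopologicalSpace.SeparableSpace W]
  [TopologicalSpace.SeparableSpace (StrongDual ℂ W)]
  {π : H →* (V ≃ₗᵢ[ℂ] V)} {γ : K →* (W ≃ₗᵢ[ℂ] W)} {D : CosetMeasures H K} {p qd : ℝ}

theorem Corresponds.measure_univ_ne_zero {S : Subgroup G} [IsClosed (S : Set G)] {ρ : G → ℝ}
    {μ : Measure (RCoset S)}
    (h : Corresponds S ((↑) : S → G) (rightHaar G) (rightHaar S) ρ μ) : μ Set.univ ≠ 0 := by
  rw [Ne, h.null_iff (j := S.subtype) S.range_subtype MeasurableSet.univ, Set.preimage_univ,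
    Measure.measure_univ_eq_zero]
  exact NeZero.ne (rightHaar G)

/-- The image in `G / S` of an invariant probability measure on `G / N` is the normalized
invariant measure. -/
theorem lintegral_orbit_of_invariant {S N : Subgroup G} [IsClosed (S : Set G)]
    [IsClosed (N : Set G)] {ρS ρN : G → ℝ} {μS : Measure (RCoset S)} {μN : Measure (RCoset N)}
    [IsFiniteMeasure μS]
    (hS : Corresponds S ((↑) : S → G) (rightHaar G) (rightHaar S) ρS μS)
    (hSc : ∀ a, ρS a = ρS 1)
    (hN : Corresponds N ((↑) : N → G) (rightHaar G) (rightHaar N) ρN μN)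
    (hNc : ∀ a, ρN a = ρN 1) (h1 : μN Set.univ = 1) {x : G}
    (hx : CosetInv N fun t => RCoset.mk S (x * t)) {f : G → ℝ≥0∞} (hf : Measurable f)
    (hfS : CosetInv S f) :
    ∫⁻ z : RCoset N, f (x * z.out) ∂μN = (μS Set.univ)⁻¹ * ∫⁻ u : RCoset S, f u.out ∂μS := by
  have hxm : Measurable fun z : RCoset N => RCoset.mk S (x * z.out) :=
    hx.measurable ((RCoset.measurable_mk S).comp (measurable_const_mul x))
  set m : Measure (RCoset S) := μN.map fun z : RCoset N => RCoset.mk S (x * z.out)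
  have hm : ∀ g : G → ℝ≥0∞, Measurable g → CosetInv S g →
      ∫⁻ u : RCoset S, g u.out ∂m = ∫⁻ z : RCoset N, g (x * z.out) ∂μN := by
    intro g hg hgS
    rw [lintegral_map (hgS.measurable hg) hxm]
    simp only [hgS.out]
  have hm1 : m Set.univ = 1 := by
    rw [Measure.map_apply hxm MeasurableSet.univ, Set.preimage_univ, h1]
  have hfin : IsFiniteMeasure m := ⟨by rw [hm1]; exact ENNReal.one_lt_top⟩
  have hm0 : m ≠ 0 := fun h => by simp [h] at hm1
  have hinv : IsInvariant m := by
    intro s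
    ext B hB
    have hBS : CosetInv S fun a => B.indicator (1 : RCoset S → ℝ≥0∞) (RCoset.mk S a) :=
      CosetInv.comp_mk _
    have hBm : Measurable fun a => B.indicator (1 : RCoset S → ℝ≥0∞) (RCoset.mk S a) :=
      (measurable_one.indicator hB).comp (RCoset.measurable_mk S)
    have hBx : CosetInv N fun t => B.indicator (1 : RCoset S → ℝ≥0∞) (RCoset.mk S (x * t)) :=
      hx.comp _
    have hBxm : Measurable fun t => B.indicator (1 : RCoset S → ℝ≥0∞) (RCoset.mk S (x * t)) :=
      hBm.comp (measurable_const_mul x)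
    have e1 : m.map (RCoset.translate S s) B = ∫⁻ u : RCoset S, B.indicator 1
        (RCoset.mk S (u.out * s)) ∂m := by
      rw [← lintegral_indicator_one hB, lintegral_map (measurable_one.indicator hB)
        (RCoset.measurable_translate S s)]
      refine lintegral_congr fun u => ?_
      conv_lhs => rw [← RCoset.mk_out u]
      rw [RCoset.translate_mk]
    have e2 : m B = ∫⁻ u : RCoset S, B.indicator 1 (RCoset.mk S u.out) ∂m := by
      simp only [RCoset.mk_out]
      rw [lintegral_indicator_one hB]
    have hBs : Measurable fun a => B.indicator (1 : RCoset S → ℝ≥0∞) (RCoset.mk S (a * s)) :=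
      hBm.comp (measurable_mul_const s)
    rw [e1, e2, hm _ hBs (hBS.mul_right s), hm _ hBm hBS]
    have := hN.lintegral_translate (j := N.subtype) (isClosedEmbedding_subtype N) N.range_subtype
      hBxm hBx s
    simp only [mul_assoc] at this ⊢
    rw [this]
    refine lintegral_congr fun z => ?_
    rw [hNc (z.out * s⁻¹), hNc z.out, div_self (hN.pos _).ne', ENNReal.ofReal_one, mul_one]
  obtain ⟨c, hc, hcorr⟩ := hinv.exists_corresponds (L := S) (j := S.subtype)
    (isClosedEmbedding_subtype S) S.range_subtype hm0
  have hS' : Corresponds S ((↑) : S → G) (rightHaar G) (rightHaar S) (fun _ => ρS 1) μS := by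
    have : ρS = fun _ => ρS 1 := funext hSc
    rwa [this] at hS
  -- The image measure and `μS` both have constant `ρ`-functions, hence are proportional. The test
  -- function `1` determines the constant.
  have key := fun (g : G → ℝ≥0∞) (hg : Measurable g) (hgS : CosetInv S g) =>
    hcorr.lintegral_const (isClosedEmbedding_subtype S) S.range_subtype hg hgS hS'
  have k1 := key 1 measurable_one fun _ _ _ => rfl
  have k2 := key f hf hfS
  simp only [Pi.one_apply, lintegral_one, hm1, mul_one] at k1
  rw [hm f hf hfS] at k2
  have hρ : ENNReal.ofReal (ρS 1) ≠ 0 := by simpa using hS.pos 1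
  have hμ0 := hS.measure_univ_ne_zero
  have hμ1 : μS Set.univ ≠ ∞ := measure_ne_top _ _
  have hc0 : ENNReal.ofReal c ≠ 0 := by simpa using hc
  rw [k1, mul_assoc] at k2
  have k3 := (ENNReal.mul_right_inj hc0 ENNReal.ofReal_ne_top).1 k2
  rw [← k3, ← mul_assoc, ENNReal.inv_mul_cancel hμ0 hμ1, one_mul]

namespace CosetMeasures

theorem FiniteInvH.const (h : D.FiniteInvH) (a : G) : D.ρH a = D.ρH 1 :=
  D.corrH.const_of_isInvariant (j := H.subtype) (isClosedEmbedding_subtype H) H.range_subtype h.2 a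

theorem FiniteInvK.const (h : D.FiniteInvK) (a : G) : D.ρK a = D.ρK 1 :=
  D.corrK.const_of_isInvariant (j := K.subtype) (isClosedEmbedding_subtype K) K.range_subtype h.2 a

theorem FiniteInvH.lamH (h : D.FiniteInvH) (x t : G) : D.lamH x t = 1 := by
  rw [CosetMeasures.lamH, h.const (x * t), h.const x, div_self (D.corrH.pos 1).ne']

theorem FiniteInvK.lamK (h : D.FiniteInvK) (x t : G) : D.lamK x t = 1 := by
  rw [CosetMeasures.lamK, h.const (x * t), h.const x, div_self (D.corrK.pos 1).ne']

/-- In each case every factor of the weight has either exponent zero or base one, because an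
invariant measure has constant `ρ`-function. -/
theorem wt_eq_one (h : D.CondA p qd ∨ D.CondB ∨ (p = 1 ∧ qd = 1)) (x y t : G) :
    D.wt p qd x y t = 1 := by
  rcases h with (⟨rfl, h⟩ | ⟨rfl, h⟩) | ⟨h, h'⟩ | ⟨rfl, rfl⟩
  · simp [wt, h.lamK]
  · simp [wt, h.lamH]
  · simp [wt, h.lamK, h'.lamH]
  · simp [wt]

theorem measure_univ_rpow_ne_top (h : D.CondA p qd ∨ D.CondB ∨ (p = 1 ∧ qd = 1)) (hp : 1 ≤ p)
    (hq : 1 ≤ qd) : D.μH Set.univ ^ (1 - 1 / p) * D.μK Set.univ ^ (1 - 1 / qd) ≠ ∞ := by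
  have hp1 : 0 ≤ 1 - 1 / p := by
    rw [sub_nonneg, div_le_one (by linarith)]; exact hp
  have hq1 : 0 ≤ 1 - 1 / qd := by
    rw [sub_nonneg, div_le_one (by linarith)]; exact hq
  have fH : D.FiniteInvH → D.μH Set.univ ^ (1 - 1 / p) ≠ ∞ := fun h => by
    have := h.1
    exact ENNReal.rpow_ne_top_of_nonneg hp1 (measure_ne_top _ _)
  have fK : D.FiniteInvK → D.μK Set.univ ^ (1 - 1 / qd) ≠ ∞ := fun h => by
    have := h.1
    exact ENNReal.rpow_ne_top_of_nonneg hq1 (measure_ne_top _ _)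
  rcases h with (⟨h1, h⟩ | ⟨h1, h⟩) | ⟨h, h'⟩ | ⟨h1, h2⟩
  -- The first exponent is zero, so that factor is one even if the total mass is infinite.
  · exact ENNReal.mul_ne_top (by simp [h1]) (fK h)
  · exact ENNReal.mul_ne_top (fH h) (by simp [h1])
  · exact ENNReal.mul_ne_top (fH h') (fK h)
  · exact ENNReal.mul_ne_top (by simp [h1]) (by simp [h2])

/-- Disintegrating the constant function `1` over `s` yields the mass of `s` for the image measure,
which is `μHK s` itself. -/
theorem dMeasure_univ (hI : D.IsImageMeasure) : ∀ᵐ d ∂D.μHK, D.dMeasure d Set.univ = 1 := by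
  have h1 : AEMeasurable (fun d => D.dMeasure d Set.univ) D.μHK := by
    simpa using D.aemeasurable_dMeasure (F := fun _ => 1) measurable_const
  refine ae_eq_of_forall_setLIntegral_eq_of_sigmaFinite₀ h1 aemeasurable_const fun s hs _ => ?_
  have h2 := D.setLIntegral_dMeasure (F := fun _ => 1) measurable_const hs
  simp only [lintegral_one] at h2
  rw [h2, lintegral_const, one_mul, Measure.restrict_apply_univ, hI s hs]
  exact lintegral_indicator_one (measurable_toDCoset hs)

end CosetMeasures

namespace TensorSeries

/-- Both `λ_H` and `λ_K` are one, hence so is `λ_{x,y}`, and the orbit measure is an invariant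
probability measure. Its images in `G/H` and `G/K` are the normalized invariant measures, whence the
two reciprocal masses. -/
theorem balanced_of_condB (hB : D.CondB) (hI : D.IsImageMeasure) :
    D.Generic fun x y => Balanced D x y (D.μH Set.univ)⁻¹ (D.μK Set.univ)⁻¹ := by
  obtain ⟨hfK, hfH⟩ := hB
  have := hfH.1
  have := hfK.1
  filter_upwards [D.generic_lam, D.dMeasure_univ hI] with d hd h1 x y hxy
  have hN1 : D.μ x y Set.univ = 1 := by
    rw [← hxy, D.dMeasure_mk, CosetMeasures.orbMeasure,
      Measure.map_apply (measurable_orbitMap x y) MeasurableSet.univ, Set.preimage_univ] at h1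
    exact h1
  have hNc : ∀ t, D.ρ x y t = D.ρ x y 1 := by
    intro t
    have := hd x y hxy t
    rw [hfH.lamH, hfK.lamK, mul_one, CosetMeasures.lam, div_eq_one_iff_eq
      ((D.corr x y).pos 1).ne'] at this
    exact this
  refine ⟨fun s _ => hfH.lamH x s, fun s _ => hfK.lamK y s, fun f hf hfi => ?_, fun f hf hfi => ?_⟩
  · simp only [hfK.lamK, inv_one, ENNReal.ofReal_one, mul_one]
    exact lintegral_orbit_of_invariant D.corrH hfH.const (D.corr x y) hNc hN1
      ((CosetInv.comp_mk (S := H) id).stab_left x y) hf hfi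
  · simp only [hfH.lamH, inv_one, ENNReal.ofReal_one, mul_one]
    exact lintegral_orbit_of_invariant D.corrK hfK.const (D.corr x y) hNc hN1
      ((CosetInv.comp_mk (S := K) id).stab_right x y) hf hfi

variable (F : TensorSeries π γ D p qd)

theorem generic_good (hw : D.Generic fun x y => ∀ s ∈ stab H K x y, D.wt p qd x y s = 1) {r : ℝ}
    (hr : 0 < r) {n : DCoset H K → ℝ≥0∞} (hn : Measurable n)
    (hb : ∀ᵐ d ∂D.μHK, ∀ x y, DCoset.mk H K (x, y) = d → F.bound x y ≤ n d)
    (hnr : ∫⁻ d, n d ^ r ∂D.μHK < ∞) : D.Generic F.Good := by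
  filter_upwards [hw, D.generic_lam, hb, ae_lt_top (hn.pow_const r) hnr.ne] with d h1 h2 h3 h4 x y
    hxy
  have h5 : n d ≠ ∞ := fun h => by simp [h, hr] at h4
  exact ⟨h2 x y hxy, h1 x y hxy, ne_top_of_le_ne_top h5 (h3 x y hxy)⟩

/-- With weight one, the bound integrated over `Υ` is the sum of the products of `L_1` norms. Each
of these is controlled by the given norm, because the exponent is one or the total mass is finite.
-/
theorem exists_bound_one (h : D.CondA p qd ∨ D.CondB ∨ (p = 1 ∧ qd = 1)) (hp : 1 ≤ p)
    (hq : 1 ≤ qd) :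
    ∃ n : DCoset H K → ℝ≥0∞, Measurable n ∧ (∀ᵐ d ∂D.μHK, ∀ x y, DCoset.mk H K (x, y) = d →
      F.bound x y ≤ n d) ∧ ∫⁻ d, n d ^ (1 : ℝ) ∂D.μHK < ∞ := by
  have hw := D.wt_eq_one h
  have hum : ∀ i, AEMeasurable (fun d => ∫⁻ q, F.normProd 1 1 i q ∂(D.dMeasure d)) D.μHK :=
    fun i => D.aemeasurable_dMeasure (F.measurable_normProd 1 1 i)
  have hsum : AEMeasurable (fun d => ∑' i, ∫⁻ q, F.normProd 1 1 i q ∂(D.dMeasure d)) D.μHK :=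
    AEMeasurable.tsum hum
  refine ⟨hsum.mk _, hsum.measurable_mk, ?_, ?_⟩
  · filter_upwards [hsum.ae_eq_mk] with d hd x y hxy
    rw [← hd, F.bound_eq_tsum fun s _ => hw x y s]
    refine ENNReal.tsum_le_tsum fun i => le_of_eq ?_
    rw [← hxy, F.lintegral_normProd_dMeasure, termBound]
    simp [majorant, hw]
  · simp only [ENNReal.rpow_one]
    rw [← lintegral_congr_ae hsum.ae_eq_mk, lintegral_tsum hum]
    simp only [F.lintegral_lintegral_normProd, ENNReal.rpow_one]
    set C := D.μH Set.univ ^ (1 - 1 / p) * D.μK Set.univ ^ (1 - 1 / qd)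
    have hC : C ≠ ∞ := D.measure_univ_rpow_ne_top h hp hq
    refine lt_of_le_of_lt (ENNReal.tsum_le_tsum (g := fun i => C *
      (lpNorm D.μH p (F.f i) * lpNorm D.μK qd (F.g i))) fun i => ?_) ?_
    · refine (mul_le_mul' (lintegral_le_rpow_mul_measure_univ (F.measurable_f_out i) hp)
        (lintegral_le_rpow_mul_measure_univ (F.measurable_g_out i) hq)).trans_eq ?_
      simp only [C, lpNorm]
      ring
    · rw [ENNReal.tsum_mul_left]
      exact (ENNReal.mul_ne_top hC F.summable).lt_top

end TensorSeries

section CaseOne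

variable (hπ : ∀ v : V, Continuous fun h => π h v) (hγ : ∀ w : W, Continuous fun k => γ k w)
  (hp : 1 ≤ p) (hq : 1 ≤ qd)

include hp hq in
theorem converges_of_condABC (h : D.CondA p qd ∨ D.CondB ∨ (p = 1 ∧ qd = 1))
    (F : TensorSeries π γ D p qd) : F.Converges := by
  obtain ⟨n, hn, hb, hnr⟩ := F.exists_bound_one h hp hq
  exact TensorSeries.converges_of_good (F.generic_good
    (.of_forall fun d x y _ s _ => D.wt_eq_one h x y s) one_pos hn hb hnr)

include hπ hγ hp hq in
theorem Apq_subset_LrΔ₂_one (h : D.CondA p qd ∨ D.CondB ∨ (p = 1 ∧ qd = 1)) :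
    Apq π γ D p qd ⊆ LrΔ₂ π γ D 1 := by
  rintro _ ⟨F, rfl⟩
  obtain ⟨n, hn, hb, hnr⟩ := F.exists_bound_one h hp hq
  exact F.Psi_mem_LrΔ₂ hπ hγ (F.generic_good
    (.of_forall fun d x y _ s _ => D.wt_eq_one h x y s) one_pos hn hb hnr)
    (.of_forall fun d x y _ s => D.wt_eq_one h x y s) one_pos hb hnr

include hπ hγ hp hq in
theorem Apq_subset_LrΔ₂_of_condB (hB : D.CondB) (hI : D.IsImageMeasure)
    (he : 1 < 1 / p + 1 / qd) {r : ℝ} (hr : 1 / r = 1 / p + 1 / qd - 1) :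
    Apq π γ D p qd ⊆ LrΔ₂ π γ D r := by
  rintro _ ⟨F, rfl⟩
  have hw : ∀ x y s, D.wt p qd x y s = 1 := D.wt_eq_one (.inr (.inl hB))
  have hr0 : 0 < r := one_div_pos.1 (by linarith)
  have hp1 : 0 ≤ 1 - 1 / p := by
    rw [sub_nonneg, div_le_one (by linarith)]; exact hp
  have hq1 : 0 ≤ 1 - 1 / qd := by
    rw [sub_nonneg, div_le_one (by linarith)]; exact hq
  set I := (D.μH Set.univ)⁻¹
  set J := (D.μK Set.univ)⁻¹
  have hC : I ^ (1 - 1 / qd) * J ^ (1 - 1 / p) ≠ ∞ := ENNReal.mul_ne_top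
    (ENNReal.rpow_ne_top_of_nonneg hq1 (ENNReal.inv_ne_top.2 D.corrH.measure_univ_ne_zero))
    (ENNReal.rpow_ne_top_of_nonneg hp1 (ENNReal.inv_ne_top.2 D.corrK.measure_univ_ne_zero))
  obtain ⟨n, hn, hb, hnr⟩ := F.exists_bound hp hq he hr
    (C := (I ^ (1 - 1 / qd) * J ^ (1 - 1 / p)).toNNReal)
    ((TensorSeries.balanced_of_condB hB hI).mono fun x y h =>
      ⟨I, J, h, (ENNReal.coe_toNNReal hC).ge⟩)
  exact F.Psi_mem_LrΔ₂ hπ hγ (F.generic_good (.of_forall fun d x y _ s _ => hw x y s) hr0 hn hb hnr)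
    (.of_forall fun d x y _ s => hw x y s) hr0 hb hnr

end CaseOne

end ApqSpace

namespace ApqSpace

variable {G : Type*} [Group G] [TopologicalSpace G] [IsTopologicalGroup G] [LocallyCompactSpace G]
  [SecondCountableTopology G] [T2Space G] [MeasurableSpace G] [BorelSpace G]
  {H K : Subgroup G} [hH : IsClosed (H : Set G)] [hK : IsClosed (K : Set G)]
  {V W : Type*} [NormedAddCommGroup V] [NormedSpace ℂ V] [TopologicalSpace.SeparableSpace V]
  [NormedAddCommGroup W] [NormedSpace ℂ W] [TopologicalSpace.SeparableSpace W]
  [TopologicalSpace.SeparableSpace (StrongDual ℂ W)]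
  {π : H →* (V ≃ₗᵢ[ℂ] V)} {γ : K →* (W ≃ₗᵢ[ℂ] W)} {D : CosetMeasures H K} {p qd : ℝ}

/-! ### Condition (d) -/

namespace CosetMeasures

variable (D)

/-- The integral defining `M_{x,y}`. -/
def factorH (x y : G) : ℝ≥0∞ :=
  ∫⁻ α, ENNReal.ofReal ((D.ρHx x (α.out : conj H x) / D.ρHx x 1) / D.lam x y (α.out : conj H x))
    ∂(D.μHxy x y)

/-- The integral defining `N_{x,y}`. -/
def factorK (x y : G) : ℝ≥0∞ :=
  ∫⁻ ξ, ENNReal.ofReal ((D.ρKy y (ξ.out : conj K y) / D.ρKy y 1) / D.lam x y (ξ.out : conj K y))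
    ∂(D.μKxy x y)

theorem M_eq (hq : 0 < qd) (x y : G) : D.M qd x y = D.factorH x y ^ (1 - 1 / qd) := by
  rw [M, factorH, sub_div, div_self hq.ne']

theorem N_eq (hp : 0 < p) (x y : G) : D.N p x y = D.factorK x y ^ (1 - 1 / p) := by
  rw [N, factorK, sub_div, div_self hp.ne']

theorem ρHx_ratio (x t : G) : D.ρHx x t / D.ρHx x 1 = D.lamH x t :=
  D.corrH.conj_ratio (D.corrHx x) t

theorem ρKy_ratio (y t : G) : D.ρKy y t / D.ρKy y 1 = D.lamK y t :=
  D.corrK.conj_ratio (D.corrKy y) t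

variable {D} {x y : G}

/-- An invariant measure on `H^x/N` forces `ρ_{x,y}/ρ_{H^x}` to be `N`-invariant, so `λ_{x,y}`
agrees with `λ_H(x,·)` on `N`. Against the factorization `λ_H λ_K` this leaves only `λ_K = 1`. The
hypothesis on the `H` side thus controls the `K` side. -/
theorem lamK_stab_eq_one (hlam : ∀ t, D.lam x y t = D.lamH x t * D.lamK y t)
    (hm : HasInvariantMeasure ((stab H K x y).subgroupOf (conj H x))) {s : G}
    (hs : s ∈ stab H K x y) : D.lamK y s = 1 := by
  have hle : stab H K x y ≤ conj H x := inf_le_left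
  have hr : (Subgroup.inclusion hle).range = (stab H K x y).subgroupOf (conj H x) :=
    Subgroup.inclusion_range hle
  have h1 := hm.cosetInv (j := Subgroup.inclusion hle) (isClosedEmbedding_inclusion hle) hr
    (D.corrHxy x y) ⟨s, hle hs⟩ hs 1
  simp only [mul_one, Subgroup.coe_one] at h1
  have h2 := D.ρHx_ratio x s
  have h3 := hlam s
  have p1 := (D.corr x y).pos 1
  have p2 := (D.corrHx x).pos 1
  have p3 := (D.corrHx x).pos s
  have p4 := D.lamH_pos x s
  have h4 : D.lam x y s = D.lamH x s := by
    rw [← h2, lam]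
    rw [div_eq_div_iff p3.ne' p2.ne'] at h1
    rw [div_eq_div_iff p1.ne' p2.ne', h1]
    ring
  rw [h4] at h3
  exact (mul_eq_left₀ p4.ne').1 h3.symm

theorem lamH_stab_eq_one (hlam : ∀ t, D.lam x y t = D.lamH x t * D.lamK y t)
    (hm : HasInvariantMeasure ((stab H K x y).subgroupOf (conj K y))) {s : G}
    (hs : s ∈ stab H K x y) : D.lamH x s = 1 := by
  have hle : stab H K x y ≤ conj K y := inf_le_right
  have hr : (Subgroup.inclusion hle).range = (stab H K x y).subgroupOf (conj K y) :=
    Subgroup.inclusion_range hle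
  have h1 := hm.cosetInv (j := Subgroup.inclusion hle) (isClosedEmbedding_inclusion hle) hr
    (D.corrKxy x y) ⟨s, hle hs⟩ hs 1
  simp only [mul_one, Subgroup.coe_one] at h1
  have h2 := D.ρKy_ratio y s
  have h3 := hlam s
  have p1 := (D.corr x y).pos 1
  have p2 := (D.corrKy y).pos 1
  have p3 := (D.corrKy y).pos s
  have p4 := D.lamK_pos y s
  have h4 : D.lam x y s = D.lamK y s := by
    rw [← h2, lam]
    rw [div_eq_div_iff p3.ne' p2.ne'] at h1
    rw [div_eq_div_iff p1.ne' p2.ne', h1]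
    ring
  rw [h4] at h3
  exact (mul_eq_right₀ p4.ne').1 h3.symm

variable (D) in
-- The cocycle rule is applied to `n s = s (s⁻¹ n s)` in two ways. It lets triviality on the
-- stabilizer travel along a double coset.
theorem lamH_conj {h : G} (hh : h ∈ H) {x n : G} (hn : x * n * x⁻¹ ∈ H) (s : G) :
    D.lamH (h * x * s) (s⁻¹ * n * s) = D.lamH x n := by
  have e1 : D.lamH (h * x * s) (s⁻¹ * n * s) = D.lamH (x * s) (s⁻¹ * n * s) := by
    rw [mul_assoc h]
    exact D.lamH_cosetInv _ h hh (x * s)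
  have e2 : D.lamH (x * n) s = D.lamH x s := by
    have : x * n = (x * n * x⁻¹) * x := by group
    rw [this]
    exact D.lamH_cosetInv s _ hn x
  have e3 := D.lamH_mul x n s
  have e4 := D.lamH_mul x s (s⁻¹ * n * s)
  rw [show s * (s⁻¹ * n * s) = n * s by group, e3, e2] at e4
  rw [e1]
  refine mul_left_cancel₀ (D.lamH_pos x s).ne' ?_
  rw [← e4, mul_comm]

variable (D) in
theorem lamK_conj {k : G} (hk : k ∈ K) {y n : G} (hn : y * n * y⁻¹ ∈ K) (s : G) :
    D.lamK (k * y * s) (s⁻¹ * n * s) = D.lamK y n := by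
  have e1 : D.lamK (k * y * s) (s⁻¹ * n * s) = D.lamK (y * s) (s⁻¹ * n * s) := by
    rw [mul_assoc k]
    exact D.lamK_cosetInv _ k hk (y * s)
  have e2 : D.lamK (y * n) s = D.lamK y s := by
    have : y * n = (y * n * y⁻¹) * y := by group
    rw [this]
    exact D.lamK_cosetInv s _ hn y
  have e3 := D.lamK_mul y n s
  have e4 := D.lamK_mul y s (s⁻¹ * n * s)
  rw [show s * (s⁻¹ * n * s) = n * s by group, e3, e2] at e4
  rw [e1]
  refine mul_left_cancel₀ (D.lamK_pos y s).ne' ?_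
  rw [← e4, mul_comm]

theorem conj_mem_stab {h k : G} (hh : h ∈ H) (hk : k ∈ K) {x y n : G} (hn : n ∈ stab H K x y)
    (s : G) : s⁻¹ * n * s ∈ stab H K (h * x * s) (k * y * s) := by
  refine mem_stab.2 ⟨?_, ?_⟩
  · have := H.mul_mem (H.mul_mem hh (mem_stab.1 hn).1) (H.inv_mem hh)
    convert this using 1
    group
  · have := K.mul_mem (K.mul_mem hk (mem_stab.1 hn).2) (K.inv_mem hk)
    convert this using 1
    group

end CosetMeasures

namespace TensorSeries

open CosetMeasures

variable {x y : G}

/-- By the factorization, `λ_{H^x}/λ_{x,y}` is `1/λ_K(y,·)`, which is the weight in integration in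
stages from `G/N` to `G/H^x`. The mass of the fibre is the integral that defines `M`, and dually for
`K` and `N`. -/
theorem balanced_of_stab (hlam : ∀ t, D.lam x y t = D.lamH x t * D.lamK y t)
    (h1 : ∀ s ∈ stab H K x y, D.lamH x s = 1) (h2 : ∀ s ∈ stab H K x y, D.lamK y s = 1) :
    Balanced D x y (D.factorH x y) (D.factorK x y) := by
  have hb0 : ∀ s ∈ stab H K x y, ∀ t, D.lamH x (s * t) = D.lamH x t := fun s hs t => by
    have e : x * s = (x * s * x⁻¹) * x := by group
    rw [D.lamH_mul, h1 s hs, one_mul, e]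
    exact D.lamH_cosetInv t _ (mem_stab.1 hs).1 x
  have hb1 : ∀ s ∈ stab H K x y, ∀ t, D.lamK y (s * t) = D.lamK y t := fun s hs t => by
    have e : y * s = (y * s * y⁻¹) * y := by group
    rw [D.lamK_mul, h2 s hs, one_mul, e]
    exact D.lamK_cosetInv t _ (mem_stab.1 hs).2 y
  have hρ : ∀ t, D.ρ x y t = D.ρ x y 1 * (D.lamH x t * D.lamK y t) := fun t => by
    rw [← hlam, lam, mul_div_cancel₀ _ ((D.corr x y).pos 1).ne']
  have hρH : ∀ t, D.ρHx x t = D.ρHx x 1 * D.lamH x t := fun t => by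
    rw [← D.ρHx_ratio, mul_div_cancel₀ _ ((D.corrHx x).pos 1).ne']
  have hρK : ∀ t, D.ρKy y t = D.ρKy y 1 * D.lamK y t := fun t => by
    rw [← D.ρKy_ratio, mul_div_cancel₀ _ ((D.corrKy y).pos 1).ne']
  refine ⟨h1, h2, fun f hf hfi => ?_, fun f hf hfi => ?_⟩
  · have hinv : CosetInv (stab H K x y) fun a => D.ρ x y a / D.ρHx x a := fun s hs t => by
      simp only
      rw [hρ (s * t), hρH (s * t), hρ t, hρH t, hb0 s hs, hb1 s hs]
    have hfc : CosetInv (conj H x) fun a => f (x * a) := fun s hs a => by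
      have : x * (s * a) = (x * s * x⁻¹) * (x * a) := by group
      simp only
      rw [this]
      exact hfi _ hs _
    have hfm : Measurable fun a => f (x * a) := hf.comp (measurable_const_mul x)
    have key := Corresponds.lintegral_tower (N := stab H K x y) (P := conj H x) inf_le_left (D.corr x y)
      (D.corrHx x) (D.corrHxy x y) hinv hfm hfc
    rw [lintegral_conjMeasure _ _ hfm hfc] at key
    simp only [mul_inv_cancel_left] at key
    change _ = D.factorH x y * _ at key
    rw [← key]
    refine lintegral_congr fun z => ?_
    congr 2
    rw [D.ρHx_ratio]
    change _ = _ / D.lam x y z.out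
    rw [hlam]
    have := D.lamH_pos x z.out
    have := D.lamK_pos y z.out
    field_simp
  · have hinv : CosetInv (stab H K x y) fun a => D.ρ x y a / D.ρKy y a := fun s hs t => by
      simp only
      rw [hρ (s * t), hρK (s * t), hρ t, hρK t, hb0 s hs, hb1 s hs]
    have hfc : CosetInv (conj K y) fun a => f (y * a) := fun s hs a => by
      have : y * (s * a) = (y * s * y⁻¹) * (y * a) := by group
      simp only
      rw [this]
      exact hfi _ hs _
    have hfm : Measurable fun a => f (y * a) := hf.comp (measurable_const_mul y)
    have key := Corresponds.lintegral_tower (N := stab H K x y) (P := conj K y) inf_le_right (D.corr x y)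
      (D.corrKy y) (D.corrKxy x y) hinv hfm hfc
    rw [lintegral_conjMeasure _ _ hfm hfc] at key
    simp only [mul_inv_cancel_left] at key
    change _ = D.factorK x y * _ at key
    rw [← key]
    refine lintegral_congr fun z => ?_
    congr 2
    rw [D.ρKy_ratio]
    change _ = _ / D.lam x y z.out
    rw [hlam]
    have := D.lamH_pos x z.out
    have := D.lamK_pos y z.out
    field_simp

theorem exists_weight_coset {S : Subgroup G} (μ : Measure (RCoset S)) [SigmaFinite μ]
    (hμ : μ Set.univ ≠ 0) : ∃ f : G → ℝ≥0∞, Measurable f ∧ CosetInv S f ∧ (∀ t, f t ≠ 0) ∧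
      ∫⁻ u : RCoset S, f u.out ∂μ ≠ 0 ∧ ∫⁻ u : RCoset S, f u.out ∂μ ≠ ∞ := by
  obtain ⟨k, hk, hk0, -, hk2⟩ := exists_weight μ
  refine ⟨fun t => k (RCoset.mk S t), hk.comp (RCoset.measurable_mk S), CosetInv.comp_mk k,
    fun t => hk0 _, ?_, ?_⟩
  · simp only [RCoset.mk_out]
    intro h
    have h' := (lintegral_eq_zero_iff hk).1 h
    refine hμ (measure_mono_null (fun u _ => ?_) h')
    exact hk0 u
  · simpa only [RCoset.mk_out] using hk2

theorem lintegral_shift {h k : G} (hh : h ∈ H) (hk : k ∈ K) (x y s : G) {Φ : G → ℝ≥0∞}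
    (hΦ : Measurable Φ) (hinv : CosetInv (stab H K (h * x * s) (k * y * s)) Φ) :
    ∫⁻ z, Φ z.out ∂(D.μ (h * x * s) (k * y * s)) = ∫⁻ z, Φ (s⁻¹ * z.out) ∂(D.μ x y) := by
  rw [D.equivariant h hh k hk, lintegral_map (hinv.measurable hΦ) (measurable_shift hh hk x y s)]
  simp only [hinv.out]

variable {I J I' J' : ℝ≥0∞}

/-- One integral is computed at both points. A test function with finite nonzero integral over `G/H`
determines the factor, and the substitution `t ↦ s⁻¹ t` contributes `λ_K(y,s)`. -/
theorem Balanced.eq_mul_left (hB : Balanced D x y I J) {h k s : G} (hh : h ∈ H) (hk : k ∈ K)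
    (hB' : Balanced D (h * x * s) (k * y * s) I' J') : I' = ENNReal.ofReal (D.lamK y s) * I := by
  obtain ⟨f, hf, hfi, -, hf0, hf1⟩ := exists_weight_coset D.μH D.corrH.measure_univ_ne_zero
  have h1 := hB.intH f hf hfi
  have h2 := hB'.intH f hf hfi
  have hΦm : Measurable fun t => f (h * x * s * t) * ENNReal.ofReal (D.lamK (k * y * s) t)⁻¹ :=
    (hf.comp (measurable_const_mul _)).mul (D.continuous_lamK_right _).measurable.inv.ennreal_ofReal
  have hΦi : CosetInv (stab H K (h * x * s) (k * y * s))
      fun t => f (h * x * s * t) * ENNReal.ofReal (D.lamK (k * y * s) t)⁻¹ := fun n hn t => by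
    have e1 : f (h * x * s * (n * t)) = f (h * x * s * t) := hfi.stab_left _ _ n hn t
    have e2 := hB'.cosetInv_lamK n hn t
    simp only [e1, e2]
  rw [lintegral_shift hh hk x y s hΦm hΦi] at h2
  have e : ∀ t, f (h * x * s * (s⁻¹ * t)) * ENNReal.ofReal (D.lamK (k * y * s) (s⁻¹ * t))⁻¹ =
      ENNReal.ofReal (D.lamK y s) * (f (x * t) * ENNReal.ofReal (D.lamK y t)⁻¹) := by
    intro t
    have a1 : f (h * x * s * (s⁻¹ * t)) = f (x * t) := by
      rw [show h * x * s * (s⁻¹ * t) = h * (x * t) by group]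
      exact hfi h hh _
    have a2 : D.lamK (k * y * s) (s⁻¹ * t) = D.lamK (y * s) (s⁻¹ * t) := by
      rw [mul_assoc k]
      exact D.lamK_cosetInv _ k hk (y * s)
    have a3 := D.lamK_mul y s (s⁻¹ * t)
    rw [mul_inv_cancel_left] at a3
    have p1 := D.lamK_pos y s
    have p2 := D.lamK_pos (y * s) (s⁻¹ * t)
    rw [a1, a2, a3, mul_left_comm, ← ENNReal.ofReal_mul p1.le]
    congr 2
    field_simp
  simp only [e] at h2
  rw [lintegral_const_mul' _ _ ENNReal.ofReal_ne_top, h1, ← mul_assoc] at h2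
  exact ((ENNReal.mul_left_inj hf0 hf1).1 h2).symm

theorem Balanced.eq_mul_right (hB : Balanced D x y I J) {h k s : G} (hh : h ∈ H) (hk : k ∈ K)
    (hB' : Balanced D (h * x * s) (k * y * s) I' J') : J' = ENNReal.ofReal (D.lamH x s) * J := by
  obtain ⟨f, hf, hfi, -, hf0, hf1⟩ := exists_weight_coset D.μK D.corrK.measure_univ_ne_zero
  have h1 := hB.intK f hf hfi
  have h2 := hB'.intK f hf hfi
  have hΦm : Measurable fun t => f (k * y * s * t) * ENNReal.ofReal (D.lamH (h * x * s) t)⁻¹ :=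
    (hf.comp (measurable_const_mul _)).mul (D.continuous_lamH_right _).measurable.inv.ennreal_ofReal
  have hΦi : CosetInv (stab H K (h * x * s) (k * y * s))
      fun t => f (k * y * s * t) * ENNReal.ofReal (D.lamH (h * x * s) t)⁻¹ := fun n hn t => by
    have e1 : f (k * y * s * (n * t)) = f (k * y * s * t) := hfi.stab_right _ _ n hn t
    have e2 := hB'.cosetInv_lamH n hn t
    simp only [e1, e2]
  rw [lintegral_shift hh hk x y s hΦm hΦi] at h2
  have e : ∀ t, f (k * y * s * (s⁻¹ * t)) * ENNReal.ofReal (D.lamH (h * x * s) (s⁻¹ * t))⁻¹ =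
      ENNReal.ofReal (D.lamH x s) * (f (y * t) * ENNReal.ofReal (D.lamH x t)⁻¹) := by
    intro t
    have a1 : f (k * y * s * (s⁻¹ * t)) = f (y * t) := by
      rw [show k * y * s * (s⁻¹ * t) = k * (y * t) by group]
      exact hfi k hk _
    have a2 : D.lamH (h * x * s) (s⁻¹ * t) = D.lamH (x * s) (s⁻¹ * t) := by
      rw [mul_assoc h]
      exact D.lamH_cosetInv _ h hh (x * s)
    have a3 := D.lamH_mul x s (s⁻¹ * t)
    rw [mul_inv_cancel_left] at a3
    have p1 := D.lamH_pos x s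
    have p2 := D.lamH_pos (x * s) (s⁻¹ * t)
    rw [a1, a2, a3, mul_left_comm, ← ENNReal.ofReal_mul p1.le]
    congr 2
    field_simp
  simp only [e] at h2
  rw [lintegral_const_mul' _ _ ENNReal.ofReal_ne_top, h1, ← mul_assoc] at h2
  exact ((ENNReal.mul_left_inj hf0 hf1).1 h2).symm

theorem Balanced.left_ne_zero (hB : Balanced D x y I J) : I ≠ 0 := by
  rintro rfl
  obtain ⟨f, hf, hfi, hfp, -, -⟩ := exists_weight_coset D.μH D.corrH.measure_univ_ne_zero
  have h1 := hB.intH f hf hfi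
  have e1 : CosetInv (stab H K x y) fun t => f (x * t) := hfi.stab_left x y
  have hm : Measurable fun z : RCoset (stab H K x y) =>
      f (x * z.out) * ENNReal.ofReal (D.lamK y z.out)⁻¹ :=
    (e1.measurable (hf.comp (measurable_const_mul x))).mul
      (hB.cosetInv_lamK.measurable (D.continuous_lamK_right y).measurable).inv.ennreal_ofReal
  rw [zero_mul, lintegral_eq_zero_iff hm] at h1
  refine (D.corr x y).measure_univ_ne_zero (measure_mono_null (fun z _ => ?_) h1)
  have := D.lamK_pos y z.out
  exact mul_ne_zero (hfp _) (by simpa using this)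

theorem Balanced.right_ne_zero (hB : Balanced D x y I J) : J ≠ 0 := by
  rintro rfl
  obtain ⟨f, hf, hfi, hfp, -, -⟩ := exists_weight_coset D.μK D.corrK.measure_univ_ne_zero
  have h1 := hB.intK f hf hfi
  have e1 : CosetInv (stab H K x y) fun t => f (y * t) := hfi.stab_right x y
  have hm : Measurable fun z : RCoset (stab H K x y) =>
      f (y * z.out) * ENNReal.ofReal (D.lamH x z.out)⁻¹ :=
    (e1.measurable (hf.comp (measurable_const_mul y))).mul
      (hB.cosetInv_lamH.measurable (D.continuous_lamH_right x).measurable).inv.ennreal_ofReal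
  rw [zero_mul, lintegral_eq_zero_iff hm] at h1
  refine (D.corr x y).measure_univ_ne_zero (measure_mono_null (fun z _ => ?_) h1)
  have := D.lamH_pos x z.out
  exact mul_ne_zero (hfp _) (by simpa using this)

/-- The behaviour of `M_{x,y} N_{x,y}` along a double coset. -/
theorem Balanced.mul_rpow_shift (hp : 1 ≤ p) (hq : 1 ≤ qd) (hB : Balanced D x y I J) {h k s : G}
    (hh : h ∈ H) (hk : k ∈ K) (hB' : Balanced D (h * x * s) (k * y * s) I' J') :
    I' ^ (1 - 1 / qd) * J' ^ (1 - 1 / p) =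
      ENNReal.ofReal (D.wt p qd x y s)⁻¹ * (I ^ (1 - 1 / qd) * J ^ (1 - 1 / p)) := by
  have hp1 : 0 ≤ 1 - 1 / p := by
    rw [sub_nonneg, div_le_one (by linarith)]; exact hp
  have hq1 : 0 ≤ 1 - 1 / qd := by
    rw [sub_nonneg, div_le_one (by linarith)]; exact hq
  have h1 := D.lamH_pos x s
  have h2 := D.lamK_pos y s
  rw [hB.eq_mul_left hh hk hB', hB.eq_mul_right hh hk hB', ENNReal.mul_rpow_of_nonneg _ _ hq1,
    ENNReal.mul_rpow_of_nonneg _ _ hp1, ENNReal.ofReal_rpow_of_pos h1,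
    ENNReal.ofReal_rpow_of_pos h2, CosetMeasures.wt, mul_inv, ← Real.rpow_neg h1.le,
    ← Real.rpow_neg h2.le, neg_sub, neg_sub, ENNReal.ofReal_mul (by positivity)]
  ring

/-- Condition (d) is given almost everywhere on `G × G`, which only provides some good point in
almost every double coset. The modular characters of the stabilizers are conjugation invariant, so
triviality spreads from there to every point of the double coset. -/
theorem generic_stab_of_condD (hD : D.CondD p qd) : D.Generic fun x y =>
    Balanced D x y (D.factorH x y) (D.factorK x y) := by
  obtain ⟨-, -, -, hcond, -⟩ := hD
  have hlam := D.generic_lam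
  have hgen := D.generic_of_ae (P := fun x y =>
    HasInvariantMeasure ((stab H K x y).subgroupOf (conj H x)) ∧
    HasInvariantMeasure ((stab H K x y).subgroupOf (conj K y)))
    (hcond.mono fun w hw => ⟨hw.2.1, hw.2.2.2⟩)
  have : (ae (rightHaar G)).NeBot := ae_neBot.2 (NeZero.ne _)
  filter_upwards [hlam, hgen] with d h1 h2 x y hxy
  obtain ⟨s, h, hh, k, hk, hmH, hmK⟩ := (h2 x y hxy).exists
  have hxy' : DCoset.mk H K (h * x * s, k * y * s) = d := by
    rw [← hxy]
    exact DCoset.mk_mul hh hk x y s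
  have hl' := h1 _ _ hxy'
  refine balanced_of_stab (h1 x y hxy) (fun n hn => ?_) fun n hn => ?_
  · rw [← D.lamH_conj hh (mem_stab.1 hn).1 s]
    exact lamH_stab_eq_one hl' hmK (conj_mem_stab hh hk hn s)
  · rw [← D.lamK_conj hk (mem_stab.1 hn).2 s]
    exact lamK_stab_eq_one hl' hmH (conj_mem_stab hh hk hn s)

theorem MN_eq (hp : 1 ≤ p) (hq : 1 ≤ qd) (x y : G) : D.M qd x y * D.N p x y =
    D.factorH x y ^ (1 - 1 / qd) * D.factorK x y ^ (1 - 1 / p) := by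
  rw [D.M_eq (by linarith), D.N_eq (by linarith)]

theorem MN_shift (hp : 1 ≤ p) (hq : 1 ≤ qd) {h k s : G} (hh : h ∈ H) (hk : k ∈ K)
    (hB : Balanced D x y (D.factorH x y) (D.factorK x y))
    (hB' : Balanced D (h * x * s) (k * y * s) (D.factorH (h * x * s) (k * y * s))
      (D.factorK (h * x * s) (k * y * s))) :
    D.M qd (h * x * s) (k * y * s) * D.N p (h * x * s) (k * y * s) =
      ENNReal.ofReal (D.wt p qd x y s)⁻¹ * (D.M qd x y * D.N p x y) := by
  rw [MN_eq hp hq, MN_eq hp hq]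
  exact hB.mul_rpow_shift hp hq hh hk hB'

/-- The essential bound holds at almost every translate, and there `M N` is `wt(x,y,s)⁻¹` times its
value at `(x, y)`. If this value is finite, continuity in `s` extends the inequality to `s = 1`. -/
theorem exists_generic_MN_le (hD : D.CondD p qd) :
    ∃ C : ℝ≥0, D.Generic fun x y => D.M qd x y * D.N p x y ≤ C := by
  have hbal := generic_stab_of_condD hD
  obtain ⟨hp, hq, -, -, C, hC⟩ := hD
  refine ⟨C, ?_⟩
  have hgen := D.generic_of_ae (P := fun x y => D.M qd x y * D.N p x y ≤ C) hC
  have hne : (ae (rightHaar G)).NeBot := ae_neBot.2 (NeZero.ne _)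
  filter_upwards [hbal, hgen] with d h1 h2 x y hxy
  set m := D.M qd x y * D.N p x y
  have hae : ∀ᵐ s ∂(rightHaar G), ENNReal.ofReal (D.wt p qd x y s)⁻¹ * m ≤ C := by
    filter_upwards [h2 x y hxy] with s hs
    obtain ⟨h, hh, k, hk, hle⟩ := hs
    have hxy' : DCoset.mk H K (h * x * s, k * y * s) = d := by
      rw [← hxy]
      exact DCoset.mk_mul hh hk x y s
    rwa [MN_shift hp.le hq.le hh hk (h1 _ _ hxy) (h1 _ _ hxy')] at hle
  -- Multiplication by `∞` is not continuous, so this case is excluded first: a single good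
  -- translate already contradicts it.
  by_cases hm : m = ∞
  · obtain ⟨s, hs⟩ := hae.exists
    have : ENNReal.ofReal (D.wt p qd x y s)⁻¹ ≠ 0 := by
      simpa using inv_pos.2 (D.wt_pos x y s)
    rw [hm, ENNReal.mul_top this] at hs
    exact absurd hs (by simp)
  · have hcont : Continuous fun s => ENNReal.ofReal (D.wt p qd x y s)⁻¹ * m := by
      refine (ENNReal.continuous_mul_const hm).comp (ENNReal.continuous_ofReal.comp ?_)
      exact (D.continuous_wt_right x y).inv₀ fun s => (D.wt_pos x y s).ne'
    have hall : ∀ s, ENNReal.ofReal (D.wt p qd x y s)⁻¹ * m ≤ C := by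
      have hd : Dense {s | ENNReal.ofReal (D.wt p qd x y s)⁻¹ * m ≤ C} :=
        Measure.dense_of_ae hae
      have hcl : IsClosed {s | ENNReal.ofReal (D.wt p qd x y s)⁻¹ * m ≤ C} :=
        isClosed_le hcont continuous_const
      have := hd.closure_eq
      rw [hcl.closure_eq] at this
      intro s
      have hs : s ∈ Set.univ := Set.mem_univ s
      rw [← this] at hs
      exact hs
    have h1' := hall 1
    have hw1 : D.wt p qd x y 1 = 1 := by
      have hH1 : D.lamH x 1 = 1 := by
        rw [CosetMeasures.lamH, mul_one, div_self (D.corrH.pos x).ne']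
      have hK1 : D.lamK y 1 = 1 := by
        rw [CosetMeasures.lamK, mul_one, div_self (D.corrK.pos y).ne']
      rw [CosetMeasures.wt, hH1, hK1, Real.one_rpow, Real.one_rpow, one_mul]
    simpa [hw1] using h1'

/-- `M N` changes by the factor `wt⁻¹` along a double coset. It is finite by the uniform bound and
nonzero because the balancing factors are, so constancy forces the weight to be one. -/
theorem generic_wt_eq_one (hD : D.CondD p qd) (hM : D.MNDescends p qd) :
    D.Generic fun x y => ∀ s, D.wt p qd x y s = 1 := by
  have hbal := generic_stab_of_condD hD
  obtain ⟨C, hC⟩ := exists_generic_MN_le hD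
  obtain ⟨hp, hq, -⟩ := hD
  filter_upwards [hbal, hC, hM] with d h1 h2 h3 x y hxy s
  have hxy' : DCoset.mk H K (1 * x * s, 1 * y * s) = d := by
    rw [← hxy]
    exact DCoset.mk_mul H.one_mem K.one_mem x y s
  have hB := h1 x y hxy
  have e1 := MN_shift hp.le hq.le H.one_mem K.one_mem hB (h1 _ _ hxy')
  have e2 := h3 _ _ hxy' hxy
  simp only at e2
  rw [e2] at e1
  have hm1 : D.M qd x y * D.N p x y ≠ ∞ := ne_top_of_le_ne_top ENNReal.coe_ne_top (h2 x y hxy)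
  have hp1 : 0 ≤ 1 - 1 / p := by
    rw [sub_nonneg, div_le_one (by linarith)]; exact hp.le
  have hq1 : 0 ≤ 1 - 1 / qd := by
    rw [sub_nonneg, div_le_one (by linarith)]; exact hq.le
  have hm0 : D.M qd x y * D.N p x y ≠ 0 := by
    rw [MN_eq hp.le hq.le]
    refine mul_ne_zero ?_ ?_
    · rw [Ne, ENNReal.rpow_eq_zero_iff]
      rintro (⟨h, -⟩ | ⟨-, h⟩)
      · exact hB.left_ne_zero h
      · linarith
    · rw [Ne, ENNReal.rpow_eq_zero_iff]
      rintro (⟨h, -⟩ | ⟨-, h⟩)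
      · exact hB.right_ne_zero h
      · linarith
  have e3 : ENNReal.ofReal (D.wt p qd x y s)⁻¹ = 1 := by
    have : 1 * (D.M qd x y * D.N p x y) =
      ENNReal.ofReal (D.wt p qd x y s)⁻¹ * (D.M qd x y * D.N p x y) := by rw [one_mul]; exact e1
    exact ((ENNReal.mul_left_inj hm0 hm1).1 this).symm
  rw [ENNReal.ofReal_eq_one] at e3
  exact inv_eq_one.1 e3

variable (F : TensorSeries π γ D p qd)

theorem exists_bound_of_condD (hD : D.CondD p qd) (he : 1 < 1 / p + 1 / qd) {r : ℝ}
    (hr : 1 / r = 1 / p + 1 / qd - 1) :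
    ∃ n : DCoset H K → ℝ≥0∞, Measurable n ∧ (∀ᵐ d ∂D.μHK, ∀ x y, DCoset.mk H K (x, y) = d →
      F.bound x y ≤ n d) ∧ ∫⁻ d, n d ^ r ∂D.μHK < ∞ := by
  obtain ⟨C, hC⟩ := exists_generic_MN_le hD
  refine F.exists_bound hD.1.le hD.2.1.le he hr (C := C)
    (((generic_stab_of_condD hD).and hC).mono fun x y h => ⟨_, _, h.1, ?_⟩)
  rw [← MN_eq hD.1.le hD.2.1.le]
  exact h.2

theorem generic_good_of_condD (hD : D.CondD p qd) (he : 1 < 1 / p + 1 / qd) :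
    D.Generic F.Good := by
  obtain ⟨n, hn, hb, hnr⟩ := F.exists_bound_of_condD hD he (r := 1 / (1 / p + 1 / qd - 1))
    (one_div_one_div _)
  exact F.generic_good ((generic_stab_of_condD hD).mono fun x y h => h.wt)
    (one_div_pos.2 (by linarith)) hn hb hnr

/-- The exponent of the orbit integral is now zero, so the estimate is pointwise and needs no
integration over `Υ`. -/
theorem bound_le_of_condD (hD : D.CondD p qd) (he : 1 / p + 1 / qd = 1) :
    D.Generic fun x y => F.bound x y ≤ D.M qd x y * D.N p x y * F.cost := by
  refine (generic_stab_of_condD hD).mono fun x y h => ?_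
  rw [F.bound_eq_tsum h.wt, cost, ← ENNReal.tsum_mul_left]
  refine ENNReal.tsum_le_tsum fun i => ?_
  refine (h.termBound_le hD.1.le hD.2.1.le he.ge i).trans_eq ?_
  have := lpNorm_combine (lpNorm D.μH p (F.f i)) (lpNorm D.μK qd (F.g i)) hD.1.le hD.2.1.le he.ge
  rw [he, sub_self, ENNReal.rpow_zero, one_mul] at this ⊢
  rw [this, MN_eq hD.1.le hD.2.1.le]

theorem generic_good_of_condD_eq (hD : D.CondD p qd) (he : 1 / p + 1 / qd = 1) :
    D.Generic F.Good := by
  obtain ⟨C, hC⟩ := exists_generic_MN_le hD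
  filter_upwards [D.generic_lam, generic_stab_of_condD hD, hC, F.bound_le_of_condD hD he] with d
    h1 h2 h3 h4 x y hxy
  refine ⟨h1 x y hxy, (h2 x y hxy).wt, ne_top_of_le_ne_top ?_ (h4 x y hxy)⟩
  exact ENNReal.mul_ne_top (ne_top_of_le_ne_top ENNReal.coe_ne_top (h3 x y hxy)) F.summable

theorem supNorm_Psi_le (hD : D.CondD p qd) (he : 1 / p + 1 / qd = 1) :
    supNorm F.Psi ≤ D.S p qd * F.cost := by
  refine essSup_le_of_ae_le _ ?_
  have h1 := ((F.generic_good_of_condD_eq hD he).and (F.bound_le_of_condD hD he)).ae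
  have h2 : ∀ᵐ w ∂((rightHaar G).prod (rightHaar G)),
      D.M qd w.1 w.2 * D.N p w.1 w.2 ≤ D.S p qd := ENNReal.ae_le_essSup _
  filter_upwards [h1, h2] with w hw1 hw2
  exact (hw1.1.enorm_Psi_le.trans hw1.2).trans (by gcongr)

theorem Psi_mem_LInf (hD : D.CondD p qd) (he : 1 / p + 1 / qd = 1) : F.Psi ∈ LInf π γ := by
  refine ⟨F.measurableSection_Psi (F.generic_good_of_condD_eq hD he),
    (F.supNorm_Psi_le hD he).trans_lt ?_⟩
  obtain ⟨-, -, -, -, C, hC⟩ := hD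
  have hS : D.S p qd ≤ C := essSup_le_of_ae_le _ hC
  exact ENNReal.mul_lt_top (hS.trans_lt ENNReal.coe_lt_top) F.summable.lt_top

theorem Psi_mem_LrDom (hD : D.CondD p qd) (he : 1 < 1 / p + 1 / qd) {r : ℝ}
    (hr : 1 / r = 1 / p + 1 / qd - 1) : F.Psi ∈ LrDom π γ D r := by
  obtain ⟨n, hn, hb, hnr⟩ := F.exists_bound_of_condD hD he hr
  have hg := F.generic_good_of_condD hD he
  refine ⟨F.measurableSection_Psi hg, n, hn, ?_, hnr⟩
  filter_upwards [hg, hb] with d h1 h2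
  rintro ⟨x, y⟩ hw
  exact (h1 x y hw).enorm_Psi_le.trans (h2 x y hw)

theorem Psi_mem_LrΔ₂_of_condD (hπ : ∀ v : V, Continuous fun h => π h v)
    (hγ : ∀ w : W, Continuous fun k => γ k w) (hD : D.CondD p qd) (he : 1 < 1 / p + 1 / qd)
    {r : ℝ} (hr : 1 / r = 1 / p + 1 / qd - 1) (hM : D.MNDescends p qd) :
    F.Psi ∈ LrΔ₂ π γ D r := by
  obtain ⟨n, hn, hb, hnr⟩ := F.exists_bound_of_condD hD he hr
  exact F.Psi_mem_LrΔ₂ hπ hγ (F.generic_good_of_condD hD he) (generic_wt_eq_one hD hM)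
    (one_div_pos.1 (by linarith)) hb hnr

end TensorSeries

end ApqSpace

end

/-! ### Assembly of the cases -/

open ApqSpace
theorem proposition4p16
    {G : Type*} [Group G] [TopologicalSpace G] [IsTopologicalGroup G] [LocallyCompactSpace G]
    [SecondCountableTopology G] [T2Space G] [MeasurableSpace G] [BorelSpace G]
    (H K : Subgroup G) [IsClosed (H : Set G)] [IsClosed (K : Set G)]
    (_hHK : RegularlyRelated H K)
    {V W : Type*} [NormedAddCommGroup V] [NormedSpace ℂ V] [CompleteSpace V]
    [TopologicalSpace.SeparableSpace V]
    [NormedAddCommGroup W] [NormedSpace ℂ W] [CompleteSpace W]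
    [TopologicalSpace.SeparableSpace W] [TopologicalSpace.SeparableSpace (StrongDual ℂ W)]
    (π : H →* (V ≃ₗᵢ[ℂ] V)) (_hπ : ∀ v : V, Continuous fun h => π h v)
    (γ : K →* (W ≃ₗᵢ[ℂ] W)) (_hγ : ∀ w : W, Continuous fun k => γ k w)
    (D : CosetMeasures H K) (p qd : ℝ) (_hp : 1 ≤ p) (_hqd : 1 ≤ qd) :
    -- (1)
    ((D.CondA p qd ∨ D.CondB ∨ (p = 1 ∧ qd = 1)) →
      (∀ F : TensorSeries π γ D p qd, F.Converges) ∧ Apq π γ D p qd ⊆ LrΔ₂ π γ D 1) ∧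
    (D.CondB → D.IsImageMeasure → 1 < 1 / p + 1 / qd →
      ∀ r : ℝ, 1 / r = 1 / p + 1 / qd - 1 → Apq π γ D p qd ⊆ LrΔ₂ π γ D r) ∧
    -- (2)
    (D.CondD p qd → 1 < 1 / p + 1 / qd →
      (∀ F : TensorSeries π γ D p qd, F.Converges) ∧
      ∀ r : ℝ, 1 / r = 1 / p + 1 / qd - 1 →
        Apq π γ D p qd ⊆ LrDom π γ D r ∧
        (D.MNDescends p qd → Apq π γ D p qd ⊆ LrΔ₂ π γ D r)) ∧
    -- (3)
    (D.CondD p qd → 1 / p + 1 / qd = 1 →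
      (∀ F : TensorSeries π γ D p qd, F.Converges) ∧
      Apq π γ D p qd ⊆ LInf π γ ∧
      ∀ F : TensorSeries π γ D p qd, supNorm F.Psi ≤ D.S p qd * F.cost) := by
  refine ⟨fun h => ⟨converges_of_condABC _hp _hqd h, Apq_subset_LrΔ₂_one _hπ _hγ _hp _hqd h⟩,
    fun hB hI he r hr => Apq_subset_LrΔ₂_of_condB _hπ _hγ _hp _hqd hB hI he hr,
    fun hD he => ⟨fun F => TensorSeries.converges_of_good (F.generic_good_of_condD hD he),
      fun r hr => ⟨?_, fun hM => ?_⟩⟩,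
    fun hD he => ⟨fun F => TensorSeries.converges_of_good (F.generic_good_of_condD_eq hD he), ?_,
      fun F => F.supNorm_Psi_le hD he⟩⟩
  · rintro _ ⟨F, rfl⟩
    exact F.Psi_mem_LrDom hD he hr
  · rintro _ ⟨F, rfl⟩
    exact F.Psi_mem_LrΔ₂_of_condD _hπ _hγ hD he hr hM
  · rintro _ ⟨F, rfl⟩
    exact F.Psi_mem_LInf hD he
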